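/- **Lemma 2.1.** Let $n\ge 3$, let $A=(A^1,\dots,A^n):\mathbb R^n\to\mathbb R^n$ and $V:\mathbb R^n\to\mathbb R$ be of class $C^1$, and write $\nabla_A=\nabla-iA$, $H=-\nabla_A^2+V$, $B_{ij}=\partial_{x_j}A^i-\partial_{x_i}A^j$, $(B_\tau)_j=\sum_i\frac{x_i}{|x|}B_{ij}$, $\partial_rV=\frac{x}{|x|}\cdot\nabla V$. Let $\lambda\ge 0$, $\epsilon\neq 0$, $f\in L^2(\mathbb R^n;\mathbb C)$, and let $u\in\mathcal H^1$, that is, $u\in L^2$ is weakly differentiable with $\nabla_Au\in L^2$ and $\int|V||u|^2<\infty$, be a weak solution of $$-Hu+(\lambda\pm i\epsilon)u=f$$ (tested against all complex-valued $C_c^\infty$ functions), for one choice of the sign $\pm$. Let $\phi(|x|),\varphi(|x|)$ be two real radial multipliers such that $\phi\in C^2((0,\infty))$ and, for some constant $C$ and all $0<r<s$, $$|\phi'(r)|\le C(1+r),\quad |\phi''(r)|\le C(1+\tfrac1r),\quad |\varphi(r)|\le C,$$ $$|\phi''(s)-\phi''(r)|+|\varphi(s)-\varphi(r)|\le C(1+\tfrac1{r^2})(s-r).$$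 Suppose that the functions $$\phi'(\partial_rV)|u|^2,\qquad \phi'\,u\,B_\tau\cdot\overline{\nabla_Au},\qquad f\,\nabla\phi\cdot\overline{\nabla_Au},\qquad u\,\nabla\phi\cdot\overline{\nabla_Au}$$ are integrable on $\mathbb R^n$. Then $$\nabla_Au\,D^2\phi\,\overline{\nabla_Au},\quad \varphi|\nabla_Au|^2,\quad [\tfrac12\phi'\partial_rV+\varphi V]|u|^2,\quad \varphi|u|^2,\quad f(\nabla\phi\cdot\overline{\nabla_Au}+\tfrac12(\Delta\phi)\bar u),\quad f\varphi\bar u$$ are integrable as well, and $$\int \nabla_A u\, D^2\phi\, \overline{\nabla_A u}\,dx-\int\varphi|\nabla_Au|^2dx-\int\Big(\tfrac14\Delta^2\phi-\tfrac12\Delta\varphi\Big)|u|^2dx-\int\Big[\tfrac12\phi'(\partial_rV)+\varphi V\Big]|u|^2dx$$ $$+\,\Im\int\phi'\,u\,B_\tau\cdot\overline{\nabla_Au}\,dx+\lambda\int\varphi|u|^2dx$$ $$=-\Re\int f\Big(\nabla\phi\cdot\overline{\nabla_Au}+\tfrac12(\Delta\phi)\bar u\Big)dx+\Re\int f\varphi\,\bar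 u\,dx\mp\epsilon\,\Im\int u\,\nabla\phi\cdot\overline{\nabla_Au}\,dx .$$ Here $D^2\phi,\Delta\phi,\Delta^2\phi$ are the Hessian, Laplacian and bi-Laplacian of $x\mapsto\phi(|x|)$, $\Delta\varphi$ is the Laplacian of $x\mapsto\varphi(|x|)$, and the identity holds whenever its third integral has a meaning in one of the following two senses: * (classical) $x\mapsto\phi(|x|)$ is $C^4$ and $x\mapsto\varphi(|x|)$ is $C^2$ on $\mathbb R^n$, and $(\frac14\Delta^2\phi-\frac12\Delta\varphi)|u|^2$ is integrable; * (distributional) the distribution $\frac14\Delta^2\phi-\frac12\Delta\varphi$ equals $\mu_1-\mu_2$ with two locally finite positive Borel measures, $|u|^2$ is integrable for $\mu_1$ and $\mu_2$, and $\mu_1$- and $\mu_2$-almost every $x$ is a Lebesgue point of $|u|^2$, i.e. $\lim_{\rho\downarrow0}$ of the average of $\big||u(y)|^2-|u(x)|^2\big|$ over $y\in B(x,\rho)$ is $0$; the third integral is then $\int|u|^2d\mu_1-\int|u|^2d\mu_2$. -/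

import Mathlib

open MeasureTheory Set Filter Topology
open scoped ContDiff

noncomputable section

namespace MagneticMorawetz

/-- Euclidean space `ℝⁿ`. -/
abbrev Eu (n : ℕ) : Type := EuclideanSpace ℝ (Fin n)

variable {n : ℕ}

/-- The classical partial derivative `∂_j F (x)`. -/
def pd {F : Type*} [NormedAddCommGroup F] [NormedSpace ℝ F]
    (j : Fin n) (w : Eu n → F) (x : Eu n) : F :=
  fderiv ℝ w x (EuclideanSpace.single j 1)

/-- A smooth compactly supported function on `ℝⁿ`. -/
def IsTest {F : Type*} [NormedAddCommGroup F] [NormedSpace ℝ F] (w : Eu n → F) : Prop :=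
  ContDiff ℝ ∞ w ∧ HasCompactSupport w

/-- `G` is the weak (distributional) gradient of `u`: both are locally integrable and
`∫ u ∂_j ψ = - ∫ G_j ψ` for every real test function `ψ`. -/
def HasWeakGradient (u : Eu n → ℂ) (G : Fin n → Eu n → ℂ) : Prop :=
  LocallyIntegrable u volume ∧ ∀ j : Fin n, LocallyIntegrable (G j) volume ∧
    ∀ ψ : Eu n → ℝ, IsTest ψ →
      ∫ x, u x * ((pd j ψ x : ℝ) : ℂ) = - ∫ x, G j x * (ψ x : ℂ)

/-- The `j`-th component of `∇_A u = ∇ u - i A u`, where `G = ∇ u`. -/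
def magGrad (A : Eu n → Eu n) (u : Eu n → ℂ) (G : Fin n → Eu n → ℂ) (j : Fin n) (x : Eu n) : ℂ :=
  G j x - Complex.I * (A x j : ℂ) * u x

/-- `|∇_A u|²`. -/
def magGradSq (A : Eu n → Eu n) (u : Eu n → ℂ) (G : Fin n → Eu n → ℂ) (x : Eu n) : ℝ :=
  ∑ j, ‖magGrad A u G j x‖ ^ 2

/-- `u`, with weak gradient `G`, belongs to the form domain of `H = -∇_A² + V`:
`u ∈ L²`, `∇_A u ∈ L²` and `∫ |V| |u|² < ∞`. -/
structure IsFormDomain (A : Eu n → Eu n) (V : Eu n → ℝ) (u : Eu n → ℂ)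
    (G : Fin n → Eu n → ℂ) : Prop where
  memLp : MemLp u 2 volume
  weakGradient : HasWeakGradient u G
  magGrad_memLp : ∀ j, MemLp (magGrad A u G j) 2 volume
  potential : Integrable (fun x => |V x| * ‖u x‖ ^ 2) volume

/-- `u`, with weak gradient `G`, solves `-H u + z u = f`, that is `∇_A² u - V u + z u = f`,
in the weak sense: for every complex test function `ψ`,
`- ∫ ∇_A u · conj (∇_A ψ) - ∫ V u conj ψ + z ∫ u conj ψ = ∫ f conj ψ`. -/
def IsWeakSolution (A : Eu n → Eu n) (V : Eu n → ℝ) (z : ℂ) (f u : Eu n → ℂ)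
    (G : Fin n → Eu n → ℂ) : Prop :=
  ∀ ψ : Eu n → ℂ, IsTest ψ →
    - (∫ x, ∑ j, magGrad A u G j x * star (magGrad A ψ (fun k => pd k ψ) j x))
      - (∫ x, (V x : ℂ) * u x * star (ψ x)) + z * (∫ x, u x * star (ψ x))
      = ∫ x, f x * star (ψ x)

/-- The magnetic field `B = DA - (DA)ᵗ`, that is `B_{ij} = ∂A^i/∂x_j - ∂A^j/∂x_i`. -/
def magField (A : Eu n → Eu n) (x : Eu n) : Matrix (Fin n) (Fin n) ℝ :=
  Matrix.of fun i j => pd j A x i - pd i A x j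

/-- The tangential component `B_τ(x) = (x / |x|) B(x)` (row vector times matrix). -/
def magTangential (A : Eu n → Eu n) (x : Eu n) : Fin n → ℝ :=
  Matrix.vecMul (fun i => x i / ‖x‖) (magField A x)

/-- The radial derivative `∂_r V (x) = ∇V(x) · x / |x|`. -/
def radialDeriv (V : Eu n → ℝ) (x : Eu n) : ℝ :=
  fderiv ℝ V x (‖x‖⁻¹ • x)

/-- The radial function on `ℝⁿ` with profile `φ`. -/
def radial (φ : ℝ → ℝ) (x : Eu n) : ℝ := φ ‖x‖

/-- The (real) quadratic form `∇_A u D²Φ conj (∇_A u) = ∑_{ij} ∂_i∂_jΦ (∇_A u)_i conj (∇_A u)_j`. -/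
def hessTerm (Φ : Eu n → ℝ) (A : Eu n → Eu n) (u : Eu n → ℂ) (G : Fin n → Eu n → ℂ)
    (x : Eu n) : ℝ :=
  (∑ i, ∑ j, ((pd i (pd j Φ) x : ℝ) : ℂ) * magGrad A u G i x * star (magGrad A u G j x)).re

/-- `∇Φ · conj (∇_A u)`. -/
def gradTerm (Φ : Eu n → ℝ) (A : Eu n → Eu n) (u : Eu n → ℂ) (G : Fin n → Eu n → ℂ)
    (x : Eu n) : ℂ :=
  ∑ j, ((pd j Φ x : ℝ) : ℂ) * star (magGrad A u G j x)

/-- `B_τ · conj (∇_A u)`. -/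
def tangTerm (A : Eu n → Eu n) (u : Eu n → ℂ) (G : Fin n → Eu n → ℂ) (x : Eu n) : ℂ :=
  ∑ j, ((magTangential A x j : ℝ) : ℂ) * star (magGrad A u G j x)

/-- Regularity and growth of the profiles of a pair of radial multipliers `φ(|x|)`, `θ(|x|)`.
Both profiles may be singular at `r = 0` (so `φ(|x|) = |x|` is allowed), the second derivative of
`φ` and `θ` itself need only be locally Lipschitz on `(0, ∞)` (so their second derivatives may
jump in the distributional sense), and `φ'` may grow linearly (so `φ(|x|) = |x|²` is allowed). -/
structure AdmissibleMultipliers (φ θ : ℝ → ℝ) : Prop where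
  contDiffOn : ContDiffOn ℝ 2 φ (Ioi 0)
  bounds : ∃ C : ℝ, ∀ r : ℝ, 0 < r →
    |deriv φ r| ≤ C * (1 + r) ∧
    |deriv (deriv φ) r| ≤ C * (1 + 1 / r) ∧
    |θ r| ≤ C ∧
    ∀ s : ℝ, r < s →
      |deriv (deriv φ) s - deriv (deriv φ) r| ≤ C * (1 + 1 / r ^ 2) * (s - r) ∧
      |θ s - θ r| ≤ C * (1 + 1 / r ^ 2) * (s - r)

/-- `x` is a Lebesgue point of `w`. -/
def IsLebesguePoint (w : Eu n → ℝ) (x : Eu n) : Prop :=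
  Tendsto (fun ρ : ℝ => ⨍ y in Metric.ball x ρ, |w y - w x|) (𝓝[>] 0) (𝓝 0)

/-- `T = ∫ (¼ Δ²Φ - ½ ΔΘ) |u|² dx` with classical derivatives:
`Φ` is `C⁴`, `Θ` is `C²` and the integral converges absolutely. -/
def ClassicalBilaplacianTerm (Φ Θ : Eu n → ℝ) (u : Eu n → ℂ) (T : ℝ) : Prop :=
  ContDiff ℝ 4 Φ ∧ ContDiff ℝ 2 Θ ∧
    Integrable (fun x => ((1 / 4) * Laplacian.laplacian (Laplacian.laplacian Φ) x
      - (1 / 2) * Laplacian.laplacian Θ x) * ‖u x‖ ^ 2) volume ∧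
    T = ∫ x, ((1 / 4) * Laplacian.laplacian (Laplacian.laplacian Φ) x
      - (1 / 2) * Laplacian.laplacian Θ x) * ‖u x‖ ^ 2

/-- `T = ∫ |u|² d(¼ Δ²Φ - ½ ΔΘ)` when the distribution `¼ Δ²Φ - ½ ΔΘ` is a signed measure
`μ₁ - μ₂` (such as surface measure on a sphere or a Dirac mass at the origin), `|u|²` is integrable
for it, and the values of `|u|²` are Lebesgue values almost everywhere for it. -/
def DistributionalBilaplacianTerm (Φ Θ : Eu n → ℝ) (u : Eu n → ℂ) (T : ℝ) : Prop :=
  ∃ μ₁ μ₂ : Measure (Eu n), IsFiniteMeasureOnCompacts μ₁ ∧ IsFiniteMeasureOnCompacts μ₂ ∧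
    (∀ ψ : Eu n → ℝ, IsTest ψ →
      ∫ x, ((1 / 4) * Φ x * Laplacian.laplacian (Laplacian.laplacian ψ) x
          - (1 / 2) * Θ x * Laplacian.laplacian ψ x)
        = (∫ x, ψ x ∂μ₁) - ∫ x, ψ x ∂μ₂) ∧
    Integrable (fun x => ‖u x‖ ^ 2) μ₁ ∧ Integrable (fun x => ‖u x‖ ^ 2) μ₂ ∧
    (∀ᵐ x ∂μ₁, IsLebesguePoint (fun y => ‖u y‖ ^ 2) x) ∧
    (∀ᵐ x ∂μ₂, IsLebesguePoint (fun y => ‖u y‖ ^ 2) x) ∧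
    T = (∫ x, ‖u x‖ ^ 2 ∂μ₁) - ∫ x, ‖u x‖ ^ 2 ∂μ₂

end MagneticMorawetz

end

/-! Formally, the equation is paired with ∇φ·conj(∇_A u) + ½(Δφ)ū and with θū, real parts are taken,
and one integrates by parts. Write W = |u|² and z for the spectral parameter, so that Re z = λ. Two
facts organise the computation. First, W has the weak Laplacian `lapSq`, namely ΔW = 2|∇_A u|² + 2(V
− Re z)W + 2 Re(f ū). Second, for a vector field X the field Σ_k X_k Re(D_j u conj D_k u) − ½X_j|∇_A
u|² has a divergence containing only the covariant Laplacian, DX and the commutator of covariant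
derivatives, which is the magnetic field (`virial_eq_sum_pd`).

Eliminating |∇_A u|² from the div X term by means of ΔW, and integrating the V and Re z terms by
parts, gives `integral_virialDensity`. For X = ∇φ this is the first multiplier identity, with the
term ¼∫ Δφ ΔW. The second multiplier needs no integration by parts at this stage: it is the formula
for ΔW multiplied by θ. Hence `integral_identity`, in which ½∫ (½Δφ − θ) ΔW stands for the third
integral. It remains to move the Laplacian from W to the weight.

Regularity: since A and V are C¹, expanding the equation puts Δu in L²_loc
(`weakJet_of_isWeakSolution`). All identities are quadratic in (u, ∇u, Δu) and contain no other
second derivatives, so they pass from mollifications of u to u without elliptic regularity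
(`WeakJet.integral_quadratic_eq_zero`).

Origin and infinity: D²φ is only O(1 + 1/|x|) and ∇φ is O(1 + |x|). For n ≥ 3, Hardy's inequality
gives |u|²/|x|² ∈ L¹, and testing ΔW against a regularisation of the superharmonic function 1/|x|
gives |∇_A u|²/|x| ∈ L¹. Therefore weights O(1 + 1/|x|) are harmless. The virial identity is applied
to η_m∇φ with annular cutoffs satisfying |x||∇η_m| ≤ K, so the cutoff errors are dominated by such a
weight and tend to zero pointwise.

The bilaplacian as a measure: if ¼Δ²φ − ½Δθ = μ₁ − μ₂, this distribution is tested with η S_N(W_m),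
where W_m is the mollification of W and S_N(t) = Nt/(N+t). For the measures, truncation gives the
dominant Nη, and Lebesgue points give convergence. For the volume integral, |∇W|² ≤ 4W|∇_A u|²
bounds the S_N'' term uniformly in N, and the A₁ property of 1/|x| controls mollification against
the singular weight. Letting first m → ∞ and then N → ∞ together with η → 1 yields
`distributional_term_eq`. The classical case is the special case of a continuous density. -/

open MeasureTheory Set Filter Topology
open scoped ContDiff
noncomputable section
namespace MagneticMorawetz
variable {n : ℕ}


/-! ### Limit theorems for integrals and a weighted Cauchy–Schwarz inequality -/

section Limits

variable {α F : Type*} [MeasurableSpace α] {μ : Measure α} [NormedAddCommGroup F]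
  [NormedSpace ℝ F]

/-- Pratt's lemma: dominated convergence with a convergent sequence of bounds. -/
theorem tendsto_integral_of_tendsto_bound {f : ℕ → α → F} {f' : α → F} {g : ℕ → α → ℝ} {g' : α → ℝ}
    (hf : ∀ m, AEStronglyMeasurable (f m) μ) (hg : ∀ m, Integrable (g m) μ) (hg' : Integrable g' μ)
    (hfg : ∀ m, ∀ᵐ x ∂μ, ‖f m x‖ ≤ g m x)
    (hlimf : ∀ᵐ x ∂μ, Tendsto (fun m => f m x) atTop (𝓝 (f' x)))
    (hlimg : ∀ᵐ x ∂μ, Tendsto (fun m => g m x) atTop (𝓝 (g' x)))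
    (hint : Tendsto (fun m => ∫ x, g m x ∂μ) atTop (𝓝 (∫ x, g' x ∂μ))) :
    Integrable f' μ ∧ Tendsto (fun m => ∫ x, f m x ∂μ) atTop (𝓝 (∫ x, f' x ∂μ)) := by
  have hf'm : AEStronglyMeasurable f' μ := aestronglyMeasurable_of_tendsto_ae atTop hf hlimf
  have hf'g : ∀ᵐ x ∂μ, ‖f' x‖ ≤ g' x := by
    filter_upwards [ae_all_iff.2 hfg, hlimf, hlimg] with x h1 h2 h3
    exact le_of_tendsto_of_tendsto' h2.norm h3 h1
  have hf'i : Integrable f' μ := hg'.mono' hf'm hf'g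
  have hfi : ∀ m, Integrable (f m) μ := fun m => (hg m).mono' (hf m) (hfg m)
  refine ⟨hf'i, ?_⟩
  -- Scheffé's argument: the bounds `g m` are nonnegative almost everywhere, so the positive part of
  -- `g' - g m` is dominated by `|g'|`. Together with convergence of the integrals this gives `g m →
  -- g'` in L¹.
  have hpos : Tendsto (fun m => ∫ x, max (g' x - g m x) 0 ∂μ) atTop (𝓝 0) := by
    have : Tendsto (fun m => ∫ x, max (g' x - g m x) 0 ∂μ) atTop (𝓝 (∫ _x, (0 : ℝ) ∂μ)) := by
      refine tendsto_integral_of_dominated_convergence (fun x => |g' x|)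
        (fun m => ((hg'.sub (hg m)).pos_part).1) hg'.abs (fun m => ?_) ?_
      · filter_upwards [hfg m] with x hx
        have h0 := (norm_nonneg _).trans hx
        rw [Real.norm_of_nonneg (le_max_right _ _)]
        refine max_le ?_ (abs_nonneg _)
        have := le_abs_self (g' x)
        linarith
      · filter_upwards [hlimg] with x hx
        have h1 : Tendsto (fun m => max (g' x - g m x) 0) atTop (𝓝 (max (g' x - g' x) 0)) :=
          (tendsto_const_nhds.sub hx).max tendsto_const_nhds
        simpa using h1
    simpa using this
  have hdiff : Tendsto (fun m => ∫ x, |g m x - g' x| ∂μ) atTop (𝓝 0) := by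
    have h1 : ∀ m, ∫ x, |g m x - g' x| ∂μ
        = (∫ x, g m x ∂μ) - (∫ x, g' x ∂μ) + 2 * ∫ x, max (g' x - g m x) 0 ∂μ := by
      intro m
      have h2 : Integrable (fun x => g m x - g' x) μ := (hg m).sub hg'
      have h3 : Integrable (fun x => 2 * max (g' x - g m x) 0) μ :=
        (hg'.sub (hg m)).pos_part.const_mul 2
      rw [← integral_sub (hg m) hg', ← integral_const_mul, ← integral_add h2 h3]
      refine integral_congr_ae (Eventually.of_forall fun x => ?_)
      dsimp only
      rcases le_total (g m x) (g' x) with h | h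
      · rw [abs_of_nonpos (by linarith), max_eq_left (by linarith)]; ring
      · rw [abs_of_nonneg (by linarith), max_eq_right (by linarith)]; ring
    simp_rw [h1]
    have := (hint.sub_const (∫ x, g' x ∂μ)).add (hpos.const_mul 2)
    simpa using this
  -- Since `‖f m - f'‖ ≤ g m + g' ≤ |g m - g'| + 2|g'|`, the part of the difference above the level
  -- `2|g'|` is controlled by the L¹ distance just estimated. The part below that level is
  -- dominated.
  have hmin : Tendsto (fun m => ∫ x, min ‖f m x - f' x‖ (2 * |g' x|) ∂μ) atTop (𝓝 0) := by
    have : Tendsto (fun m => ∫ x, min ‖f m x - f' x‖ (2 * |g' x|) ∂μ) atTop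
        (𝓝 (∫ _x, (0 : ℝ) ∂μ)) := by
      refine tendsto_integral_of_dominated_convergence (fun x => 2 * |g' x|)
        (fun m => (((hf m).sub hf'm).norm.inf (hg'.abs.const_mul 2).1)) (hg'.abs.const_mul 2)
        (fun m => Eventually.of_forall fun x => ?_) ?_
      · rw [Real.norm_of_nonneg (le_min (norm_nonneg _) (by positivity))]
        exact min_le_right _ _
      · filter_upwards [hlimf] with x hx
        have h1 : Tendsto (fun m => min ‖f m x - f' x‖ (2 * |g' x|)) atTop
            (𝓝 (min ‖f' x - f' x‖ (2 * |g' x|))) :=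
          ((hx.sub tendsto_const_nhds).norm).min tendsto_const_nhds
        simpa using h1
    simpa using this
  have hL1 : Tendsto (fun m => ∫ x, ‖f m x - f' x‖ ∂μ) atTop (𝓝 0) := by
    refine squeeze_zero (fun m => integral_nonneg fun x => norm_nonneg _) (fun m => ?_)
      (by simpa using hdiff.add hmin)
    have him : Integrable (fun x => min ‖f m x - f' x‖ (2 * |g' x|)) μ :=
      ((hfi m).sub hf'i).norm.inf (hg'.abs.const_mul 2)
    have hgi : Integrable (fun x => |g m x - g' x|) μ := ((hg m).sub hg').abs
    rw [← integral_add hgi him]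
    refine integral_mono_ae ((hfi m).sub hf'i).norm (hgi.add him) ?_
    filter_upwards [hfg m, hf'g] with x h1 h2
    have h3 := norm_sub_le (f m x) (f' x)
    have h4 := le_abs_self (g m x - g' x)
    have h5 := le_abs_self (g' x)
    rcases le_total ‖f m x - f' x‖ (2 * |g' x|) with h | h
    · rw [min_eq_left h]; linarith [abs_nonneg (g m x - g' x)]
    · rw [min_eq_right h]; linarith
  rw [tendsto_iff_norm_sub_tendsto_zero]
  refine squeeze_zero (fun m => norm_nonneg _) (fun m => ?_) hL1
  rw [← integral_sub (hfi m) hf'i]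
  exact norm_integral_le_integral_norm _

/-- The quadratic polynomial t ↦ ∫ k (t a + b)² is nonnegative, so its discriminant is nonpositive.
-/
theorem sq_integral_mul_le {a b : α → ℝ} (k : α → ℝ) (hk : ∀ x, 0 ≤ k x)
    (hab : Integrable (fun x => k x * (a x * b x)) μ)
    (ha : Integrable (fun x => k x * a x ^ 2) μ) (hb : Integrable (fun x => k x * b x ^ 2) μ) :
    (∫ x, k x * (a x * b x) ∂μ) ^ 2 ≤ (∫ x, k x * a x ^ 2 ∂μ) * ∫ x, k x * b x ^ 2 ∂μ := by
  set p := ∫ x, k x * a x ^ 2 ∂μ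
  set q := ∫ x, k x * b x ^ 2 ∂μ
  set r := ∫ x, k x * (a x * b x) ∂μ
  have h : ∀ t : ℝ, 0 ≤ p * (t * t) + (2 * r) * t + q := by
    intro t
    have h1 : ∫ x, k x * (t * a x + b x) ^ 2 ∂μ = p * (t * t) + (2 * r) * t + q := by
      have : ∀ x, k x * (t * a x + b x) ^ 2
          = (t * t) * (k x * a x ^ 2) + (2 * t) * (k x * (a x * b x)) + k x * b x ^ 2 := by
        intro x; ring
      simp_rw [this]
      have i1 : Integrable (fun x => (t * t) * (k x * a x ^ 2)) μ := ha.const_mul _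
      have i2 : Integrable (fun x => (2 * t) * (k x * (a x * b x))) μ := hab.const_mul _
      have i3 : Integrable (fun x => (t * t) * (k x * a x ^ 2) + (2 * t) * (k x * (a x * b x))) μ :=
        i1.add i2
      rw [integral_add i3 hb, integral_add i1 i2, integral_const_mul, integral_const_mul]
      ring
    rw [← h1]
    exact integral_nonneg fun x => mul_nonneg (hk x) (sq_nonneg _)
  have := discrim_le_zero h
  rw [discrim] at this
  nlinarith

end Limits

/-! ### Mollification: smoothness, convergence, and integrals against a weight -/

section Mollify

variable {F : Type*} [NormedAddCommGroup F] [NormedSpace ℝ F]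

/-- A sequence of bump functions at the origin, with radii of order `1 / (m + 1)`. -/
def bump (n m : ℕ) : ContDiffBump (0 : Eu n) where
  rIn := 1 / (m + 1)
  rOut := 2 / (m + 1)
  rIn_pos := by positivity
  rIn_lt_rOut := by gcongr; norm_num

/-- The mollifier `η_m`. -/
def ker (n m : ℕ) : Eu n → ℝ := (bump n m).normed volume

/-- The mollification `η_m * g`. -/
def mollify (m : ℕ) (g : Eu n → F) (x : Eu n) : F := ∫ y, ker n m (x - y) • g y

theorem ker_nonneg (m : ℕ) (x : Eu n) : 0 ≤ ker n m x := (bump n m).nonneg_normed x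

theorem contDiff_ker (m : ℕ) : ContDiff ℝ ∞ (ker n m) := (bump n m).contDiff_normed

theorem continuous_ker (m : ℕ) : Continuous (ker n m) := (bump n m).continuous_normed

theorem hasCompactSupport_ker (m : ℕ) : HasCompactSupport (ker n m) :=
  (bump n m).hasCompactSupport_normed

theorem ker_sub_comm (m : ℕ) (x y : Eu n) : ker n m (x - y) = ker n m (y - x) := by
  rw [← neg_sub]; exact (bump n m).normed_neg _

theorem ker_eq_zero {m : ℕ} {x : Eu n} (h : 2 / ((m : ℝ) + 1) ≤ ‖x‖) : ker n m x = 0 := by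
  have : x ∉ Function.support (ker n m) := by
    rw [ker, ContDiffBump.support_normed_eq]
    simpa [bump] using h
  simpa using this

theorem integral_ker_sub (m : ℕ) (x : Eu n) : ∫ y, ker n m (x - y) = 1 := by
  rw [integral_sub_left_eq_self (ker n m) volume x]
  exact (bump n m).integral_normed

theorem tendsto_rOut : Tendsto (fun m : ℕ => 2 / ((m : ℝ) + 1)) atTop (𝓝 0) := by
  have := (tendsto_one_div_add_atTop_nhds_zero_nat (𝕜 := ℝ)).const_mul 2
  simpa [div_eq_mul_inv] using this

theorem hasCompactSupport_ker_sub (m : ℕ) (x : Eu n) :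
    HasCompactSupport (fun y => ker n m (x - y)) :=
  (hasCompactSupport_ker m).comp_homeomorph (Homeomorph.subLeft x)

theorem integrable_ker_smul {g : Eu n → F} (hg : LocallyIntegrable g volume) (m : ℕ) (x : Eu n) :
    Integrable (fun y => ker n m (x - y) • g y) volume :=
  hg.integrable_smul_left_of_hasCompactSupport
    ((continuous_ker m).comp (continuous_const.sub continuous_id)) (hasCompactSupport_ker_sub m x)

theorem mollify_eq_convolution (m : ℕ) (g : Eu n → F) :
    mollify m g = MeasureTheory.convolution (ker n m) g (ContinuousLinearMap.lsmul ℝ ℝ) volume := by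
  ext x
  rw [convolution_eq_swap]
  rfl

theorem contDiff_mollify {g : Eu n → F} (hg : LocallyIntegrable g volume) (m : ℕ) :
    ContDiff ℝ ∞ (mollify m g) := by
  rw [mollify_eq_convolution]
  exact (hasCompactSupport_ker m).contDiff_convolution_left _ (contDiff_ker m) hg

theorem pd_mollify [CompleteSpace F] {g : Eu n → F} (hg : LocallyIntegrable g volume) (m : ℕ) (j : Fin n)
    (x : Eu n) :
    pd j (mollify m g) x = ∫ y, pd j (ker n m) (x - y) • g y := by
  rw [mollify_eq_convolution, pd,
    ((hasCompactSupport_ker m).hasFDerivAt_convolution_left _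
      ((contDiff_ker m).of_le (by norm_num)) hg x).fderiv, convolution_eq_swap,
      ContinuousLinearMap.integral_apply]
  · rfl
  · exact ((((hasCompactSupport_ker m).fderiv ℝ).convolutionExists_left _
      ((contDiff_ker m).continuous_fderiv (by norm_num)) hg) x).integrable_swap

theorem tendsto_mollify_ae [CompleteSpace F] {g : Eu n → F} (hg : LocallyIntegrable g volume) :
    ∀ᵐ x, Tendsto (fun m => mollify m g x) atTop (𝓝 (g x)) := by
  simp_rw [mollify_eq_convolution]
  -- The outer radius is always twice the inner one, which keeps the kernels comparable to
  -- normalised indicators of balls.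
  refine ContDiffBump.ae_convolution_tendsto_right_of_locallyIntegrable (φ := bump n) (K := 2)
    tendsto_rOut (Eventually.of_forall fun m => ?_) hg
  simp only [bump]
  exact le_of_eq (by ring)

/-- Spheres are null sets in positive dimension. Lebesgue points are defined with open balls,
whereas the mollifier estimate below uses closed ones. -/
theorem average_ball_eq_average_closedBall (hn : n ≠ 0) (h : Eu n → ℝ) (x : Eu n) (r : ℝ) :
    ⨍ y in Metric.ball x r, h y = ⨍ y in Metric.closedBall x r, h y := by
  have : Nonempty (Fin n) := ⟨⟨0, Nat.pos_of_ne_zero hn⟩⟩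
  have : Nontrivial (Eu n) := inferInstance
  refine setAverage_congr ?_
  rw [← Metric.ball_union_sphere]
  exact (union_ae_eq_left_of_ae_eq_empty (ae_eq_empty.2 (Measure.addHaar_sphere _ _ _))).symm

/-- Since the outer radius is twice the inner one, the kernel is at most 2ⁿ divided by the volume of
its supporting ball. The mollification error at the point is then at most 2ⁿ times the mean
oscillation over that ball. -/
theorem tendsto_mollify_of_isLebesguePoint (hn : n ≠ 0) {w : Eu n → ℝ}
    (hw : LocallyIntegrable w volume) {x : Eu n} (hx : IsLebesguePoint w x) :
    Tendsto (fun m => mollify m w x) atTop (𝓝 (w x)) := by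
  have hr : Tendsto (fun m => (bump n m).rOut) atTop (𝓝[>] 0) :=
    tendsto_nhdsWithin_iff.2 ⟨tendsto_rOut, Eventually.of_forall fun m => (bump n m).rOut_pos⟩
  have h := hx.comp hr
  refine tendsto_integral_smul_of_tendsto_average_norm_sub
    (a := fun m => Metric.closedBall x (bump n m).rOut) (2 ^ (Module.finrank ℝ (Eu n))) ?_ ?_ ?_ ?_ ?_
  · refine h.congr fun m => ?_
    simp only [Function.comp]
    rw [average_ball_eq_average_closedBall hn]
    rfl
  · filter_upwards with i using hw.integrableOn_isCompact (isCompact_closedBall _ _)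
  · exact tendsto_const_nhds.congr (fun m => (integral_ker_sub m x).symm)
  · filter_upwards with i y hy
    by_contra hc
    refine hy (ker_eq_zero ?_)
    simp only [Metric.mem_closedBall, not_le, dist_eq_norm'] at hc
    exact hc.le
  · filter_upwards with i y
    rw [abs_of_nonneg (ker_nonneg _ _), Measure.addHaar_real_closedBall_center]
    exact (bump n i).normed_le_div_measure_closedBall_rOut _ _ (le_of_eq (by simp only [bump]; ring)) _

/-- Jensen's inequality for the probability density `ker`, obtained from Cauchy–Schwarz with the
constant function 1 as second factor. -/
theorem norm_mollify_sq_le {g : Eu n → F} (hg : LocallyIntegrable g volume)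
    (hg2 : LocallyIntegrable (fun x => ‖g x‖ ^ 2) volume) (m : ℕ) (x : Eu n) :
    ‖mollify m g x‖ ^ 2 ≤ mollify m (fun y => ‖g y‖ ^ 2) x := by
  have h1 : ‖mollify m g x‖ ≤ ∫ y, ker n m (x - y) * (1 * ‖g y‖) := by
    refine (norm_integral_le_integral_norm _).trans (le_of_eq ?_)
    refine integral_congr_ae (Eventually.of_forall fun y => ?_)
    simp [norm_smul, abs_of_nonneg (ker_nonneg m (x - y))]
  have h2 := sq_integral_mul_le (μ := volume) (a := fun _ => (1 : ℝ)) (b := fun y => ‖g y‖)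
    (fun y => ker n m (x - y)) (fun y => ker_nonneg _ _)
    (by simpa using integrable_ker_smul (fun y => (hg y).norm) m x)
    (by simpa using integrable_ker_smul (g := fun _ => (1 : ℝ)) (locallyIntegrable_const 1) m x)
    (integrable_ker_smul hg2 m x)
  have h3 : ∫ y, ker n m (x - y) * (1 : ℝ) ^ 2 = 1 := by simpa using integral_ker_sub m x
  rw [h3, one_mul] at h2
  exact (pow_le_pow_left₀ (norm_nonneg _) h1 2).trans h2

theorem mollify_nonneg {g : Eu n → ℝ} (hg : ∀ x, 0 ≤ g x) (m : ℕ) (x : Eu n) :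
    0 ≤ mollify m g x :=
  integral_nonneg fun y => mul_nonneg (ker_nonneg _ _) (hg y)

theorem mollify_mono {g h : Eu n → ℝ} (hg : LocallyIntegrable g volume)
    (hh : LocallyIntegrable h volume) (hgh : ∀ x, g x ≤ h x) (m : ℕ) (x : Eu n) :
    mollify m g x ≤ mollify m h x :=
  integral_mono (integrable_ker_smul hg m x) (integrable_ker_smul hh m x)
    fun y => mul_le_mul_of_nonneg_left (hgh y) (ker_nonneg _ _)

theorem norm_mollify_le {g : Eu n → F} {h : Eu n → ℝ}
    (hh : LocallyIntegrable h volume) (hgh : ∀ x, ‖g x‖ ≤ h x) (m : ℕ) (x : Eu n) :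
    ‖mollify m g x‖ ≤ mollify m h x := by
  refine norm_integral_le_of_norm_le (integrable_ker_smul hh m x) (Eventually.of_forall fun y => ?_)
  rw [norm_smul, Real.norm_of_nonneg (ker_nonneg _ _)]
  exact mul_le_mul_of_nonneg_left (hgh y) (ker_nonneg _ _)

/-- Convergence of `∫ k (η_m * h)` when the mollifications of the weight `k` have a common bound. -/
theorem tendsto_integral_mul_mollify {k k' h : Eu n → ℝ} (hk : Integrable k volume)
    (hk0 : ∀ x, 0 ≤ k x) (hh : LocallyIntegrable h volume) (hh0 : ∀ x, 0 ≤ h x)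
    (hkk' : ∀ m, ∀ᵐ x, mollify m k x ≤ k' x) (hint : Integrable (fun x => k' x * h x) volume) :
    (∀ m, Integrable (fun x => k x * mollify m h x) volume) ∧
    Integrable (fun x => k x * h x) volume ∧
    Tendsto (fun m => ∫ x, k x * mollify m h x) atTop (𝓝 (∫ x, k x * h x)) := by
  have hkl := hk.locallyIntegrable
  have hmeas : ∀ m, AEStronglyMeasurable (fun x => mollify m k x * h x) volume := fun m =>
    (contDiff_mollify hkl m).continuous.aestronglyMeasurable.mul hh.aestronglyMeasurable
  have hbd : ∀ m, ∀ᵐ x, ‖mollify m k x * h x‖ ≤ k' x * h x := fun m =>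
    by
      filter_upwards [hkk' m] with x hx
      rw [Real.norm_of_nonneg (mul_nonneg (mollify_nonneg hk0 m x) (hh0 x))]
      exact mul_le_mul_of_nonneg_right hx (hh0 x)
  -- Joint integrability, needed for Fubini: integrating out the first variable leaves `mollify m k
  -- · h`, which is dominated by the integrable function `k' · h`.
  have hprod : ∀ m, Integrable (fun z : Eu n × Eu n => k z.1 * (ker n m (z.1 - z.2) * h z.2))
      (volume.prod volume) := by
    intro m
    have hm : AEStronglyMeasurable (fun z : Eu n × Eu n => k z.1 * (ker n m (z.1 - z.2) * h z.2))
        (volume.prod volume) :=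
      hk.1.comp_fst.mul ((((continuous_ker m).comp (continuous_fst.sub
        continuous_snd)).aestronglyMeasurable).mul hh.aestronglyMeasurable.comp_snd)
    rw [integrable_prod_iff' hm]
    refine ⟨Eventually.of_forall fun y => ?_, ?_⟩
    · have := (integrable_ker_smul hkl m y).mul_const (h y)
      refine this.congr (Eventually.of_forall fun x => ?_)
      simp only [smul_eq_mul, ker_sub_comm m y x]
      ring
    · have : Integrable (fun y => mollify m k y * h y) volume := hint.mono' (hmeas m) (hbd m)
      refine this.congr (Eventually.of_forall fun y => ?_)
      simp only [mollify, smul_eq_mul]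
      rw [← integral_mul_const]
      refine integral_congr_ae (Eventually.of_forall fun x => ?_)
      simp only
      rw [Real.norm_of_nonneg (mul_nonneg (hk0 x) (mul_nonneg (ker_nonneg _ _) (hh0 y))),
        ker_sub_comm m y x]
      ring
  -- The kernel is even, so Fubini moves the mollifier from `h`, which has no pointwise bound, to
  -- the weight `k`, which has one.
  have heq : ∀ m, ∫ x, k x * mollify m h x = ∫ y, mollify m k y * h y := by
    intro m
    have h1 : ∀ x, k x * mollify m h x = ∫ y, k x * (ker n m (x - y) * h y) := fun x => by
      rw [integral_const_mul]; rfl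
    simp_rw [h1]
    rw [integral_integral_swap (hprod m)]
    refine integral_congr_ae (Eventually.of_forall fun y => ?_)
    simp only [mollify, smul_eq_mul]
    rw [← integral_mul_const]
    refine integral_congr_ae (Eventually.of_forall fun x => ?_)
    simp only
    rw [ker_sub_comm m y x]
    ring
  have hlim : ∀ᵐ x, Tendsto (fun m => mollify m k x * h x) atTop (𝓝 (k x * h x)) := by
    filter_upwards [tendsto_mollify_ae hkl] with x hx using hx.mul_const _
  refine ⟨fun m => ?_, ?_, ?_⟩
  · refine (hprod m).integral_prod_left.congr (Eventually.of_forall fun x => ?_)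
    simp only
    rw [integral_const_mul]; rfl
  · refine hint.mono' (hk.1.mul hh.aestronglyMeasurable) ?_
    filter_upwards [hlim, ae_all_iff.2 hkk'] with x hx hx'
    rw [Real.norm_of_nonneg (mul_nonneg (hk0 x) (hh0 x))]
    exact le_of_tendsto' hx fun m => mul_le_mul_of_nonneg_right (hx' m) (hh0 x)
  · simp_rw [heq]
    exact tendsto_integral_of_dominated_convergence _ hmeas hint hbd hlim

end Mollify

/-! ### Rules for partial derivatives, the Laplacian, and integration by parts -/

section Calculus

variable {F : Type*} [NormedAddCommGroup F] [NormedSpace ℝ F]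
  {R : Type*} [NormedCommRing R] [NormedAlgebra ℝ R]

theorem pd_add {f g : Eu n → F} {x : Eu n} (j : Fin n) (hf : DifferentiableAt ℝ f x)
    (hg : DifferentiableAt ℝ g x) : pd j (fun y => f y + g y) x = pd j f x + pd j g x := by
  simp only [pd]
  rw [fderiv_fun_add hf hg]; rfl

theorem pd_sub {f g : Eu n → F} {x : Eu n} (j : Fin n) (hf : DifferentiableAt ℝ f x)
    (hg : DifferentiableAt ℝ g x) : pd j (fun y => f y - g y) x = pd j f x - pd j g x := by
  simp only [pd]
  rw [fderiv_fun_sub hf hg]; rfl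

theorem pd_mul {f g : Eu n → R} {x : Eu n} (j : Fin n) (hf : DifferentiableAt ℝ f x)
    (hg : DifferentiableAt ℝ g x) :
    pd j (fun y => f y * g y) x = f x * pd j g x + pd j f x * g x := by
  simp only [pd]
  rw [fderiv_fun_mul hf hg]
  simp [mul_comm]

theorem pd_const_mul (c : R) {f : Eu n → R} {x : Eu n} (j : Fin n) (hf : DifferentiableAt ℝ f x) :
    pd j (fun y => c * f y) x = c * pd j f x := by
  simp only [pd]
  rw [fderiv_const_mul hf c]
  simp

theorem pd_clm {F' : Type*} [NormedAddCommGroup F'] [NormedSpace ℝ F'] (L : F →L[ℝ] F')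
    {f : Eu n → F} {x : Eu n} (j : Fin n) (hf : DifferentiableAt ℝ f x) :
    pd j (fun y => L (f y)) x = L (pd j f x) := by
  simp only [pd]
  have := (L.hasFDerivAt.comp x hf.hasFDerivAt).fderiv
  rw [show (fun y => L (f y)) = L ∘ f from rfl, this]; rfl

theorem pd_ofReal {f : Eu n → ℝ} {x : Eu n} (j : Fin n) (hf : DifferentiableAt ℝ f x) :
    pd j (fun y => (f y : ℂ)) x = ((pd j f x : ℝ) : ℂ) :=
  pd_clm Complex.ofRealCLM j hf

theorem pd_star {f : Eu n → ℂ} {x : Eu n} (j : Fin n) (hf : DifferentiableAt ℝ f x) :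
    pd j (fun y => star (f y)) x = star (pd j f x) :=
  pd_clm Complex.conjCLE.toContinuousLinearMap j hf

theorem pd_re {f : Eu n → ℂ} {x : Eu n} (j : Fin n) (hf : DifferentiableAt ℝ f x) :
    pd j (fun y => (f y).re) x = (pd j f x).re :=
  pd_clm Complex.reCLM j hf

theorem pd_apply {f : Eu n → Eu n} {x : Eu n} (j k : Fin n) (hf : DifferentiableAt ℝ f x) :
    pd j (fun y => f y k) x = pd j f x k :=
  pd_clm (EuclideanSpace.proj k : Eu n →L[ℝ] ℝ) j hf

theorem pd_coord (j k : Fin n) (x : Eu n) :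
    pd j (fun y : Eu n => y k) x = if k = j then 1 else 0 := by
  have := pd_apply (f := fun y : Eu n => y) (x := x) j k differentiableAt_id
  rw [this]
  simp [pd]

theorem pd_scomp {h : ℝ → ℝ} {f : Eu n → ℝ} {x : Eu n} (j : Fin n)
    (hh : DifferentiableAt ℝ h (f x)) (hf : DifferentiableAt ℝ f x) :
    pd j (fun y => h (f y)) x = deriv h (f x) * pd j f x := by
  simp only [pd]
  have := (hh.hasDerivAt.comp_hasFDerivAt x hf.hasFDerivAt).fderiv
  rw [show (fun y => h (f y)) = h ∘ f from rfl, this]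
  simp

theorem pd_congr {f g : Eu n → F} {x : Eu n} (j : Fin n) (h : f =ᶠ[𝓝 x] g) :
    pd j f x = pd j g x := by
  simp only [pd]; rw [h.fderiv_eq]

theorem pd_comp_const_sub (a : Eu n) {f : Eu n → F} (hf : Differentiable ℝ f) (x : Eu n)
    (j : Fin n) :
    pd j (fun y => f (a - y)) x = - pd j f (a - x) := by
  have h := (hf (a - x)).hasFDerivAt.comp x ((hasFDerivAt_id x).const_sub a)
  simp only [pd]
  rw [show (fun y => f (a - y)) = f ∘ HSub.hSub a from rfl, h.fderiv]
  simp

theorem ContDiff_pd {f : Eu n → F} {k m : WithTop ℕ∞} (hf : ContDiff ℝ m f) (hk : k + 1 ≤ m)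
    (j : Fin n) : ContDiff ℝ k (pd j f) :=
  (hf.fderiv_right hk).clm_apply contDiff_const

theorem ContDiffAt_pd {f : Eu n → F} {k m : WithTop ℕ∞} {x : Eu n} (hf : ContDiffAt ℝ m f x)
    (hk : k + 1 ≤ m) (j : Fin n) : ContDiffAt ℝ k (pd j f) x :=
  (hf.fderiv_right hk).clm_apply contDiffAt_const

theorem continuous_pd {f : Eu n → F} (hf : ContDiff ℝ 1 f) (j : Fin n) : Continuous (pd j f) :=
  (ContDiff_pd (k := 0) hf (by norm_num) j).continuous

theorem HasCompactSupport_pd {f : Eu n → F} (hf : HasCompactSupport f) (j : Fin n) :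
    HasCompactSupport (pd j f) := by
  refine (hf.fderiv ℝ).comp_left (g := fun L : Eu n →L[ℝ] F => L (EuclideanSpace.single j 1)) ?_
  simp

theorem isTest_pd {f : Eu n → F} (hf : IsTest f) (j : Fin n) : IsTest (pd j f) :=
  ⟨ContDiff_pd hf.1 (by simp) j, HasCompactSupport_pd hf.2 j⟩

theorem pd_comm {f : Eu n → F} {x : Eu n} (hf : ContDiffAt ℝ 2 f x) (i j : Fin n) :
    pd i (pd j f) x = pd j (pd i f) x := by
  have hd : DifferentiableAt ℝ (fderiv ℝ f) x :=
    (hf.fderiv_right (m := 1) (by norm_num)).differentiableAt (by norm_num)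
  have h : ∀ i j : Fin n, pd i (pd j f) x
      = fderiv ℝ (fderiv ℝ f) x (EuclideanSpace.single i 1) (EuclideanSpace.single j 1) := by
    intro i j
    have := pd_clm (ContinuousLinearMap.apply ℝ F (EuclideanSpace.single j (1 : ℝ) : Eu n)) i hd
    exact this
  rw [h, h]
  exact (hf.isSymmSndFDerivAt (by simp)).eq _ _

theorem laplacian_eq_sum_pd {f : Eu n → F} {x : Eu n} (hf : ContDiffAt ℝ 2 f x) :
    Laplacian.laplacian f x = ∑ j, pd j (pd j f) x := by
  have hd : DifferentiableAt ℝ (fderiv ℝ f) x :=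
    (hf.fderiv_right (m := 1) (by norm_num)).differentiableAt (by norm_num)
  have := congrFun (InnerProductSpace.laplacian_eq_iteratedFDeriv_orthonormalBasis f
    (EuclideanSpace.basisFun (Fin n) ℝ)) x
  rw [this]
  refine Finset.sum_congr rfl fun j _ => ?_
  have h := pd_clm (ContinuousLinearMap.apply ℝ F (EuclideanSpace.single j (1 : ℝ) : Eu n)) j hd
  rw [iteratedFDeriv_two_apply]
  simp only [EuclideanSpace.basisFun_apply, Matrix.cons_val_zero, Matrix.cons_val_one]
  exact h.symm

theorem integral_pd_eq_zero {h : Eu n → F} (hh : ContDiff ℝ 1 h) (hc : HasCompactSupport h)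
    (j : Fin n) : ∫ x, pd j h x = 0 := by
  have h1 : Integrable (pd j h) volume :=
    (continuous_pd hh j).integrable_of_hasCompactSupport (HasCompactSupport_pd hc j)
  have h2 : Integrable h volume := hh.continuous.integrable_of_hasCompactSupport hc
  have := integral_smul_fderiv_eq_neg_fderiv_smul_of_integrable (μ := (volume : Measure (Eu n)))
    (f := fun _ => (1 : ℝ)) (g := h) (v := EuclideanSpace.single j 1)
    (by simp) (by simpa [pd] using (show Integrable (fun x => pd j h x) volume from h1)) (by simpa using h2)
    (fun x _ => differentiableAt_const _) (fun x _ => (hh.differentiable (by norm_num)) x)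
  simpa [pd] using this

theorem integral_mul_pd {f g : Eu n → ℝ} (hf : ContDiff ℝ 1 f) (hg : ContDiff ℝ 1 g)
    (hc : HasCompactSupport g) (j : Fin n) :
    ∫ x, f x * pd j g x = - ∫ x, pd j f x * g x := by
  have h1 : Integrable (fun x => f x * pd j g x) volume :=
    (hf.continuous.mul (continuous_pd hg j)).integrable_of_hasCompactSupport
      (HasCompactSupport_pd hc j).mul_left
  have h2 : Integrable (fun x => pd j f x * g x) volume :=
    ((continuous_pd hf j).mul hg.continuous).integrable_of_hasCompactSupport hc.mul_left
  have h3 := integral_pd_eq_zero (hf.mul hg) hc.mul_left j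
  have h4 : ∀ x, pd j (fun y => f y * g y) x = f x * pd j g x + pd j f x * g x := fun x =>
    pd_mul j (hf.differentiable (by norm_num) x) (hg.differentiable (by norm_num) x)
  simp_rw [h4] at h3
  rw [integral_add h1 h2] at h3
  linarith

end Calculus

/-! ### Mollification of the weight 1/|x| and of indicators of balls -/

section Weights

theorem locallyIntegrable_inv_norm (hn : 2 ≤ n) :
    LocallyIntegrable (fun x : Eu n => ‖x‖⁻¹) volume := by
  refine locallyIntegrable_of_norm_le_rpow (C := 1) (α := 1) ?_ ?_ ?_ ?_
  · simp; omega
  · simp; omega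
  · refine Eventually.of_forall fun x => ?_
    rw [Real.rpow_neg_one]; simp
  · exact (measurable_norm.inv).aestronglyMeasurable

theorem integral_ball_inv_norm_scale (ρ : ℝ) (hρ : 0 < ρ) :
    ∫ z in Metric.ball (0 : Eu n) ρ, ‖z‖⁻¹
      = ρ ^ n * ρ⁻¹ * ∫ z in Metric.ball (0 : Eu n) 1, ‖z‖⁻¹ := by
  rw [← integral_indicator Metric.isOpen_ball.measurableSet,
    ← integral_indicator Metric.isOpen_ball.measurableSet]
  have h := Measure.integral_comp_smul (volume : Measure (Eu n))
    ((Metric.ball (0 : Eu n) ρ).indicator fun z => ‖z‖⁻¹) ρ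
  have h2 : ∀ z : Eu n, (Metric.ball (0 : Eu n) ρ).indicator (fun z => ‖z‖⁻¹) (ρ • z)
      = ρ⁻¹ * (Metric.ball (0 : Eu n) 1).indicator (fun z => ‖z‖⁻¹) z := by
    intro z
    have : ρ • z ∈ Metric.ball (0 : Eu n) ρ ↔ z ∈ Metric.ball (0 : Eu n) 1 := by
      simp only [Metric.mem_ball, dist_zero_right, norm_smul, Real.norm_of_nonneg hρ.le]
      constructor <;> intro h <;> nlinarith
    by_cases hz : z ∈ Metric.ball (0 : Eu n) 1
    · rw [indicator_of_mem (this.2 hz), indicator_of_mem hz, norm_smul, Real.norm_of_nonneg hρ.le,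
        mul_inv]
    · rw [indicator_of_notMem (fun h => hz (this.1 h)), indicator_of_notMem hz, mul_zero]
  simp_rw [h2] at h
  rw [integral_const_mul, finrank_euclideanSpace_fin, smul_eq_mul, abs_of_nonneg (by positivity)] at h
  rw [mul_assoc, h, ← mul_assoc, mul_inv_cancel₀ (by positivity), one_mul]

/-- The weight `|x|⁻¹` belongs to the Muckenhoupt class `A₁`. -/
theorem exists_mollify_inv_norm_le (hn : 2 ≤ n) :
    ∃ C : ℝ, 1 ≤ C ∧ ∀ m : ℕ, ∀ x : Eu n, x ≠ 0 → mollify m (fun x : Eu n => ‖x‖⁻¹) x ≤ C * ‖x‖⁻¹ := by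
  have : Nonempty (Fin n) := ⟨⟨0, by omega⟩⟩
  have : Nontrivial (Eu n) := inferInstance
  set c := ∫ z in Metric.ball (0 : Eu n) 1, ‖z‖⁻¹ with hc
  have hc0 : 0 ≤ c := integral_nonneg fun z => by positivity
  set v := (volume : Measure (Eu n)).real (Metric.ball 0 1) with hv
  have hv0 : 0 < v := ENNReal.toReal_pos (Metric.measure_ball_pos _ _ one_pos).ne'
    measure_ball_lt_top.ne
  have hli := locallyIntegrable_inv_norm hn
  refine ⟨2 + 3 ^ n * 2 ^ n * c / v, by have : 0 ≤ 3 ^ n * 2 ^ n * c / v := by positivity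
                                        linarith, fun m x hx => ?_⟩
  set K := 3 ^ n * 2 ^ n * c / v with hK
  have hK0 : 0 ≤ K := by positivity
  set ρ : ℝ := 2 / ((m : ℝ) + 1) with hρ
  have hρ0 : 0 < ρ := by positivity
  have hx0 : 0 < ‖x‖ := norm_pos_iff.2 hx
  -- If |x| ≥ 2ρ, every y within ρ of x satisfies |y| ≥ |x|/2. Otherwise the ball of radius ρ about
  -- x lies in the ball of radius 3ρ about 0, and the supremum bound of the kernel together with the
  -- scaling of ∫ |z|⁻¹ gives K/(3ρ) ≤ K/|x|.
  rcases le_or_gt (2 * ρ) ‖x‖ with h | h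
  · have h1 : mollify m (fun x : Eu n => ‖x‖⁻¹) x ≤ ∫ y, ker n m (x - y) * (2 * ‖x‖⁻¹) := by
      refine integral_mono (integrable_ker_smul hli m x)
        (integrable_ker_smul (g := fun _ => 2 * ‖x‖⁻¹) (locallyIntegrable_const _) m x) fun y => ?_
      rcases le_or_gt ρ ‖x - y‖ with hy | hy
      · simp [ker_eq_zero hy]
      · refine mul_le_mul_of_nonneg_left ?_ (ker_nonneg _ _)
        have h2 : ‖x‖ / 2 ≤ ‖y‖ := by
          have := norm_sub_norm_le x y
          linarith
        calc ‖y‖⁻¹ ≤ (‖x‖ / 2)⁻¹ := by gcongr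
          _ = 2 * ‖x‖⁻¹ := by field_simp
    rw [integral_mul_const, integral_ker_sub, one_mul] at h1
    refine h1.trans ?_
    gcongr
    linarith
  · have hB := hli.integrableOn_isCompact (isCompact_closedBall (0 : Eu n) (3 * ρ))
    have hB' : IntegrableOn (fun x : Eu n => ‖x‖⁻¹) (Metric.ball 0 (3 * ρ)) volume :=
      hB.mono_set Metric.ball_subset_closedBall
    have hvol : (volume : Measure (Eu n)).real (Metric.closedBall 0 ρ) = ρ ^ n * v := by
      rw [Measure.addHaar_real_closedBall _ _ hρ0.le, finrank_euclideanSpace_fin]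
    have hker : ∀ z, ker n m z ≤ 2 ^ n / (ρ ^ n * v) := by
      intro z
      have := (bump n m).normed_le_div_measure_closedBall_rOut (volume : Measure (Eu n)) 2
        (le_of_eq (by simp only [bump]; ring)) z
      rw [finrank_euclideanSpace_fin, show (bump n m).rOut = ρ from rfl, hvol] at this
      exact this
    have h1 : mollify m (fun x : Eu n => ‖x‖⁻¹) x ≤
        ∫ y, 2 ^ n / (ρ ^ n * v) * (Metric.ball (0 : Eu n) (3 * ρ)).indicator (fun z => ‖z‖⁻¹) y := by
      refine integral_mono (integrable_ker_smul hli m x)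
        (((integrable_indicator_iff Metric.isOpen_ball.measurableSet).2 hB').const_mul _) fun y => ?_
      rcases le_or_gt ρ ‖x - y‖ with hy | hy
      · simp only [ker_eq_zero hy, zero_smul]
        exact mul_nonneg (by positivity) (indicator_nonneg (fun z _ => by positivity) y)
      · have hmem : y ∈ Metric.ball (0 : Eu n) (3 * ρ) := by
          have := norm_sub_norm_le y x
          rw [norm_sub_rev] at this
          simp only [Metric.mem_ball, dist_zero_right]
          linarith
        rw [indicator_of_mem hmem]
        exact mul_le_mul_of_nonneg_right (hker _) (by positivity)
    rw [integral_const_mul, integral_indicator Metric.isOpen_ball.measurableSet,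
      integral_ball_inv_norm_scale _ (by positivity), ← hc] at h1
    have h2 : 2 ^ n / (ρ ^ n * v) * ((3 * ρ) ^ n * (3 * ρ)⁻¹ * c) = K * (3 * ρ)⁻¹ := by
      rw [hK, mul_pow]
      field_simp
    rw [h2] at h1
    refine h1.trans ?_
    have h3 : (3 * ρ)⁻¹ ≤ ‖x‖⁻¹ := by
      gcongr
      linarith
    have : 0 ≤ ‖x‖⁻¹ := by positivity
    nlinarith

/-- Every mollifier radius 2/(m+1) is at most 2, which is the enlargement of the ball. -/
theorem mollify_indicator_le (R : ℝ) (m : ℕ) (x : Eu n) :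
    mollify m ((Metric.closedBall (0 : Eu n) R).indicator fun _ => (1 : ℝ)) x
      ≤ (Metric.closedBall (0 : Eu n) (R + 2)).indicator (fun _ => (1 : ℝ)) x := by
  have hl : LocallyIntegrable ((Metric.closedBall (0 : Eu n) R).indicator fun _ => (1 : ℝ)) volume :=
    (locallyIntegrable_const 1).indicator Metric.isClosed_closedBall.measurableSet
  by_cases hx : x ∈ Metric.closedBall (0 : Eu n) (R + 2)
  · rw [indicator_of_mem hx]
    refine (mollify_mono hl (locallyIntegrable_const 1) (fun y => ?_) m x).trans (le_of_eq ?_)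
    · exact indicator_le_self' (fun _ _ => zero_le_one) y
    · simpa [mollify] using integral_ker_sub m x
  · rw [indicator_of_notMem hx]
    refine le_of_eq (integral_eq_zero_of_ae (Eventually.of_forall fun y => ?_))
    by_cases hy : y ∈ Metric.closedBall (0 : Eu n) R
    · simp only [Metric.mem_closedBall, dist_zero_right, not_le] at hx hy
      have h1 := norm_sub_norm_le x y
      have h2 : 2 / ((m : ℝ) + 1) ≤ 2 := div_le_self (by norm_num) (by linarith [m.cast_nonneg (α := ℝ)])
      simp [ker_eq_zero (show 2 / ((m : ℝ) + 1) ≤ ‖x - y‖ by linarith)]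
    · simp [indicator_of_notMem hy]

end Weights

/-! ### Passing quadratic identities from smooth functions to weak derivatives -/

section Jets

/-- By homogeneity and compactness, |q(x, y)| is at most a constant times 1_B(x)|y|². Jensen bounds
|J_m|² by the mollification of |J|², whose integrals over B converge although it need not have a
fixed integrable dominant. Pratt's lemma then applies. -/
theorem tendsto_integral_quadratic {Y : Type*} [NormedAddCommGroup Y] [NormedSpace ℝ Y]
    [FiniteDimensional ℝ Y] {J : Eu n → Y} (hJ : LocallyIntegrable J volume)
    (hJ2 : LocallyIntegrable (fun x => ‖J x‖ ^ 2) volume) {q : Eu n → Y → ℝ}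
    (hq : Continuous (Function.uncurry q)) (hhom : ∀ x (t : ℝ) y, q x (t • y) = t ^ 2 * q x y)
    {K : Set (Eu n)} (hK : IsCompact K) (hq0 : ∀ x, x ∉ K → ∀ y, q x y = 0) :
    Integrable (fun x => q x (J x)) volume ∧
      Tendsto (fun m => ∫ x, q x (mollify m J x)) atTop (𝓝 (∫ x, q x (J x))) := by
  have : ProperSpace Y := FiniteDimensional.proper ℝ Y
  obtain ⟨C, hC⟩ := (hK.prod (isCompact_closedBall (0 : Y) 1)).exists_bound_of_continuousOn
    hq.continuousOn
  obtain ⟨R, hR⟩ := hK.isBounded.subset_closedBall (0 : Eu n)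
  have hbd : ∀ x y, |q x y| ≤ |C| * ((Metric.closedBall (0 : Eu n) R).indicator (fun _ => (1 : ℝ)) x
      * ‖y‖ ^ 2) := by
    intro x y
    by_cases hx : x ∈ K
    · rw [indicator_of_mem (hR hx), one_mul]
      -- Reduction to the unit ball of `Y`. At y = 0 the convention 0⁻¹ = 0 keeps the formula valid.
      have h1 : q x y = ‖y‖ ^ 2 * q x (‖y‖⁻¹ • y) := by
        rw [← hhom]
        by_cases hy : y = 0
        · simp [hy]
        · rw [smul_smul, mul_inv_cancel₀ (norm_ne_zero_iff.2 hy), one_smul]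
      have h2 : |q x (‖y‖⁻¹ • y)| ≤ |C| := by
        refine (hC (x, ‖y‖⁻¹ • y) ⟨hx, ?_⟩).trans (le_abs_self C)
        rw [mem_closedBall_zero_iff, norm_smul, norm_inv, norm_norm]
        exact inv_mul_le_one
      rw [h1, abs_mul, abs_of_nonneg (sq_nonneg _), mul_comm]
      gcongr
    · rw [hq0 x hx, abs_zero]
      exact mul_nonneg (abs_nonneg _) (mul_nonneg (indicator_nonneg (fun _ _ => zero_le_one) _)
        (sq_nonneg _))
  set k : Eu n → ℝ := (Metric.closedBall (0 : Eu n) R).indicator (fun _ => (1 : ℝ)) with hk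
  have hk0 : ∀ x, 0 ≤ k x := indicator_nonneg (fun _ _ => zero_le_one)
  have hki : Integrable k volume :=
    (integrable_indicator_iff Metric.isClosed_closedBall.measurableSet).2
      (integrableOn_const (measure_closedBall_lt_top.ne))
  have hint : Integrable (fun x => (Metric.closedBall (0 : Eu n) (R + 2)).indicator
      (fun _ => (1 : ℝ)) x * ‖J x‖ ^ 2) volume := by
    have h1 := (integrable_indicator_iff (μ := volume) (f := fun x => ‖J x‖ ^ 2)
      Metric.isClosed_closedBall.measurableSet).2
      (hJ2.integrableOn_isCompact (isCompact_closedBall (0 : Eu n) (R + 2)))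
    refine h1.congr (Eventually.of_forall fun x => ?_)
    by_cases hx : x ∈ Metric.closedBall (0 : Eu n) (R + 2)
    · simp only [indicator_of_mem hx, one_mul]
    · simp only [indicator_of_notMem hx, zero_mul]
  obtain ⟨h1, h2, h3⟩ := tendsto_integral_mul_mollify hki hk0 hJ2 (fun x => sq_nonneg _)
    (fun m => Eventually.of_forall (mollify_indicator_le R m)) hint
  refine tendsto_integral_of_tendsto_bound
    (g := fun m x => |C| * (k x * mollify m (fun x => ‖J x‖ ^ 2) x))
    (g' := fun x => |C| * (k x * ‖J x‖ ^ 2)) (fun m => ?_) (fun m => (h1 m).const_mul _)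
    (h2.const_mul _) (fun m => Eventually.of_forall fun x => ?_) ?_ ?_ ?_
  · exact (hq.comp (continuous_id.prodMk (contDiff_mollify hJ m).continuous)).aestronglyMeasurable
  · refine (hbd x _).trans ?_
    gcongr
    · exact hk0 x
    · exact norm_mollify_sq_le hJ hJ2 m x
  · filter_upwards [tendsto_mollify_ae hJ] with x hx
    exact ((hq.comp (Continuous.prodMk_right x)).tendsto (J x)).comp hx
  · filter_upwards [tendsto_mollify_ae hJ2] with x hx
    exact (hx.const_mul _).const_mul _
  · simp_rw [integral_const_mul]
    exact h3.const_mul _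

/-- `u` has weak gradient `G` and weak Laplacian `L`, all locally square integrable. -/
structure WeakJet (u : Eu n → ℂ) (G : Fin n → Eu n → ℂ) (L : Eu n → ℂ) : Prop where
  grad : HasWeakGradient u G
  locL : LocallyIntegrable L volume
  lap : ∀ ψ : Eu n → ℝ, IsTest ψ →
    ∫ x, ∑ j, G j x * ((pd j ψ x : ℝ) : ℂ) = - ∫ x, L x * (ψ x : ℂ)
  sq_u : LocallyIntegrable (fun x => ‖u x‖ ^ 2) volume
  sq_G : ∀ j, LocallyIntegrable (fun x => ‖G j x‖ ^ 2) volume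
  sq_L : LocallyIntegrable (fun x => ‖L x‖ ^ 2) volume

theorem isTest_ker_sub (m : ℕ) (x : Eu n) : IsTest (fun y => ker n m (x - y)) :=
  ⟨(contDiff_ker m).comp (contDiff_const.sub contDiff_id), hasCompactSupport_ker_sub m x⟩

theorem pd_ker_sub (m : ℕ) (x y : Eu n) (j : Fin n) :
    pd j (fun y => ker n m (x - y)) y = - pd j (ker n m) (x - y) :=
  pd_comp_const_sub x ((contDiff_ker m).differentiable (by simp)) y j

/-- The translated kernel y ↦ `ker n m (x - y)` is itself a test function, and differentiating it in
y instead of x changes the sign. -/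
theorem pd_mollify_of_hasWeakGradient {u : Eu n → ℂ} {G : Fin n → Eu n → ℂ}
    (h : HasWeakGradient u G) (m : ℕ) (j : Fin n) (x : Eu n) :
    pd j (mollify m u) x = mollify m (G j) x := by
  have h1 := (h.2 j).2 _ (isTest_ker_sub m x)
  rw [pd_mollify h.1]
  simp_rw [pd_ker_sub] at h1
  have h2 : ∫ y, pd j (ker n m) (x - y) • u y
      = - ∫ y, u y * ((- pd j (ker n m) (x - y) : ℝ) : ℂ) := by
    rw [← integral_neg]
    refine integral_congr_ae (Eventually.of_forall fun y => ?_)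
    simp [mul_comm]
  rw [h2, h1, neg_neg]
  refine integral_congr_ae (Eventually.of_forall fun y => ?_)
  simp [mul_comm]

theorem integrable_pd_ker_smul {F : Type*} [NormedAddCommGroup F] [NormedSpace ℝ F] {g : Eu n → F}
    (hg : LocallyIntegrable g volume) (m : ℕ) (j : Fin n) (x : Eu n) :
    Integrable (fun y => pd j (ker n m) (x - y) • g y) volume :=
  hg.integrable_smul_left_of_hasCompactSupport
    ((continuous_pd ((contDiff_ker m).of_le (by simp)) j).comp (continuous_const.sub continuous_id))
    ((HasCompactSupport_pd (hasCompactSupport_ker m) j).comp_homeomorph (Homeomorph.subLeft x))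

/-- Only the trace of the Hessian of the mollified function is identified with a mollified L²_loc
function. This suffices because no individual second derivative occurs in the identities used. -/
theorem WeakJet.sum_pd_mollify {u : Eu n → ℂ} {G : Fin n → Eu n → ℂ} {L : Eu n → ℂ}
    (h : WeakJet u G L) (m : ℕ) (x : Eu n) :
    ∑ j, pd j (mollify m (G j)) x = mollify m L x := by
  have h1 := h.lap _ (isTest_ker_sub m x)
  simp_rw [pd_ker_sub] at h1
  have h3 : ∀ j, pd j (mollify m (G j)) x = ∫ y, pd j (ker n m) (x - y) • G j y := fun j =>
    pd_mollify (h.grad.2 j).1 m j x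
  simp_rw [h3]
  rw [← integral_finsetSum _ fun j _ => integrable_pd_ker_smul (h.grad.2 j).1 m j x]
  have h2 : ∫ y, ∑ j, pd j (ker n m) (x - y) • G j y
      = - ∫ y, ∑ j, G j y * ((- pd j (ker n m) (x - y) : ℝ) : ℂ) := by
    rw [← integral_neg]
    refine integral_congr_ae (Eventually.of_forall fun y => ?_)
    simp only
    rw [← Finset.sum_neg_distrib]
    refine Finset.sum_congr rfl fun j _ => ?_
    simp [mul_comm]
  rw [h2, h1, neg_neg]
  refine integral_congr_ae (Eventually.of_forall fun y => ?_)
  simp [mul_comm]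

theorem mollify_clm {F F' : Type*} [NormedAddCommGroup F] [NormedSpace ℝ F] [CompleteSpace F]
    [NormedAddCommGroup F'] [NormedSpace ℝ F'] [CompleteSpace F'] (T : F →L[ℝ] F') {g : Eu n → F}
    (hg : LocallyIntegrable g volume) (m : ℕ) (x : Eu n) :
    mollify m (fun y => T (g y)) x = T (mollify m g x) := by
  rw [mollify, mollify, ← T.integral_comp_comm (integrable_ker_smul hg m x)]
  simp

theorem WeakJet.locallyIntegrable_jet {u : Eu n → ℂ} {G : Fin n → Eu n → ℂ} {L : Eu n → ℂ}
    (h : WeakJet u G L) :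
    LocallyIntegrable (fun x => (u x, (fun j => G j x), L x)) volume ∧
    LocallyIntegrable (fun x => ‖(u x, (fun j => G j x), L x)‖ ^ 2) volume := by
  have hm : AEStronglyMeasurable (fun x => (u x, (fun j => G j x), L x)) volume :=
    h.grad.1.aestronglyMeasurable.prodMk
      ((aemeasurable_pi_iff.2 fun j =>
        (h.grad.2 j).1.aestronglyMeasurable.aemeasurable).aestronglyMeasurable.prodMk
        h.locL.aestronglyMeasurable)
  have hle : ∀ x, ‖(u x, (fun j => G j x), L x)‖ ^ 2
      ≤ ‖u x‖ ^ 2 + ((∑ j, ‖G j x‖ ^ 2) + ‖L x‖ ^ 2) := by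
    intro x
    have hp : ‖fun j => G j x‖ ^ 2 ≤ ∑ j, ‖G j x‖ ^ 2 := by
      have h0 : 0 ≤ ∑ j, ‖G j x‖ ^ 2 := Finset.sum_nonneg fun _ _ => sq_nonneg _
      rw [← Real.sq_sqrt h0]
      refine pow_le_pow_left₀ (norm_nonneg _) ?_ 2
      exact (pi_norm_le_iff_of_nonneg (Real.sqrt_nonneg _)).2 fun j => Real.le_sqrt_of_sq_le
        (Finset.single_le_sum (f := fun j => ‖G j x‖ ^ 2) (fun i _ => sq_nonneg _)
          (Finset.mem_univ j))
    rw [Prod.norm_mk, Prod.norm_mk]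
    have h0 : 0 ≤ ∑ j, ‖G j x‖ ^ 2 := Finset.sum_nonneg fun _ _ => sq_nonneg _
    rcases max_choice ‖u x‖ (max ‖fun j => G j x‖ ‖L x‖) with h1 | h1 <;> rw [h1]
    · nlinarith [sq_nonneg ‖L x‖]
    · rcases max_choice ‖fun j => G j x‖ ‖L x‖ with h2 | h2 <;> rw [h2] <;>
        nlinarith [sq_nonneg ‖L x‖, sq_nonneg ‖u x‖]
  have hsq : LocallyIntegrable (fun x => ‖(u x, (fun j => G j x), L x)‖ ^ 2) volume := by
    have hb : LocallyIntegrable (fun x => ‖u x‖ ^ 2 + ((∑ j, ‖G j x‖ ^ 2) + ‖L x‖ ^ 2)) volume :=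
      h.sq_u.add ((locallyIntegrable_finsetSum _ fun j _ => h.sq_G j).add h.sq_L)
    refine hb.mono (hm.norm.pow 2) (Eventually.of_forall fun x => ?_)
    rw [Real.norm_of_nonneg (sq_nonneg _)]
    exact (hle x).trans (le_abs_self _)
  refine ⟨?_, hsq⟩
  have hb : LocallyIntegrable (fun x => (1 : ℝ) + ‖(u x, (fun j => G j x), L x)‖ ^ 2) volume :=
    (locallyIntegrable_const 1).add hsq
  refine hb.mono hm (Eventually.of_forall fun x => ?_)
  rw [Real.norm_of_nonneg (by positivity)]
  nlinarith [sq_nonneg (‖(u x, (fun j => G j x), L x)‖ - 1)]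

/-- Quadratic integral identities pass from the mollified functions to the weak jet. -/
theorem WeakJet.integral_quadratic_eq_zero {u : Eu n → ℂ} {G : Fin n → Eu n → ℂ} {L : Eu n → ℂ}
    (h : WeakJet u G L) {q : Eu n → ℂ × (Fin n → ℂ) × ℂ → ℝ}
    (hq : Continuous (Function.uncurry q)) (hhom : ∀ x (t : ℝ) y, q x (t • y) = t ^ 2 * q x y)
    {K : Set (Eu n)} (hK : IsCompact K) (hq0 : ∀ x, x ∉ K → ∀ y, q x y = 0)
    (hsmooth : ∀ v : Eu n → ℂ, ContDiff ℝ ∞ v →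
      ∫ x, q x (v x, (fun j => pd j v x), ∑ j, pd j (pd j v) x) = 0) :
    Integrable (fun x => q x (u x, (fun j => G j x), L x)) volume ∧
      ∫ x, q x (u x, (fun j => G j x), L x) = 0 := by
  obtain ⟨hJ, hJ2⟩ := h.locallyIntegrable_jet
  obtain ⟨h1, h2⟩ := tendsto_integral_quadratic hJ hJ2 hq hhom hK hq0
  refine ⟨h1, tendsto_nhds_unique h2 ?_⟩
  refine tendsto_const_nhds.congr fun m => ?_
  -- The mollification of the jet is the jet of the mollification, so the identity for smooth
  -- functions makes every term of the sequence zero.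
  rw [← hsmooth (mollify m u) (contDiff_mollify h.grad.1 m)]
  refine integral_congr_ae (Eventually.of_forall fun x => ?_)
  have hpd : ∀ j, pd j (mollify m u) = mollify m (G j) := fun j =>
    funext (pd_mollify_of_hasWeakGradient h.grad m j)
  simp only
  congr 1
  refine Prod.ext ?_ (Prod.ext (funext fun j => ?_) ?_)
  · exact mollify_clm (ContinuousLinearMap.fst ℝ ℂ ((Fin n → ℂ) × ℂ)) hJ m x
  · simp only [hpd]
    exact mollify_clm ((ContinuousLinearMap.proj j).comp ((ContinuousLinearMap.fst ℝ (Fin n → ℂ) ℂ).comp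
      (ContinuousLinearMap.snd ℝ ℂ ((Fin n → ℂ) × ℂ)))) hJ m x
  · simp only [hpd]
    rw [h.sum_pd_mollify]
    exact mollify_clm ((ContinuousLinearMap.snd ℝ (Fin n → ℂ) ℂ).comp
      (ContinuousLinearMap.snd ℝ ℂ ((Fin n → ℂ) × ℂ))) hJ m x

end Jets

/-! ### The basic identities in jet form: |u|², its Laplacian, and the virial identity -/

section WeakIdentities

theorem re_smul_mul_star_smul (t : ℝ) (z w : ℂ) :
    ((t • z) * star (t • w)).re = t ^ 2 * (z * star w).re := by
  simp only [Complex.real_smul, Complex.star_def, map_mul, Complex.conj_ofReal]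
  rw [show (t : ℂ) * z * (t * (starRingEnd ℂ) w) = ((t ^ 2 : ℝ) : ℂ) * (z * (starRingEnd ℂ) w) by
    push_cast; ring, Complex.re_ofReal_mul]

theorem pd_re_mul_star {a b : Eu n → ℂ} {x : Eu n} (j : Fin n) (ha : DifferentiableAt ℝ a x)
    (hb : DifferentiableAt ℝ b x) :
    pd j (fun y => (a y * star (b y)).re) x
      = (a x * star (pd j b x)).re + (pd j a x * star (b x)).re := by
  have hb' : DifferentiableAt ℝ (fun y => star (b y)) x := hb.star
  rw [pd_re (f := fun y => a y * star (b y)) j (ha.mul hb'), pd_mul j ha hb', pd_star j hb,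
    Complex.add_re]

theorem re_mul_star_comm (z w : ℂ) : (z * star w).re = (w * star z).re := by
  simp only [Complex.star_def, Complex.mul_re, Complex.conj_re, Complex.conj_im]; ring

variable {u : Eu n → ℂ} {G : Fin n → Eu n → ℂ} {L : Eu n → ℂ}

/-- For smooth v the integrand is ∂_j(|v|²ψ), the derivative of a compactly supported C¹ function.
-/
theorem WeakJet.integral_normSq_pd (h : WeakJet u G L) {ψ : Eu n → ℝ} (hψ : ContDiff ℝ 1 ψ)
    (hc : HasCompactSupport ψ) (j : Fin n) :
    Integrable (fun x => (u x * star (u x)).re * pd j ψ x + 2 * (G j x * star (u x)).re * ψ x) volume ∧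
    ∫ x, ((u x * star (u x)).re * pd j ψ x + 2 * (G j x * star (u x)).re * ψ x) = 0 := by
  have hψc := hψ.continuous
  have hψd := continuous_pd hψ j
  refine h.integral_quadratic_eq_zero (q := fun x y => (y.1 * star y.1).re * pd j ψ x
    + 2 * (y.2.1 j * star y.1).re * ψ x) ?_ ?_ hc.isCompact ?_ ?_
  · simp only [Function.uncurry_def]
    fun_prop
  · intro x t y
    simp only [Prod.smul_fst, Prod.smul_snd, Pi.smul_apply, re_smul_mul_star_smul]
    ring
  · intro x hx y
    have h1 : pd j ψ x = 0 := by
      rw [pd, image_eq_zero_of_notMem_tsupport (fun h => hx (tsupport_fderiv_subset ℝ h))]; rfl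
    simp [h1, image_eq_zero_of_notMem_tsupport hx]
  · intro v hv
    have hv1 : ContDiff ℝ 1 v := hv.of_le (by simp)
    have hvd := hv1.differentiable (by norm_num)
    have hW : ContDiff ℝ 1 (fun x => (v x * star (v x)).re) :=
      Complex.reCLM.contDiff.comp (hv1.mul (Complex.conjCLE.contDiff.comp hv1))
    rw [← integral_pd_eq_zero (hW.mul hψ) hc.mul_left j]
    refine integral_congr_ae (Eventually.of_forall fun x => ?_)
    simp only
    rw [pd_mul j (hW.differentiable (by norm_num) x) (hψ.differentiable (by norm_num) x),
      pd_re_mul_star j (hvd x) (hvd x), re_mul_star_comm (v x) (pd j v x)]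
    ring

/-- For smooth v the integrand is 2 Σ_j ∂_j(Re(∂_j v conj v) ψ). The terms |∂_j v|² and Re(Δv conj
v) together form half of Δ|v|². -/
theorem WeakJet.integral_laplacian_normSq (h : WeakJet u G L) {ψ : Eu n → ℝ} (hψ : ContDiff ℝ 1 ψ)
    (hc : HasCompactSupport ψ) :
    Integrable (fun x => ∑ j, 2 * (G j x * star (u x)).re * pd j ψ x
      + (2 * (∑ j, (G j x * star (G j x)).re) + 2 * (L x * star (u x)).re) * ψ x) volume ∧
    ∫ x, (∑ j, 2 * (G j x * star (u x)).re * pd j ψ x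
      + (2 * (∑ j, (G j x * star (G j x)).re) + 2 * (L x * star (u x)).re) * ψ x) = 0 := by
  have hψc := hψ.continuous
  have hψd := continuous_pd hψ
  refine h.integral_quadratic_eq_zero (q := fun x y => ∑ j, 2 * (y.2.1 j * star y.1).re * pd j ψ x
      + (2 * (∑ j, (y.2.1 j * star (y.2.1 j)).re) + 2 * (y.2.2 * star y.1).re) * ψ x)
      ?_ ?_ hc.isCompact ?_ ?_
  · simp only [Function.uncurry_def]
    fun_prop
  · intro x t y
    simp only [Prod.smul_fst, Prod.smul_snd, Pi.smul_apply, re_smul_mul_star_smul, mul_add,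
      Finset.mul_sum, add_mul, Finset.sum_mul]
    simp only [← mul_assoc, mul_comm 2 (t ^ 2)]
  · intro x hx y
    have h1 : ∀ j, pd j ψ x = 0 := fun j => by
      rw [pd, image_eq_zero_of_notMem_tsupport (fun h => hx (tsupport_fderiv_subset ℝ h))]; rfl
    simp [h1, image_eq_zero_of_notMem_tsupport hx]
  · intro v hv
    have hv2 : ContDiff ℝ 2 v := mod_cast contDiff_infty.1 hv 2
    have hv1 : ContDiff ℝ 1 v := hv.of_le (by simp)
    have hvd := hv1.differentiable (by norm_num)
    have hp : ∀ j, ContDiff ℝ 1 (pd j v) := fun j => ContDiff_pd hv2 (by norm_num) j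
    have hN : ∀ j, ContDiff ℝ 1 (fun x => (pd j v x * star (v x)).re) := fun j =>
      Complex.reCLM.contDiff.comp ((hp j).mul (Complex.conjCLE.contDiff.comp hv1))
    have hN' : ∀ j, ContDiff ℝ 1 (fun x => (pd j v x * star (v x)).re * ψ x) := fun j =>
      (hN j).mul hψ
    have h0 : ∫ x, ∑ j, 2 * pd j (fun x => (pd j v x * star (v x)).re * ψ x) x = 0 := by
      rw [integral_finsetSum _ fun j _ => (((continuous_pd (hN' j) j).integrable_of_hasCompactSupport
        (HasCompactSupport_pd hc.mul_left j))).const_mul 2]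
      refine Finset.sum_eq_zero fun j _ => ?_
      rw [integral_const_mul, integral_pd_eq_zero (hN' j) hc.mul_left j, mul_zero]
    rw [← h0]
    refine integral_congr_ae (Eventually.of_forall fun x => ?_)
    simp only
    rw [Finset.mul_sum, Finset.sum_mul, Complex.re_sum, Finset.mul_sum, ← Finset.sum_add_distrib,
      Finset.sum_mul, ← Finset.sum_add_distrib]
    refine Finset.sum_congr rfl fun j _ => ?_
    rw [pd_mul j ((hN j).differentiable (by norm_num) x) (hψ.differentiable (by norm_num) x),
      pd_re_mul_star j ((hp j).differentiable (by norm_num) x) (hvd x)]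
    ring


/-- The covariant derivative `(∇ - i a) u` in terms of the jet of `u`. -/
def covGrad (a : Fin n → ℝ) (y : ℂ × (Fin n → ℂ) × ℂ) (k : Fin n) : ℂ :=
  y.2.1 k - Complex.I * (a k : ℂ) * y.1

/-- The covariant Laplacian in terms of the jet `(u, ∇u, Δu)` and `b i j = ∂_i a_j`. -/
def covLap (a : Fin n → ℝ) (b : Fin n → Fin n → ℝ) (y : ℂ × (Fin n → ℂ) × ℂ) : ℂ :=
  y.2.2 - Complex.I * ∑ i, ((b i i : ℂ) * y.1 + (a i : ℂ) * y.2.1 i + (a i : ℂ) * covGrad a y i)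

/-- The integrand of the virial identity for a vector field `X` with derivative `Y i j = ∂_i X_j`. -/
def virial (a : Fin n → ℝ) (b : Fin n → Fin n → ℝ) (X : Fin n → ℝ) (Y : Fin n → Fin n → ℝ)
    (y : ℂ × (Fin n → ℂ) × ℂ) : ℝ :=
  (∑ k, X k * (covLap a b y * star (covGrad a y k)).re)
    + ∑ j, ∑ k, (Y j k * (covGrad a y j * star (covGrad a y k)).re
      - 1 / 2 * Y j j * (covGrad a y k * star (covGrad a y k)).re
      + X k * (covGrad a y j * star (-Complex.I * ((b j k - b k j : ℝ) : ℂ) * y.1)).re)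

theorem covGrad_smul (a : Fin n → ℝ) (t : ℝ) (y : ℂ × (Fin n → ℂ) × ℂ) (k : Fin n) :
    covGrad a (t • y) k = t • covGrad a y k := by
  simp only [covGrad, Prod.smul_fst, Prod.smul_snd, Pi.smul_apply, Complex.real_smul]
  ring

theorem covLap_smul (a : Fin n → ℝ) (b : Fin n → Fin n → ℝ) (t : ℝ) (y : ℂ × (Fin n → ℂ) × ℂ) :
    covLap a b (t • y) = t • covLap a b y := by
  simp only [covLap, covGrad_smul, Prod.smul_fst, Prod.smul_snd, Pi.smul_apply, Complex.real_smul,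
    mul_sub, Finset.mul_sum]
  congr 1
  refine Finset.sum_congr rfl fun i _ => ?_
  ring

theorem virial_smul (a : Fin n → ℝ) (b : Fin n → Fin n → ℝ) (X : Fin n → ℝ) (Y : Fin n → Fin n → ℝ)
    (t : ℝ) (y : ℂ × (Fin n → ℂ) × ℂ) : virial a b X Y (t • y) = t ^ 2 * virial a b X Y y := by
  have h : ∀ c : ℂ, c * (t • y).1 = t • (c * y.1) := fun c => by
    simp only [Prod.smul_fst, Complex.real_smul]; ring
  simp only [virial, covGrad_smul, covLap_smul, h, re_smul_mul_star_smul, mul_add, Finset.mul_sum]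
  congr 1
  · exact Finset.sum_congr rfl fun k _ => by ring
  · exact Finset.sum_congr rfl fun j _ => Finset.sum_congr rfl fun k _ => by ring

/-- By the product rule, the second derivatives that do not collect into the covariant Laplacian
occur as X_k Re(D_j v conj D_jD_k v) minus X_j Re(D_k v conj D_jD_k v). After exchanging the
summation indices in the second expression, their difference contains only the commutator of D_j and
D_k, which is −i(∂_jA_k − ∂_kA_j). -/
theorem virial_eq_sum_pd {A : Eu n → Eu n} (hA : ContDiff ℝ 1 A) {X : Fin n → Eu n → ℝ}
    (hX : ∀ k, ContDiff ℝ 1 (X k)) {v : Eu n → ℂ} (hv : ContDiff ℝ 2 v) (x : Eu n) :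
    virial (fun k => A x k) (fun i k => pd i A x k) (fun k => X k x) (fun i k => pd i (X k) x)
        (v x, (fun j => pd j v x), ∑ j, pd j (pd j v) x)
      = ∑ j, ∑ k, pd j (fun z => X k z * (magGrad A v (fun l => pd l v) j z
            * star (magGrad A v (fun l => pd l v) k z)).re
          - 1 / 2 * (X j z * (magGrad A v (fun l => pd l v) k z
            * star (magGrad A v (fun l => pd l v) k z)).re)) x := by
  have hv1 : ContDiff ℝ 1 v := hv.of_le (by norm_num)
  have hp : ∀ j, ContDiff ℝ 1 (pd j v) := fun j => ContDiff_pd hv (by norm_num) j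
  have hAk : ∀ k, ContDiff ℝ 1 (fun z => A z k) := fun k =>
    (EuclideanSpace.proj k : Eu n →L[ℝ] ℝ).contDiff.comp hA
  have hAc : ∀ k, ContDiff ℝ 1 (fun z => Complex.I * (A z k : ℂ)) := fun k =>
    contDiff_const.mul (Complex.ofRealCLM.contDiff.comp (hAk k))
  have hP : ∀ k, ContDiff ℝ 1 (magGrad A v (fun l => pd l v) k) := fun k =>
    (hp k).sub ((hAc k).mul hv1)
  have hd : ∀ {g : Eu n → ℂ}, ContDiff ℝ 1 g → DifferentiableAt ℝ g x := fun h =>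
    h.differentiable (by norm_num) x
  have hdr : ∀ {g : Eu n → ℝ}, ContDiff ℝ 1 g → DifferentiableAt ℝ g x := fun h =>
    h.differentiable (by norm_num) x
  have hPP : ∀ j k, ContDiff ℝ 1 (fun z => (magGrad A v (fun l => pd l v) j z
      * star (magGrad A v (fun l => pd l v) k z)).re) := fun j k =>
    Complex.reCLM.contDiff.comp ((hP j).mul (Complex.conjCLE.contDiff.comp (hP k)))
  have hQ : ∀ j k, pd j (magGrad A v (fun l => pd l v) k) x = pd j (pd k v) x
      - (Complex.I * (A x k : ℂ) * pd j v x + Complex.I * (pd j A x k : ℂ) * v x) := by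
    intro j k
    have h1 : magGrad A v (fun l => pd l v) k = fun z => pd k v z - Complex.I * (A z k : ℂ) * v z :=
      rfl
    have hc : ContDiff ℝ 1 (fun z => (A z k : ℂ)) := Complex.ofRealCLM.contDiff.comp (hAk k)
    rw [h1, pd_sub j (hd (hp k)) (hd ((hAc k).mul hv1)), pd_mul j (hd (hAc k)) (hd hv1),
      pd_const_mul Complex.I j (hd hc),
      pd_ofReal j (hdr (hAk k)), pd_apply j k (hA.differentiable (by norm_num) x)]
  have hsym : ∀ j k, pd j (pd k v) x = pd k (pd j v) x := fun j k => pd_comm hv.contDiffAt j k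
  set P : Fin n → ℂ := fun k => magGrad A v (fun l => pd l v) k x with hPdef
  have hcov : ∀ k, covGrad (fun k => A x k) (v x, (fun j => pd j v x), ∑ j, pd j (pd j v) x) k
      = P k := fun k => rfl
  have hPk : ∀ k, P k = pd k v x - Complex.I * (A x k : ℂ) * v x := fun k => rfl
  have hterm : ∀ j k, pd j (fun z => X k z * (magGrad A v (fun l => pd l v) j z
            * star (magGrad A v (fun l => pd l v) k z)).re
          - 1 / 2 * (X j z * (magGrad A v (fun l => pd l v) k z
            * star (magGrad A v (fun l => pd l v) k z)).re)) x
      = X k x * ((P j * star (pd j (magGrad A v (fun l => pd l v) k) x)).re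
          + (pd j (magGrad A v (fun l => pd l v) j) x * star (P k)).re)
        + pd j (X k) x * (P j * star (P k)).re
        - 1 / 2 * (X j x * (2 * (P k * star (pd j (magGrad A v (fun l => pd l v) k) x)).re)
          + pd j (X j) x * (P k * star (P k)).re) := by
    intro j k
    rw [pd_sub j (hdr ((hX k).mul (hPP j k))) (hdr (contDiff_const.mul ((hX j).mul (hPP k k)))),
      pd_const_mul _ j (hdr ((hX j).mul (hPP k k))), pd_mul j (hdr (hX k)) (hdr (hPP j k)),
      pd_mul j (hdr (hX j)) (hdr (hPP k k)), pd_re_mul_star j (hd (hP j)) (hd (hP k)),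
      pd_re_mul_star j (hd (hP k)) (hd (hP k)),
      re_mul_star_comm (pd j (magGrad A v (fun l => pd l v) k) x)]
    ring
  simp_rw [hterm]
  -- Renaming the indices makes both mixed second derivative terms carry the same factor X_k P_j.
  have hswap : ∑ j, ∑ k, X j x * (P k * star (pd j (magGrad A v (fun l => pd l v) k) x)).re
      = ∑ j, ∑ k, X k x * (P j * star (pd k (magGrad A v (fun l => pd l v) j) x)).re :=
    Finset.sum_comm
  have hL : covLap (fun k => A x k) (fun i k => pd i A x k)
      (v x, (fun j => pd j v x), ∑ j, pd j (pd j v) x)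
      = ∑ j, (pd j (magGrad A v (fun l => pd l v) j) x - Complex.I * (A x j : ℂ) * P j) := by
    simp only [covLap, hcov, hQ, Finset.mul_sum, ← Finset.sum_sub_distrib]
    refine Finset.sum_congr rfl fun j _ => ?_
    ring
  have hsplit : ∀ j k, X k x * ((P j * star (pd j (magGrad A v (fun l => pd l v) k) x)).re
          + (pd j (magGrad A v (fun l => pd l v) j) x * star (P k)).re)
        + pd j (X k) x * (P j * star (P k)).re
        - 1 / 2 * (X j x * (2 * (P k * star (pd j (magGrad A v (fun l => pd l v) k) x)).re)
          + pd j (X j) x * (P k * star (P k)).re)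
      = (X k x * ((P j * star (pd j (magGrad A v (fun l => pd l v) k) x)).re
          + (pd j (magGrad A v (fun l => pd l v) j) x * star (P k)).re)
        + pd j (X k) x * (P j * star (P k)).re
        - 1 / 2 * pd j (X j) x * (P k * star (P k)).re)
        - X j x * (P k * star (pd j (magGrad A v (fun l => pd l v) k) x)).re := by
    intro j k; ring
  simp_rw [hsplit, Finset.sum_sub_distrib]
  rw [hswap]
  simp only [virial, hcov, hL]
  have hX1 : ∑ k, X k x * ((∑ j, (pd j (magGrad A v (fun l => pd l v) j) x
        - Complex.I * (A x j : ℂ) * P j)) * star (P k)).re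
      = ∑ j, ∑ k, X k x * ((pd j (magGrad A v (fun l => pd l v) j) x
        - Complex.I * (A x j : ℂ) * P j) * star (P k)).re := by
    rw [Finset.sum_comm]
    refine Finset.sum_congr rfl fun k _ => ?_
    rw [Finset.sum_mul, Complex.re_sum, Finset.mul_sum]
  rw [hX1]
  simp only [← Finset.sum_add_distrib, ← Finset.sum_sub_distrib]
  refine Finset.sum_congr rfl fun j _ => ?_
  refine Finset.sum_congr rfl fun k _ => ?_
  -- The commutator of covariant derivatives, written with ordinary derivatives of P. The terms A_j
  -- P_k − A_k P_j restore covariance, and they cancel against those in `covLap` once real parts are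
  -- taken.
  have hcomm : pd j (magGrad A v (fun l => pd l v) k) x = pd k (magGrad A v (fun l => pd l v) j) x
      + (-Complex.I * ((pd j A x k - pd k A x j : ℝ) : ℂ) * v x
        + Complex.I * ((A x j : ℂ) * P k - (A x k : ℂ) * P j)) := by
    rw [hQ, hQ, hsym j k, hPk, hPk]
    push_cast
    ring
  rw [hcomm]
  generalize pd k (magGrad A v (fun l => pd l v) j) x = q1
  generalize pd j (magGrad A v (fun l => pd l v) j) x = q2
  generalize P j = p1
  generalize P k = p2
  generalize v x = v0
  simp only [Complex.star_def, Complex.mul_re, Complex.mul_im, Complex.conj_re, Complex.conj_im,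
    Complex.add_re, Complex.add_im, Complex.sub_re, Complex.sub_im, Complex.neg_re, Complex.neg_im,
    Complex.I_re, Complex.I_im, Complex.ofReal_re, Complex.ofReal_im]
  ring

/-- The virial density is a quadratic form in (v, ∇v, Δv) with continuous compactly supported
coefficients, and for smooth v it is a divergence. -/
theorem WeakJet.integral_virial (h : WeakJet u G L) {A : Eu n → Eu n} (hA : ContDiff ℝ 1 A)
    {X : Fin n → Eu n → ℝ} (hX : ∀ k, ContDiff ℝ 1 (X k)) (hc : ∀ k, HasCompactSupport (X k)) :
    Integrable (fun x => virial (fun k => A x k) (fun i k => pd i A x k) (fun k => X k x)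
        (fun i k => pd i (X k) x) (u x, (fun j => G j x), L x)) volume ∧
    ∫ x, virial (fun k => A x k) (fun i k => pd i A x k) (fun k => X k x) (fun i k => pd i (X k) x)
        (u x, (fun j => G j x), L x) = 0 := by
  have hA1 : ∀ k, Continuous fun x => A x k := fun k =>
    ((EuclideanSpace.proj k : Eu n →L[ℝ] ℝ).continuous.comp hA.continuous)
  have hA2 : ∀ i k, Continuous fun x => pd i A x k := fun i k =>
    ((EuclideanSpace.proj k : Eu n →L[ℝ] ℝ).continuous.comp (continuous_pd hA i))
  have hX1 : ∀ k, Continuous (X k) := fun k => (hX k).continuous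
  have hX2 : ∀ i k, Continuous (pd i (X k)) := fun i k => continuous_pd (hX k) i
  have hK : IsCompact (⋃ k, tsupport (X k)) := isCompact_iUnion fun k => (hc k).isCompact
  refine h.integral_quadratic_eq_zero (q := fun x y => virial (fun k => A x k)
    (fun i k => pd i A x k) (fun k => X k x) (fun i k => pd i (X k) x) y) ?_
    (fun x t y => virial_smul _ _ _ _ t y) hK ?_ ?_
  · have hA1' : ∀ k, Continuous fun z : Eu n × (ℂ × (Fin n → ℂ) × ℂ) => A z.1 k := fun k =>
      (hA1 k).comp continuous_fst
    have hA2' : ∀ i k, Continuous fun z : Eu n × (ℂ × (Fin n → ℂ) × ℂ) => pd i A z.1 k := fun i k =>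
      (hA2 i k).comp continuous_fst
    have hP : ∀ k, Continuous fun z : Eu n × (ℂ × (Fin n → ℂ) × ℂ) =>
        covGrad (fun k => A z.1 k) z.2 k := fun k => by
      have := hA1' k
      simp only [covGrad]
      fun_prop
    have hL : Continuous fun z : Eu n × (ℂ × (Fin n → ℂ) × ℂ) =>
        covLap (fun k => A z.1 k) (fun i k => pd i A z.1 k) z.2 := by
      simp only [covLap]
      have hc1 : ∀ i, Continuous fun z : Eu n × (ℂ × (Fin n → ℂ) × ℂ) => (A z.1 i : ℂ) := fun i =>
        Complex.continuous_ofReal.comp (hA1' i)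
      refine Continuous.sub (by fun_prop) (continuous_const.mul (continuous_finsetSum _ fun i _ => ?_))
      exact (((Complex.continuous_ofReal.comp (hA2' i i)).mul (by fun_prop)).add
        ((hc1 i).mul (by fun_prop))).add ((hc1 i).mul (hP i))
    simp only [Function.uncurry_def, virial]
    refine Continuous.add (continuous_finsetSum _ fun k _ => ?_)
      (continuous_finsetSum _ fun j _ => continuous_finsetSum _ fun k _ => ?_)
    · exact ((hX1 k).comp continuous_fst).mul
        (Complex.continuous_re.comp (hL.mul (continuous_star.comp (hP k))))
    · have hPP : ∀ j, Continuous fun z : Eu n × (ℂ × (Fin n → ℂ) × ℂ) =>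
          (covGrad (fun k => A z.1 k) z.2 j * star (covGrad (fun k => A z.1 k) z.2 k)).re := fun j =>
        Complex.continuous_re.comp ((hP j).mul (continuous_star.comp (hP k)))
      have hb : Continuous fun z : Eu n × (ℂ × (Fin n → ℂ) × ℂ) =>
          -Complex.I * ((pd j A z.1 k - pd k A z.1 j : ℝ) : ℂ) * z.2.1 :=
        (continuous_const.mul (Complex.continuous_ofReal.comp ((hA2' j k).sub (hA2' k j)))).mul
          (continuous_fst.comp continuous_snd)
      exact ((((hX2 j k).comp continuous_fst).mul (hPP j)).sub
        ((continuous_const.mul ((hX2 j j).comp continuous_fst)).mul (hPP k))).add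
        (((hX1 k).comp continuous_fst).mul
          (Complex.continuous_re.comp ((hP j).mul (continuous_star.comp hb))))
  · intro x hx y
    have hx' : ∀ k, x ∉ tsupport (X k) := fun k hk => hx (mem_iUnion.2 ⟨k, hk⟩)
    have h1 : ∀ k, X k x = 0 := fun k => image_eq_zero_of_notMem_tsupport (hx' k)
    have h2 : ∀ i k, pd i (X k) x = 0 := fun i k => by
      rw [pd, image_eq_zero_of_notMem_tsupport (fun h => hx' k (tsupport_fderiv_subset ℝ h))]; rfl
    simp [virial, h1, h2]
  · intro v hv
    have hv2 : ContDiff ℝ 2 v := mod_cast contDiff_infty.1 hv 2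
    simp_rw [virial_eq_sum_pd hA hX hv2]
    have hAk : ∀ k, ContDiff ℝ 1 (fun z => A z k) := fun k =>
      (EuclideanSpace.proj k : Eu n →L[ℝ] ℝ).contDiff.comp hA
    have hAc : ∀ k, ContDiff ℝ 1 (fun z => Complex.I * (A z k : ℂ)) := fun k =>
      contDiff_const.mul (Complex.ofRealCLM.contDiff.comp (hAk k))
    have hP : ∀ k, ContDiff ℝ 1 (magGrad A v (fun l => pd l v) k) := fun k =>
      (ContDiff_pd hv2 (by norm_num) k).sub ((hAc k).mul (hv2.of_le (by norm_num)))
    have hPP : ∀ j k, ContDiff ℝ 1 (fun z => (magGrad A v (fun l => pd l v) j z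
        * star (magGrad A v (fun l => pd l v) k z)).re) := fun j k =>
      Complex.reCLM.contDiff.comp ((hP j).mul (Complex.conjCLE.contDiff.comp (hP k)))
    have hN : ∀ j k, ContDiff ℝ 1 (fun z => X k z * (magGrad A v (fun l => pd l v) j z
            * star (magGrad A v (fun l => pd l v) k z)).re
          - 1 / 2 * (X j z * (magGrad A v (fun l => pd l v) k z
            * star (magGrad A v (fun l => pd l v) k z)).re)) := fun j k =>
      ((hX k).mul (hPP j k)).sub (contDiff_const.mul ((hX j).mul (hPP k k)))
    have hNc : ∀ j k, HasCompactSupport (fun z => X k z * (magGrad A v (fun l => pd l v) j z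
            * star (magGrad A v (fun l => pd l v) k z)).re
          - 1 / 2 * (X j z * (magGrad A v (fun l => pd l v) k z
            * star (magGrad A v (fun l => pd l v) k z)).re)) := fun j k =>
      (hc k).mul_right.sub (hc j).mul_right.mul_left
    have hi : ∀ j k, Integrable (pd j (fun z => X k z * (magGrad A v (fun l => pd l v) j z
            * star (magGrad A v (fun l => pd l v) k z)).re
          - 1 / 2 * (X j z * (magGrad A v (fun l => pd l v) k z
            * star (magGrad A v (fun l => pd l v) k z)).re))) volume := fun j k =>
      (continuous_pd (hN j k) j).integrable_of_hasCompactSupport (HasCompactSupport_pd (hNc j k) j)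
    rw [integral_finsetSum _ fun j _ => integrable_finsetSum _ fun k _ => hi j k]
    refine Finset.sum_eq_zero fun j _ => ?_
    rw [integral_finsetSum _ fun k _ => hi j k]
    exact Finset.sum_eq_zero fun k _ => integral_pd_eq_zero (hN j k) (hNc j k) j

end WeakIdentities

/-! ### Functions that are square integrable on balls -/

section LocallySquareIntegrable

/-- Square integrability on bounded sets. -/
def LocL2 (g : Eu n → ℂ) : Prop :=
  ∀ R : ℝ, MemLp g 2 (volume.restrict (Metric.closedBall (0 : Eu n) R))

theorem locallyIntegrable_of_closedBall {F : Type*} [NormedAddCommGroup F] {g : Eu n → F}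
    (h : ∀ R : ℝ, IntegrableOn g (Metric.closedBall (0 : Eu n) R) volume) :
    LocallyIntegrable g volume := by
  rw [locallyIntegrable_iff]
  intro K hK
  obtain ⟨R, hR⟩ := hK.isBounded.subset_closedBall (0 : Eu n)
  exact (h R).mono_set hR

theorem LocL2.add {g h : Eu n → ℂ} (hg : LocL2 g) (hh : LocL2 h) : LocL2 (fun x => g x + h x) :=
  fun R => (hg R).add (hh R)

theorem LocL2.sum {ι : Type*} (s : Finset ι) {g : ι → Eu n → ℂ} (hg : ∀ i ∈ s, LocL2 (g i)) :
    LocL2 (fun x => ∑ i ∈ s, g i x) :=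
  fun R => memLp_finsetSum s fun i hi => hg i hi R

theorem LocL2.mul_continuous {g c : Eu n → ℂ} (hc : Continuous c) (hg : LocL2 g) :
    LocL2 (fun x => c x * g x) := by
  intro R
  obtain ⟨C, hC⟩ := (isCompact_closedBall (0 : Eu n) R).exists_bound_of_continuousOn hc.continuousOn
  refine (hg R).of_le_mul (c := C) (hc.aestronglyMeasurable.mul (hg R).1) ?_
  refine (ae_restrict_iff' Metric.isClosed_closedBall.measurableSet).2
    (Eventually.of_forall fun x hx => ?_)
  rw [norm_mul]
  exact mul_le_mul_of_nonneg_right (hC x hx) (norm_nonneg _)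

theorem LocL2.of_memLp {g : Eu n → ℂ} (hg : MemLp g 2 volume) : LocL2 g :=
  fun _ => hg.restrict _

theorem LocL2.locallyIntegrable {g : Eu n → ℂ} (hg : LocL2 g) : LocallyIntegrable g volume := by
  refine locallyIntegrable_of_closedBall fun R => ?_
  have : IsFiniteMeasure ((volume : Measure (Eu n)).restrict (Metric.closedBall (0 : Eu n) R)) :=
    ⟨by rw [Measure.restrict_apply_univ]; exact measure_closedBall_lt_top⟩
  exact (hg R).integrable (by norm_num)

theorem LocL2.locallyIntegrable_sq {g : Eu n → ℂ} (hg : LocL2 g) :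
    LocallyIntegrable (fun x => ‖g x‖ ^ 2) volume :=
  locallyIntegrable_of_closedBall fun R => (hg R).integrable_norm_pow (by norm_num)

theorem _root_.MeasureTheory.LocallyIntegrable.integrable_mul_ofReal {g : Eu n → ℂ}
    (hg : LocallyIntegrable g volume) {ψ : Eu n → ℝ} (hψ : Continuous ψ) (hc : HasCompactSupport ψ) :
    Integrable (fun x => g x * (ψ x : ℂ)) volume := by
  refine (hg.integrable_smul_left_of_hasCompactSupport hψ hc).congr
    (Eventually.of_forall fun x => ?_)
  simp [mul_comm]

end LocallySquareIntegrable

/-! ### The weak equation gives a locally square integrable Laplacian -/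

section WeakEquation

theorem pd_mollify_of_contDiff {ψ : Eu n → ℝ} (hψ : ContDiff ℝ 1 ψ) (hc : HasCompactSupport ψ)
    (m : ℕ) (j : Fin n) (x : Eu n) : pd j (mollify m ψ) x = mollify m (pd j ψ) x := by
  rw [mollify_eq_convolution, mollify_eq_convolution, pd,
    (hc.hasFDerivAt_convolution_right _ (continuous_ker m).locallyIntegrable hψ x).fderiv,
    convolution_precompR_apply]
  · rfl
  · exact (continuous_ker m).locallyIntegrable
  · exact hc.fderiv ℝ
  · exact hψ.continuous_fderiv (by norm_num)

theorem tendsto_mollify_of_continuous {g : Eu n → ℝ} (hg : Continuous g) (x : Eu n) :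
    Tendsto (fun m => mollify m g x) atTop (𝓝 (g x)) := by
  simp_rw [mollify_eq_convolution]
  exact ContDiffBump.convolution_tendsto_right_of_continuous (φ := bump n) tendsto_rOut hg x

/-- Mollifications of a continuous compactly supported function are uniformly bounded and
supported in a common ball. -/
theorem exists_mollify_le_indicator {g : Eu n → ℝ} (hg : Continuous g) (hc : HasCompactSupport g) :
    ∃ C R : ℝ, 0 ≤ C ∧ ∀ m x, |mollify m g x|
      ≤ C * (Metric.closedBall (0 : Eu n) R).indicator (fun _ => (1 : ℝ)) x := by
  obtain ⟨C, hC⟩ := hg.bounded_above_of_compact_support hc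
  obtain ⟨R, hR⟩ := hc.isCompact.isBounded.subset_closedBall (0 : Eu n)
  have hC0 : 0 ≤ C := (norm_nonneg _).trans (hC 0)
  refine ⟨C, R + 2, hC0, fun m x => ?_⟩
  have hle : ∀ y, ‖g y‖ ≤ C * (Metric.closedBall (0 : Eu n) R).indicator (fun _ => (1 : ℝ)) y := by
    intro y
    by_cases hy : y ∈ Metric.closedBall (0 : Eu n) R
    · simpa [indicator_of_mem hy] using hC y
    · rw [image_eq_zero_of_notMem_tsupport (fun h => hy (hR h)), indicator_of_notMem hy]
      simp
  have hl : LocallyIntegrable ((Metric.closedBall (0 : Eu n) R).indicator fun _ => (1 : ℝ)) volume :=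
    (locallyIntegrable_const 1).indicator Metric.isClosed_closedBall.measurableSet
  have hl' : LocallyIntegrable
      (fun y => C * (Metric.closedBall (0 : Eu n) R).indicator (fun _ => (1 : ℝ)) y) volume :=
    hl.smul C
  refine (norm_mollify_le hl' hle m x).trans ?_
  have h2 := mollify_clm (C • ContinuousLinearMap.id ℝ ℝ) hl m x
  simp only [_root_.smul_apply, ContinuousLinearMap.id_apply, smul_eq_mul] at h2
  rw [h2]
  exact mul_le_mul_of_nonneg_left (mollify_indicator_le R m x) hC0

theorem hasCompactSupport_mollify {g : Eu n → ℝ} (hc : HasCompactSupport g) (m : ℕ) :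
    HasCompactSupport (mollify m g) := by
  rw [mollify_eq_convolution]
  exact (hasCompactSupport_ker m).convolution _ hc

theorem tendsto_integral_mul_mollify_test {g : Eu n → ℂ} (hg : LocallyIntegrable g volume)
    {ψ : Eu n → ℝ} (hψ : Continuous ψ) (hc : HasCompactSupport ψ) :
    Tendsto (fun m => ∫ x, g x * ((mollify m ψ x : ℝ) : ℂ)) atTop (𝓝 (∫ x, g x * (ψ x : ℂ))) := by
  obtain ⟨C, R, hC, hbd⟩ := exists_mollify_le_indicator hψ hc
  have hψl : LocallyIntegrable ψ volume := hψ.locallyIntegrable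
  refine tendsto_integral_of_dominated_convergence
    (fun x => C * (Metric.closedBall (0 : Eu n) R).indicator (fun x => ‖g x‖) x) (fun m => ?_) ?_
    (fun m => Eventually.of_forall fun x => ?_) (Eventually.of_forall fun x => ?_)
  · exact hg.aestronglyMeasurable.mul (Complex.continuous_ofReal.comp
      (contDiff_mollify hψl m).continuous).aestronglyMeasurable
  · exact ((integrable_indicator_iff Metric.isClosed_closedBall.measurableSet).2
      (hg.integrableOn_isCompact (isCompact_closedBall _ _)).norm).const_mul C
  · rw [norm_mul, Complex.norm_real, mul_comm]
    refine (mul_le_mul_of_nonneg_right (hbd m x) (norm_nonneg _)).trans (le_of_eq ?_)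
    by_cases hx : x ∈ Metric.closedBall (0 : Eu n) R
    · simp only [indicator_of_mem hx, mul_one]
    · simp only [indicator_of_notMem hx, mul_zero, zero_mul]
  · exact ((Complex.continuous_ofReal.tendsto _).comp (tendsto_mollify_of_continuous hψ x)).const_mul _

/-- The weak gradient may be tested against compactly supported `C¹` functions. -/
theorem HasWeakGradient.integral_mul_pd {u : Eu n → ℂ} {G : Fin n → Eu n → ℂ}
    (h : HasWeakGradient u G) {ψ : Eu n → ℝ} (hψ : ContDiff ℝ 1 ψ) (hc : HasCompactSupport ψ)
    (j : Fin n) : ∫ x, u x * ((pd j ψ x : ℝ) : ℂ) = - ∫ x, G j x * (ψ x : ℂ) := by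
  have h1 := tendsto_integral_mul_mollify_test h.1 (continuous_pd hψ j) (HasCompactSupport_pd hc j)
  have h2 := (tendsto_integral_mul_mollify_test (h.2 j).1 hψ.continuous hc).neg
  refine tendsto_nhds_unique h1 (h2.congr fun m => ?_)
  rw [← (h.2 j).2 (mollify m ψ) ⟨contDiff_mollify hψ.continuous.locallyIntegrable m,
    hasCompactSupport_mollify hc m⟩]
  simp_rw [pd_mollify_of_contDiff hψ hc]

/-- The weak Laplacian of a solution. -/
def weakLap (A : Eu n → Eu n) (V : Eu n → ℝ) (z : ℂ) (f u : Eu n → ℂ) (G : Fin n → Eu n → ℂ)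
    (x : Eu n) : ℂ :=
  f x + ((V x : ℂ) - z) * u x + Complex.I * ∑ i, (((pd i A x i : ℝ) : ℂ) * u x + (A x i : ℂ) * G i x
    + (A x i : ℂ) * magGrad A u G i x)

variable {A : Eu n → Eu n} {V : Eu n → ℝ} {z : ℂ} {f u : Eu n → ℂ} {G : Fin n → Eu n → ℂ}

/-- A, its first derivatives and V are bounded on balls. Hence ∇u = ∇_A u + iAu is in L²_loc, and so
is every term obtained by expanding the magnetic Laplacian in the equation. Real test functions
suffice to identify the resulting function as Δu. -/
theorem weakJet_of_isWeakSolution (hA : ContDiff ℝ 1 A) (hV : Continuous V) (hf : MemLp f 2 volume)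
    (hu : IsFormDomain A V u G) (hsol : IsWeakSolution A V z f u G) :
    WeakJet u G (weakLap A V z f u G) := by
  have hAk : ∀ k, ContDiff ℝ 1 (fun z => A z k) := fun k =>
    (EuclideanSpace.proj k : Eu n →L[ℝ] ℝ).contDiff.comp hA
  have hAc : ∀ k, Continuous (fun x => (A x k : ℂ)) := fun k =>
    Complex.continuous_ofReal.comp (hAk k).continuous
  have hAd : ∀ k, Continuous (fun x => ((pd k A x k : ℝ) : ℂ)) := fun k =>
    Complex.continuous_ofReal.comp
      ((EuclideanSpace.proj k : Eu n →L[ℝ] ℝ).continuous.comp (continuous_pd hA k))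
  have hu2 : LocL2 u := LocL2.of_memLp hu.memLp
  have hD2 : ∀ j, LocL2 (magGrad A u G j) := fun j => LocL2.of_memLp (hu.magGrad_memLp j)
  have hG2 : ∀ j, LocL2 (G j) := by
    intro j
    have h1 := (hD2 j).add (hu2.mul_continuous (c := fun x => Complex.I * (A x j : ℂ))
      (continuous_const.mul (hAc j)))
    have h2 : (fun x => magGrad A u G j x + Complex.I * (A x j : ℂ) * u x) = G j := by
      funext x; simp [magGrad]
    rwa [h2] at h1
  have hVz : Continuous fun x => ((V x : ℂ) - z) :=
    (Complex.continuous_ofReal.comp hV).sub continuous_const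
  have hL2 : LocL2 (weakLap A V z f u G) := by
    refine ((LocL2.of_memLp hf).add (hu2.mul_continuous hVz)).add
      (LocL2.mul_continuous continuous_const (LocL2.sum _ fun i _ => ?_))
    exact ((hu2.mul_continuous (hAd i)).add ((hG2 i).mul_continuous (hAc i))).add
      ((hD2 i).mul_continuous (hAc i))
  refine ⟨hu.weakGradient, hL2.locallyIntegrable, fun ψ hψ => ?_, hu2.locallyIntegrable_sq,
    fun j => (hG2 j).locallyIntegrable_sq, hL2.locallyIntegrable_sq⟩
  have hψ1 : ContDiff ℝ 1 ψ := hψ.1.of_le (by simp)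
  have hψd := hψ1.differentiable (by norm_num)
  have hpc : ∀ j, Continuous (pd j ψ) := fun j => continuous_pd hψ1 j
  have hpk : ∀ j, HasCompactSupport (pd j ψ) := fun j => HasCompactSupport_pd hψ.2 j
  have hs := hsol (fun x => (ψ x : ℂ)) ⟨Complex.ofRealCLM.contDiff.comp hψ.1,
    hψ.2.comp_left (g := fun t : ℝ => (t : ℂ)) (by simp)⟩
  have hmag : ∀ j x, star (magGrad A (fun x => (ψ x : ℂ)) (fun k => pd k fun x => (ψ x : ℂ)) j x)
      = ((pd j ψ x : ℝ) : ℂ) + Complex.I * (A x j : ℂ) * (ψ x : ℂ) := by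
    intro j x
    simp only [magGrad, pd_ofReal j (hψd x), Complex.star_def, map_sub, map_mul,
      Complex.conj_ofReal, Complex.conj_I]
    ring
  have hstar : ∀ x, star (ψ x : ℂ) = (ψ x : ℂ) := fun x => Complex.conj_ofReal _
  simp only [hmag, hstar] at hs
  have iψ : ∀ {g : Eu n → ℂ}, LocL2 g → Integrable (fun x => g x * (ψ x : ℂ)) volume := fun hg =>
    hg.locallyIntegrable.integrable_mul_ofReal hψ.1.continuous hψ.2
  have ip : ∀ {g : Eu n → ℂ} (j), LocL2 g → Integrable (fun x => g x * ((pd j ψ x : ℝ) : ℂ)) volume :=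
    fun j hg => hg.locallyIntegrable.integrable_mul_ofReal (hpc j) (hpk j)
  have i1 : Integrable (fun x => ∑ j, magGrad A u G j x * (((pd j ψ x : ℝ) : ℂ)
      + Complex.I * (A x j : ℂ) * (ψ x : ℂ))) volume := by
    refine integrable_finsetSum _ fun j _ => ?_
    refine ((ip j (hD2 j)).add (iψ ((hD2 j).mul_continuous (c := fun x => Complex.I * (A x j : ℂ))
      (continuous_const.mul (hAc j))))).congr (Eventually.of_forall fun x => ?_)
    simp only [Pi.add_apply]; ring
  have i2 : Integrable (fun x => (V x : ℂ) * u x * (ψ x : ℂ)) volume :=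
    iψ (hu2.mul_continuous (Complex.continuous_ofReal.comp hV))
  have i3 : Integrable (fun x => u x * (ψ x : ℂ)) volume := iψ hu2
  have i4 : Integrable (fun x => f x * (ψ x : ℂ)) volume := iψ (LocL2.of_memLp hf)
  have hAψ : ∀ j, ContDiff ℝ 1 (fun x => A x j * ψ x) := fun j => (hAk j).mul hψ1
  have hAψc : ∀ j, HasCompactSupport (fun x => A x j * ψ x) := fun j => hψ.2.mul_left
  have i5 : ∀ j, Integrable (fun x => u x * ((pd j (fun x => A x j * ψ x) x : ℝ) : ℂ)) volume :=
    fun j => hu2.locallyIntegrable.integrable_mul_ofReal (continuous_pd (hAψ j) j)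
      (HasCompactSupport_pd (hAψc j) j)
  have i6 : ∀ j, Integrable (fun x => G j x * ((A x j * ψ x : ℝ) : ℂ)) volume :=
    fun j => (hG2 j).locallyIntegrable.integrable_mul_ofReal (hAψ j).continuous (hAψc j)
  -- This moves the derivative off ψ in the first order term of the magnetic Laplacian. The product
  -- A_j ψ is only C¹, hence the extension of the weak gradient to C¹ test functions.
  have hz : ∀ j, ∫ x, (u x * ((pd j (fun x => A x j * ψ x) x : ℝ) : ℂ)
      + G j x * ((A x j * ψ x : ℝ) : ℂ)) = 0 := fun j => by
    rw [integral_add (i5 j) (i6 j), hu.weakGradient.integral_mul_pd (hAψ j) (hAψc j) j]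
    ring
  have i56 : ∀ j, Integrable (fun x => u x * ((pd j (fun x => A x j * ψ x) x : ℝ) : ℂ)
      + G j x * ((A x j * ψ x : ℝ) : ℂ)) volume := fun j => (i5 j).add (i6 j)
  have i7 : Integrable (fun x => ∑ j, (u x * ((pd j (fun x => A x j * ψ x) x : ℝ) : ℂ)
      + G j x * ((A x j * ψ x : ℝ) : ℂ))) volume :=
    integrable_finsetSum _ fun j _ => i56 j
  have hz' : ∫ x, ∑ j, (u x * ((pd j (fun x => A x j * ψ x) x : ℝ) : ℂ)
      + G j x * ((A x j * ψ x : ℝ) : ℂ)) = 0 := by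
    rw [integral_finsetSum _ fun j _ => i56 j]
    exact Finset.sum_eq_zero fun j _ => hz j
  have hpt : ∀ x, ∑ j, G j x * ((pd j ψ x : ℝ) : ℂ) = -(weakLap A V z f u G x * (ψ x : ℂ))
      + (∑ j, magGrad A u G j x * (((pd j ψ x : ℝ) : ℂ) + Complex.I * (A x j : ℂ) * (ψ x : ℂ))
        + (V x : ℂ) * u x * (ψ x : ℂ) - z * (u x * (ψ x : ℂ)) + f x * (ψ x : ℂ))
      + Complex.I * ∑ j, (u x * ((pd j (fun x => A x j * ψ x) x : ℝ) : ℂ)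
      + G j x * ((A x j * ψ x : ℝ) : ℂ)) := by
    intro x
    have h1 : ∀ j, G j x * ((pd j ψ x : ℝ) : ℂ)
        = magGrad A u G j x * (((pd j ψ x : ℝ) : ℂ) + Complex.I * (A x j : ℂ) * (ψ x : ℂ))
          + Complex.I * (u x * ((pd j (fun x => A x j * ψ x) x : ℝ) : ℂ)
            + G j x * ((A x j * ψ x : ℝ) : ℂ))
          - Complex.I * (((pd j A x j : ℝ) : ℂ) * u x + (A x j : ℂ) * G j x
            + (A x j : ℂ) * magGrad A u G j x) * (ψ x : ℂ) := by
      intro j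
      rw [pd_mul j ((hAk j).differentiable (by norm_num) x) (hψd x),
        pd_apply j j (hA.differentiable (by norm_num) x)]
      simp only [magGrad]
      push_cast
      ring
    simp_rw [h1]
    rw [Finset.sum_sub_distrib, Finset.sum_add_distrib, ← Finset.mul_sum, ← Finset.sum_mul,
      ← Finset.mul_sum]
    simp only [weakLap]
    ring
  simp_rw [hpt]
  have j1 : Integrable (fun x => weakLap A V z f u G x * (ψ x : ℂ)) volume := iψ hL2
  have j2 : Integrable (fun x => -(weakLap A V z f u G x * (ψ x : ℂ))) volume := j1.neg
  have j3 : Integrable (fun x => z * (u x * (ψ x : ℂ))) volume := i3.const_mul z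
  have j4 : Integrable (fun x => ∑ j, magGrad A u G j x * (((pd j ψ x : ℝ) : ℂ)
      + Complex.I * (A x j : ℂ) * (ψ x : ℂ)) + (V x : ℂ) * u x * (ψ x : ℂ)) volume := i1.add i2
  have j5 : Integrable (fun x => ∑ j, magGrad A u G j x * (((pd j ψ x : ℝ) : ℂ)
      + Complex.I * (A x j : ℂ) * (ψ x : ℂ)) + (V x : ℂ) * u x * (ψ x : ℂ)
      - z * (u x * (ψ x : ℂ))) volume := j4.sub j3
  have j6 : Integrable (fun x => ∑ j, magGrad A u G j x * (((pd j ψ x : ℝ) : ℂ)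
      + Complex.I * (A x j : ℂ) * (ψ x : ℂ)) + (V x : ℂ) * u x * (ψ x : ℂ)
      - z * (u x * (ψ x : ℂ)) + f x * (ψ x : ℂ)) volume := j5.add i4
  have j7 : Integrable (fun x => -(weakLap A V z f u G x * (ψ x : ℂ))
      + (∑ j, magGrad A u G j x * (((pd j ψ x : ℝ) : ℂ) + Complex.I * (A x j : ℂ) * (ψ x : ℂ))
        + (V x : ℂ) * u x * (ψ x : ℂ) - z * (u x * (ψ x : ℂ)) + f x * (ψ x : ℂ))) volume :=
    j2.add j6
  rw [integral_add j7 (i7.const_mul _), integral_const_mul, hz', mul_zero, add_zero,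
    integral_add j2 j6, integral_neg, integral_add j5 i4, integral_sub j4 j3, integral_add i1 i2,
    integral_const_mul]
  linear_combination -hs

end WeakEquation

/-- The standing assumptions on the data and on the weak solution. -/
structure IsSolution (A : Eu n → Eu n) (V : Eu n → ℝ) (z : ℂ) (f u : Eu n → ℂ)
    (G : Fin n → Eu n → ℂ) : Prop where
  hA : ContDiff ℝ 1 A
  hV : ContDiff ℝ 1 V
  hf : MemLp f 2 volume
  hu : IsFormDomain A V u G
  hsol : IsWeakSolution A V z f u G

/-- The weak gradient of `|u|²`. -/
def gradSq (A : Eu n → Eu n) (u : Eu n → ℂ) (G : Fin n → Eu n → ℂ) (j : Fin n) (x : Eu n) : ℝ :=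
  2 * (magGrad A u G j x * star (u x)).re

/-- The weak Laplacian of `|u|²`. -/
def lapSq (A : Eu n → Eu n) (V : Eu n → ℝ) (z : ℂ) (f u : Eu n → ℂ) (G : Fin n → Eu n → ℂ)
    (x : Eu n) : ℝ :=
  2 * magGradSq A u G x + 2 * (V x - z.re) * ‖u x‖ ^ 2 + 2 * (f x * star (u x)).re

theorem re_mul_star_self (w : ℂ) : (w * star w).re = ‖w‖ ^ 2 := by
  rw [Complex.star_def, Complex.mul_conj, Complex.normSq_eq_norm_sq, Complex.ofReal_re]

/-- A is real, so its contribution iA|u|² is purely imaginary: ∇|u|² can be computed with either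
gradient. -/
theorem re_grad_mul_star (A : Eu n → Eu n) (u : Eu n → ℂ) (G : Fin n → Eu n → ℂ) (j : Fin n)
    (x : Eu n) : 2 * (G j x * star (u x)).re = gradSq A u G j x := by
  simp only [gradSq, magGrad, Complex.star_def, Complex.mul_re, Complex.mul_im, Complex.conj_re,
    Complex.conj_im, Complex.sub_re, Complex.sub_im, Complex.I_re, Complex.I_im, Complex.ofReal_re,
    Complex.ofReal_im]
  ring

/-- The A-dependent terms of Re(Δu ū) complete |∇u|² to |∇_A u|², and the term with div A is purely
imaginary. The imaginary part of z drops out as well. -/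
theorem lapSq_eq (A : Eu n → Eu n) (V : Eu n → ℝ) (z : ℂ) (f u : Eu n → ℂ) (G : Fin n → Eu n → ℂ)
    (x : Eu n) : 2 * (∑ j, (G j x * star (G j x)).re) + 2 * (weakLap A V z f u G x * star (u x)).re
      = lapSq A V z f u G x := by
  have h1 : (weakLap A V z f u G x * star (u x)).re = (f x * star (u x)).re
      + (V x - z.re) * ‖u x‖ ^ 2 + ∑ i, (Complex.I * (((pd i A x i : ℝ) : ℂ) * u x
        + (A x i : ℂ) * G i x + (A x i : ℂ) * magGrad A u G i x) * star (u x)).re := by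
    rw [weakLap, add_mul, add_mul, Complex.add_re, Complex.add_re, Finset.mul_sum, Finset.sum_mul,
      Complex.re_sum, mul_assoc ((V x : ℂ) - z), ← re_mul_star_self]
    congr 2
    simp only [Complex.star_def, Complex.mul_re, Complex.mul_im, Complex.conj_re,
      Complex.conj_im, Complex.sub_re, Complex.sub_im, Complex.ofReal_re, Complex.ofReal_im]
    ring
  have h2 : ∀ j, (G j x * star (G j x)).re + (Complex.I * (((pd j A x j : ℝ) : ℂ) * u x
        + (A x j : ℂ) * G j x + (A x j : ℂ) * magGrad A u G j x) * star (u x)).re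
      = ‖magGrad A u G j x‖ ^ 2 := by
    intro j
    rw [← re_mul_star_self]
    simp only [magGrad, Complex.star_def, Complex.mul_re, Complex.mul_im, Complex.conj_re,
      Complex.conj_im, Complex.sub_re, Complex.sub_im, Complex.add_re, Complex.add_im,
      Complex.I_re, Complex.I_im, Complex.ofReal_re, Complex.ofReal_im]
    ring
  rw [h1, lapSq, magGradSq, ← Finset.sum_congr rfl fun j _ => h2 j, Finset.sum_add_distrib]
  ring

theorem memLp_integrable_mul_star {g h : Eu n → ℂ} (hg : MemLp g 2 volume) (hh : MemLp h 2 volume) :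
    Integrable (fun x => g x * star (h x)) volume :=
  hg.integrable_mul (MemLp.star hh)

theorem memLp_integrable_sq {g : Eu n → ℂ} (hg : MemLp g 2 volume) :
    Integrable (fun x => ‖g x‖ ^ 2) volume :=
  hg.integrable_norm_pow (by norm_num)

/-! ### Identities for |u|² and the virial identity for the solution -/

section Solution

variable {A : Eu n → Eu n} {V : Eu n → ℝ} {z : ℂ} {f u : Eu n → ℂ} {G : Fin n → Eu n → ℂ}

namespace IsSolution

theorem weakJet (h : IsSolution A V z f u G) : WeakJet u G (weakLap A V z f u G) :=
  weakJet_of_isWeakSolution h.hA h.hV.continuous h.hf h.hu h.hsol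

theorem integrable_sq (h : IsSolution A V z f u G) : Integrable (fun x => ‖u x‖ ^ 2) volume :=
  memLp_integrable_sq h.hu.memLp

theorem integrable_magGradSq (h : IsSolution A V z f u G) :
    Integrable (magGradSq A u G) volume :=
  integrable_finsetSum _ fun j _ => memLp_integrable_sq (h.hu.magGrad_memLp j)

theorem integrable_gradSq (h : IsSolution A V z f u G) (j : Fin n) :
    Integrable (gradSq A u G j) volume :=
  ((memLp_integrable_mul_star (h.hu.magGrad_memLp j) h.hu.memLp).re).const_mul 2

theorem integrable_potential (h : IsSolution A V z f u G) :
    Integrable (fun x => V x * ‖u x‖ ^ 2) volume := by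
  refine h.hu.potential.mono (h.hV.continuous.aestronglyMeasurable.mul h.integrable_sq.1)
    (Eventually.of_forall fun x => ?_)
  simp

theorem integrable_lapSq (h : IsSolution A V z f u G) : Integrable (lapSq A V z f u G) volume := by
  have h1 := (h.integrable_magGradSq.const_mul 2).add
    ((h.integrable_potential.sub (h.integrable_sq.const_mul z.re)).const_mul 2)
  refine (h1.add (((memLp_integrable_mul_star h.hf h.hu.memLp).re).const_mul 2)).congr
    (Eventually.of_forall fun x => ?_)
  simp only [lapSq, Pi.add_apply, Pi.sub_apply, RCLike.re_to_complex]
  ring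

theorem integral_sq_mul_pd (h : IsSolution A V z f u G) {ψ : Eu n → ℝ} (hψ : ContDiff ℝ 1 ψ)
    (hc : HasCompactSupport ψ) (j : Fin n) :
    Integrable (fun x => ‖u x‖ ^ 2 * pd j ψ x + gradSq A u G j x * ψ x) volume ∧
    ∫ x, (‖u x‖ ^ 2 * pd j ψ x + gradSq A u G j x * ψ x) = 0 := by
  have := h.weakJet.integral_normSq_pd hψ hc j
  simpa only [re_mul_star_self, re_grad_mul_star A] using this

theorem integral_lapSq_mul (h : IsSolution A V z f u G) {ψ : Eu n → ℝ} (hψ : ContDiff ℝ 1 ψ)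
    (hc : HasCompactSupport ψ) :
    Integrable (fun x => ∑ j, gradSq A u G j x * pd j ψ x + lapSq A V z f u G x * ψ x) volume ∧
    ∫ x, (∑ j, gradSq A u G j x * pd j ψ x + lapSq A V z f u G x * ψ x) = 0 := by
  have := h.weakJet.integral_laplacian_normSq hψ hc
  simpa only [re_grad_mul_star A, lapSq_eq] using this

theorem integral_sq_mul_lap (h : IsSolution A V z f u G) {ψ : Eu n → ℝ} (hψ : ContDiff ℝ 2 ψ)
    (hc : HasCompactSupport ψ) :
    Integrable (fun x => ‖u x‖ ^ 2 * ∑ j, pd j (pd j ψ) x - lapSq A V z f u G x * ψ x) volume ∧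
    ∫ x, (‖u x‖ ^ 2 * ∑ j, pd j (pd j ψ) x - lapSq A V z f u G x * ψ x) = 0 := by
  have h1 := fun j => h.integral_sq_mul_pd (ContDiff_pd hψ (by norm_num) j : ContDiff ℝ 1 (pd j ψ))
    (HasCompactSupport_pd hc j) j
  have h2 := h.integral_lapSq_mul (hψ.of_le (by norm_num)) hc
  have hpt : ∀ x, ‖u x‖ ^ 2 * ∑ j, pd j (pd j ψ) x - lapSq A V z f u G x * ψ x
      = ∑ j, (‖u x‖ ^ 2 * pd j (pd j ψ) x + gradSq A u G j x * pd j ψ x)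
        - (∑ j, gradSq A u G j x * pd j ψ x + lapSq A V z f u G x * ψ x) := by
    intro x
    rw [Finset.sum_add_distrib, Finset.mul_sum]
    ring
  simp_rw [hpt]
  have i1 : Integrable (fun x => ∑ j, (‖u x‖ ^ 2 * pd j (pd j ψ) x + gradSq A u G j x * pd j ψ x))
      volume := integrable_finsetSum _ fun j _ => (h1 j).1
  refine ⟨i1.sub h2.1, ?_⟩
  rw [integral_sub i1 h2.1, h2.2, sub_zero, integral_finsetSum _ fun j _ => (h1 j).1]
  exact Finset.sum_eq_zero fun j _ => (h1 j).2

end IsSolution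

/-- The integrand of the virial identity for the solution `u` and the vector field `X`. -/
def virialDensity (A : Eu n → Eu n) (V : Eu n → ℝ) (z : ℂ) (f u : Eu n → ℂ)
    (G : Fin n → Eu n → ℂ) (X : Fin n → Eu n → ℝ) (x : Eu n) : ℝ :=
  (∑ j, ∑ k, pd j (X k) x * (magGrad A u G j x * star (magGrad A u G k x)).re)
    - 1 / 2 * (∑ k, X k x * pd k V x) * ‖u x‖ ^ 2
    + (∑ j, ∑ k, X k x * ((pd j A x k - pd k A x j) * (u x * star (magGrad A u G j x)).im))
    + (∑ k, X k x * (f x * star (magGrad A u G k x)).re)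
    + 1 / 2 * (∑ k, pd k (X k) x) * (f x * star (u x)).re
    + z.im * (∑ k, X k x * (u x * star (magGrad A u G k x)).im)
    - 1 / 4 * (∑ k, pd k (X k) x) * lapSq A V z f u G x

/-- The equation turns the covariant Laplacian into f + (V − z)u. The real part of (V − z) X·u
conj(∇_A u) is ½(V − Re z) X·∇|u|², and |∇_A u|² in the div X term is expressed through `lapSq`. The
V and Re z terms then combine into divergences of V X|u|² and X|u|², leaving −½(X·∇V)|u|². -/
theorem virialDensity_eq (h : IsSolution A V z f u G) {X : Fin n → Eu n → ℝ}
    (hX : ∀ k, ContDiff ℝ 1 (X k)) (x : Eu n) :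
    virialDensity A V z f u G X x
      = virial (fun k => A x k) (fun i k => pd i A x k) (fun k => X k x) (fun i k => pd i (X k) x)
        (u x, (fun j => G j x), weakLap A V z f u G x)
      - 1 / 2 * (∑ k, (‖u x‖ ^ 2 * pd k (fun y => V y * X k y) x
          + gradSq A u G k x * (V x * X k x)))
      + 1 / 2 * z.re * ∑ k, (‖u x‖ ^ 2 * pd k (X k) x + gradSq A u G k x * X k x) := by
  have hcov : ∀ k, covGrad (fun k => A x k) (u x, (fun j => G j x), weakLap A V z f u G x) k
      = magGrad A u G k x := fun k => rfl
  have hlap : covLap (fun k => A x k) (fun i k => pd i A x k)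
      (u x, (fun j => G j x), weakLap A V z f u G x) = f x + ((V x : ℂ) - z) * u x := by
    simp only [covLap, hcov]
    simp only [weakLap]
    ring
  have hpd : ∀ k, pd k (fun y => V y * X k y) x = V x * pd k (X k) x + pd k V x * X k x := fun k =>
    pd_mul k (h.hV.differentiable (by norm_num) x) ((hX k).differentiable (by norm_num) x)
  simp only [virial, hcov, hlap, hpd]
  have e1 : ∀ k, X k x * ((f x + ((V x : ℂ) - z) * u x) * star (magGrad A u G k x)).re
      = X k x * (f x * star (magGrad A u G k x)).re
        + 1 / 2 * (V x - z.re) * (gradSq A u G k x * X k x)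
        + z.im * (X k x * (u x * star (magGrad A u G k x)).im) := by
    intro k
    simp only [gradSq, Complex.star_def, Complex.mul_re, Complex.mul_im, Complex.conj_re,
      Complex.conj_im, Complex.sub_re, Complex.sub_im, Complex.add_re, Complex.add_im,
      Complex.ofReal_re, Complex.ofReal_im]
    ring
  have e2 : ∀ j k, (magGrad A u G j x
      * star (-Complex.I * ((pd j A x k - pd k A x j : ℝ) : ℂ) * u x)).re
      = (pd j A x k - pd k A x j) * (u x * star (magGrad A u G j x)).im := by
    intro j k
    simp only [Complex.star_def, Complex.mul_re, Complex.mul_im, Complex.conj_re,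
      Complex.conj_im, Complex.neg_re, Complex.neg_im, Complex.I_re, Complex.I_im,
      Complex.ofReal_re, Complex.ofReal_im]
    ring
  have e3 : ∑ j, ∑ k, 1 / 2 * pd j (X j) x * (magGrad A u G k x * star (magGrad A u G k x)).re
      = 1 / 2 * (∑ j, pd j (X j) x) * magGradSq A u G x := by
    simp only [re_mul_star_self, ← Finset.mul_sum]
    change ∑ j, 1 / 2 * pd j (X j) x * magGradSq A u G x = _
    rw [← Finset.sum_mul, ← Finset.mul_sum]
  simp only [e1, e2, Finset.sum_add_distrib, Finset.sum_sub_distrib]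
  rw [e3]
  simp only [virialDensity, lapSq, mul_add, Finset.sum_add_distrib, ← Finset.mul_sum]
  have e4 : ∑ k, gradSq A u G k x * (V x * X k x) = V x * ∑ k, gradSq A u G k x * X k x := by
    rw [Finset.mul_sum]; exact Finset.sum_congr rfl fun k _ => by ring
  have e5 : ∑ k, pd k V x * X k x = ∑ k, X k x * pd k V x :=
    Finset.sum_congr rfl fun k _ => by ring
  rw [e4, e5]
  ring

theorem integral_virialDensity (h : IsSolution A V z f u G) {X : Fin n → Eu n → ℝ}
    (hX : ∀ k, ContDiff ℝ 1 (X k)) (hc : ∀ k, HasCompactSupport (X k)) :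
    ∫ x, virialDensity A V z f u G X x = 0 := by
  simp_rw [virialDensity_eq h hX]
  obtain ⟨i1, h1⟩ := h.weakJet.integral_virial h.hA hX hc
  have h2 := fun k => h.integral_sq_mul_pd (h.hV.mul (hX k)) (hc k).mul_left k
  have h3 := fun k => h.integral_sq_mul_pd (hX k) (hc k) k
  have i2 : Integrable (fun x => 1 / 2 * ∑ k, (‖u x‖ ^ 2 * pd k (fun y => V y * X k y) x
      + gradSq A u G k x * (V x * X k x))) volume :=
    (integrable_finsetSum _ fun k _ => (h2 k).1).const_mul _
  have i3 : Integrable (fun x => 1 / 2 * z.re * ∑ k, (‖u x‖ ^ 2 * pd k (X k) x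
      + gradSq A u G k x * X k x)) volume :=
    (integrable_finsetSum _ fun k _ => (h3 k).1).const_mul _
  have i12 : Integrable (fun x => virial (fun k => A x k) (fun i k => pd i A x k)
        (fun k => X k x) (fun i k => pd i (X k) x) (u x, (fun j => G j x), weakLap A V z f u G x)
      - 1 / 2 * ∑ k, (‖u x‖ ^ 2 * pd k (fun y => V y * X k y) x
      + gradSq A u G k x * (V x * X k x))) volume := i1.sub i2
  rw [integral_add i12 i3, integral_sub i1 i2, h1, integral_const_mul, integral_const_mul,
    integral_finsetSum _ fun k _ => (h2 k).1, integral_finsetSum _ fun k _ => (h3 k).1,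
    Finset.sum_eq_zero fun k _ => (h2 k).2, Finset.sum_eq_zero fun k _ => (h3 k).2]
  ring

end Solution

/-- Fatou's lemma. It turns bounds uniform in a regularisation parameter into integrability of the
singular limit. -/
theorem integrable_of_tendsto_of_integral_le {α : Type*} [MeasurableSpace α] {μ : Measure α}
    {f : ℕ → α → ℝ} {g : α → ℝ} (hf : ∀ m, Integrable (f m) μ) (h0 : ∀ m x, 0 ≤ f m x) {C : ℝ}
    (hC : ∀ m, ∫ x, f m x ∂μ ≤ C)
    (hlim : ∀ᵐ x ∂μ, Tendsto (fun m => f m x) atTop (𝓝 (g x))) : Integrable g μ := by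
  refine ⟨aestronglyMeasurable_of_tendsto_ae atTop (fun m => (hf m).1) hlim, ?_⟩
  have h1 : ∀ m, ∫⁻ x, ‖f m x‖ₑ ∂μ ≤ ENNReal.ofReal C := by
    intro m
    have := ofReal_integral_norm_eq_lintegral_enorm (hf m)
    rw [← this]
    refine ENNReal.ofReal_le_ofReal (le_trans (le_of_eq ?_) (hC m))
    exact integral_congr_ae (Eventually.of_forall fun x => Real.norm_of_nonneg (h0 m x))
  have h2 : ∫⁻ x, ‖g x‖ₑ ∂μ ≤ liminf (fun m => ∫⁻ x, ‖f m x‖ₑ ∂μ) atTop := by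
    have h3 : ∫⁻ x, ‖g x‖ₑ ∂μ = ∫⁻ x, liminf (fun m => ‖f m x‖ₑ) atTop ∂μ :=
      lintegral_congr_ae (by filter_upwards [hlim] with x hx using hx.enorm.liminf_eq.symm)
    rw [h3]
    exact lintegral_liminf_le' fun m => (hf m).1.aemeasurable.enorm
  refine lt_of_le_of_lt (h2.trans ?_) (ENNReal.ofReal_lt_top (r := C))
  exact (liminf_le_liminf (Eventually.of_forall h1)).trans (by simp)

/-! ### A fixed smooth cutoff at the origin -/

section Cutoff

/-- A smooth cutoff function, equal to `1` on the unit ball. -/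
def cutoff (x : Eu n) : ℝ := (⟨1, 2, one_pos, one_lt_two⟩ : ContDiffBump (0 : Eu n)) x

theorem contDiff_cutoff : ContDiff ℝ ∞ (cutoff (n := n)) := ContDiffBump.contDiff _

theorem hasCompactSupport_cutoff : HasCompactSupport (cutoff (n := n)) :=
  ContDiffBump.hasCompactSupport _

theorem cutoff_nonneg (x : Eu n) : 0 ≤ cutoff x := ContDiffBump.nonneg _

theorem cutoff_le_one (x : Eu n) : cutoff x ≤ 1 := ContDiffBump.le_one _

theorem cutoff_eq_one {x : Eu n} (h : ‖x‖ ≤ 1) : cutoff x = 1 :=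
  ContDiffBump.one_of_mem_closedBall _ (by simpa using h)

theorem cutoff_eq_zero {x : Eu n} (h : 2 ≤ ‖x‖) : cutoff x = 0 :=
  ContDiffBump.zero_of_le_dist _ (by simpa using h)

theorem cutoff_eventuallyEq_one {x : Eu n} (h : ‖x‖ < 1) : cutoff =ᶠ[𝓝 x] fun _ => 1 := by
  filter_upwards [Metric.isOpen_ball.mem_nhds (show x ∈ Metric.ball (0 : Eu n) 1 by simpa using h)]
    with y hy
  exact cutoff_eq_one (by simpa using (mem_ball_zero_iff.1 hy).le)

theorem pd_const {F : Type*} [NormedAddCommGroup F] [NormedSpace ℝ F] (j : Fin n) (c : F) (x : Eu n) :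
    pd j (fun _ => c) x = 0 := by
  simp [pd]

theorem pd_cutoff_eq_zero {x : Eu n} (h : ‖x‖ < 1) (j : Fin n) : pd j cutoff x = 0 := by
  rw [pd_congr j (cutoff_eventuallyEq_one h), pd_const]

theorem pd_eventuallyEq {F : Type*} [NormedAddCommGroup F] [NormedSpace ℝ F] {f g : Eu n → F}
    {x : Eu n} (h : f =ᶠ[𝓝 x] g) (j : Fin n) : pd j f =ᶠ[𝓝 x] pd j g := by
  filter_upwards [h.eventuallyEq_nhds] with y hy using pd_congr j hy

theorem pd_pd_cutoff_eq_zero {x : Eu n} (h : ‖x‖ < 1) (i j : Fin n) :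
    pd i (pd j cutoff) x = 0 := by
  rw [pd_congr i (pd_eventuallyEq (cutoff_eventuallyEq_one h) j),
    pd_congr i (Eventually.of_forall fun y => pd_const j (1 : ℝ) y), pd_const]

end Cutoff

/-! ### Regularised powers of 1/|x| and their derivatives -/

section RadialFunctions

theorem contDiff_normSq : ContDiff ℝ ∞ (fun x : Eu n => ‖x‖ ^ 2) := contDiff_norm_sq ℝ

theorem pd_normSq (j : Fin n) (x : Eu n) : pd j (fun y : Eu n => ‖y‖ ^ 2) x = 2 * x j := by
  rw [pd, (hasStrictFDerivAt_norm_sq x).hasFDerivAt.fderiv]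
  simp [EuclideanSpace.inner_single_right]

theorem sum_sq_eq_norm_sq (x : Eu n) : ∑ j, x j ^ 2 = ‖x‖ ^ 2 := by
  rw [EuclideanSpace.norm_sq_eq]
  simp

/-- Regularization of `|x|⁻²`. -/
def regInvSq (κ : ℝ) (x : Eu n) : ℝ := (‖x‖ ^ 2 + κ)⁻¹

/-- Regularization of `|x|⁻¹`. -/
def regInv (κ : ℝ) (x : Eu n) : ℝ := (√(‖x‖ ^ 2 + κ))⁻¹

theorem contDiff_regInvSq {κ : ℝ} (hκ : 0 < κ) : ContDiff ℝ ∞ (regInvSq (n := n) κ) :=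
  (contDiff_normSq.add contDiff_const).inv fun x => by positivity

theorem contDiff_regInv {κ : ℝ} (hκ : 0 < κ) : ContDiff ℝ ∞ (regInv (n := n) κ) := by
  refine ((contDiff_normSq.add contDiff_const).sqrt fun x => ?_).inv fun x => ?_ <;> positivity

theorem regInv_pos {κ : ℝ} (hκ : 0 < κ) (x : Eu n) : 0 < regInv κ x := by
  unfold regInv; positivity

theorem regInvSq_pos {κ : ℝ} (hκ : 0 < κ) (x : Eu n) : 0 < regInvSq κ x := by
  unfold regInvSq; positivity

theorem regInv_sq {κ : ℝ} (hκ : 0 < κ) (x : Eu n) : regInv κ x ^ 2 = regInvSq κ x := by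
  rw [regInv, inv_pow, Real.sq_sqrt (by positivity), regInvSq]

theorem norm_sq_mul_regInvSq_le {κ : ℝ} (hκ : 0 < κ) (x : Eu n) : ‖x‖ ^ 2 * regInvSq κ x ≤ 1 := by
  rw [regInvSq, ← div_eq_mul_inv, div_le_one (by positivity)]
  linarith

theorem norm_mul_regInv_le {κ : ℝ} (hκ : 0 < κ) (x : Eu n) : ‖x‖ * regInv κ x ≤ 1 := by
  have h1 := norm_sq_mul_regInvSq_le hκ x
  rw [← regInv_sq hκ, ← mul_pow] at h1
  have h2 : 0 ≤ ‖x‖ * regInv κ x := mul_nonneg (norm_nonneg _) (regInv_pos hκ x).le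
  nlinarith

theorem pd_regInvSq {κ : ℝ} (hκ : 0 < κ) (j : Fin n) (x : Eu n) :
    pd j (regInvSq κ) x = -(2 * x j * regInvSq κ x ^ 2) := by
  have h1 : HasDerivAt (fun t : ℝ => (t + κ)⁻¹) (-1 / (‖x‖ ^ 2 + κ) ^ 2) (‖x‖ ^ 2) :=
    ((hasDerivAt_id _).add_const κ).inv (by simp only [id]; positivity)
  have h2 := pd_scomp (f := fun y : Eu n => ‖y‖ ^ 2) (x := x) j h1.differentiableAt
    (contDiff_normSq.differentiable (by simp) x)
  rw [h1.deriv, pd_normSq] at h2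
  rw [show regInvSq κ = fun y : Eu n => (‖y‖ ^ 2 + κ)⁻¹ from rfl, h2]
  field_simp

theorem pd_regInv {κ : ℝ} (hκ : 0 < κ) (j : Fin n) (x : Eu n) :
    pd j (regInv κ) x = -(x j * regInv κ x ^ 3) := by
  have hs : 0 < √(‖x‖ ^ 2 + κ) := Real.sqrt_pos.2 (by positivity)
  have h1 : HasDerivAt (fun t : ℝ => (√(t + κ))⁻¹)
      (-(1 / (2 * √(‖x‖ ^ 2 + κ))) / √(‖x‖ ^ 2 + κ) ^ 2) (‖x‖ ^ 2) :=
    (((hasDerivAt_id (‖x‖ ^ 2)).add_const κ).sqrt (by simp only [id]; positivity)).inv hs.ne'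
  have h2 := pd_scomp (f := fun y : Eu n => ‖y‖ ^ 2) (x := x) j h1.differentiableAt
    (contDiff_normSq.differentiable (by simp) x)
  rw [h1.deriv, pd_normSq] at h2
  rw [show regInv κ = fun y : Eu n => (√(‖y‖ ^ 2 + κ))⁻¹ from rfl, h2]
  field_simp

theorem contDiff_coord (j : Fin n) : ContDiff ℝ ∞ (fun x : Eu n => x j) :=
  (EuclideanSpace.proj j : Eu n →L[ℝ] ℝ).contDiff

theorem pd_pow_three {g : Eu n → ℝ} {x : Eu n} (hg : DifferentiableAt ℝ g x) (j : Fin n) :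
    pd j (fun y => g y ^ 3) x = 3 * g x ^ 2 * pd j g x := by
  rw [pd_scomp (h := fun t => t ^ 3) j (by fun_prop) hg]
  simp

theorem pd_pd_regInv {κ : ℝ} (hκ : 0 < κ) (j : Fin n) (x : Eu n) :
    pd j (pd j (regInv κ)) x = -(regInv κ x ^ 3) + 3 * x j ^ 2 * regInv κ x ^ 5 := by
  have hd : DifferentiableAt ℝ (regInv κ) x := (contDiff_regInv hκ).differentiable (by simp) x
  have d1 : DifferentiableAt ℝ (fun y : Eu n => y j) x :=
    (contDiff_coord j).differentiable (by simp) x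
  have d2 : DifferentiableAt ℝ (fun y : Eu n => regInv κ y ^ 3) x := hd.pow 3
  have d3 : DifferentiableAt ℝ (fun y : Eu n => y j * regInv κ y ^ 3) x := d1.mul d2
  rw [pd_congr (g := fun y => (-1 : ℝ) * (y j * regInv κ y ^ 3)) j
    (Eventually.of_forall fun y => by rw [pd_regInv hκ]; ring),
    pd_const_mul _ j d3, pd_mul j d1 d2, pd_pow_three hd, pd_regInv hκ, pd_coord]
  simp
  ring

/-- The regularized fundamental solution is superharmonic in dimension at least three. -/
theorem sum_pd_pd_regInv_nonpos (hn : 3 ≤ n) {κ : ℝ} (hκ : 0 < κ) (x : Eu n) :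
    ∑ j, pd j (pd j (regInv κ)) x ≤ 0 := by
  simp_rw [pd_pd_regInv hκ]
  rw [Finset.sum_add_distrib, ← Finset.sum_mul, ← Finset.mul_sum, sum_sq_eq_norm_sq]
  simp only [Finset.sum_const, Finset.card_univ, Fintype.card_fin, nsmul_eq_mul]
  have h1 := norm_sq_mul_regInvSq_le hκ x
  rw [← regInv_sq hκ] at h1
  have h2 := regInv_pos hκ x
  have h3 : 0 < regInv κ x ^ 3 := by positivity
  have h4 : (3 : ℝ) ≤ n := by exact_mod_cast hn
  -- With e the regularised 1/|x|, the Laplacian is −e³(n − 3|x|²e²), where |x|²e² ≤ 1 and n ≥ 3.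
  have h5 : 3 * ‖x‖ ^ 2 * regInv κ x ^ 5 = 3 * regInv κ x ^ 3 * (‖x‖ ^ 2 * regInv κ x ^ 2) := by ring
  rw [h5]
  nlinarith

end RadialFunctions

/-! ### Hardy's inequality, uniformly in the regularisation -/

section Hardy

variable {A : Eu n → Eu n} {V : Eu n → ℝ} {z : ℂ} {f u : Eu n → ℂ} {G : Fin n → Eu n → ℂ}

theorem abs_gradSq_le (A : Eu n → Eu n) (u : Eu n → ℂ) (G : Fin n → Eu n → ℂ) (j : Fin n) (x : Eu n) :
    |gradSq A u G j x| ≤ 2 * (‖magGrad A u G j x‖ * ‖u x‖) := by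
  rw [gradSq, abs_mul, abs_two]
  gcongr
  refine (Complex.abs_re_le_norm _).trans (le_of_eq ?_)
  rw [norm_mul, norm_star]

theorem bounded_of_test {g : Eu n → ℝ} (hg : Continuous g) (hc : HasCompactSupport g) :
    ∃ C : ℝ, 0 ≤ C ∧ ∀ x, |g x| ≤ C := by
  obtain ⟨C, hC⟩ := hg.bounded_above_of_compact_support hc
  exact ⟨C, (norm_nonneg _).trans (hC 0), hC⟩

theorem contDiff_cutoff_one : ContDiff ℝ 1 (cutoff (n := n)) := contDiff_cutoff.of_le (by simp)

theorem exists_sum_coord_mul_pd_cutoff_le :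
    ∃ C : ℝ, 0 ≤ C ∧ ∀ x : Eu n, |∑ j, x j * pd j cutoff x| ≤ C := by
  refine bounded_of_test (continuous_finsetSum _ fun j _ =>
    (contDiff_coord j).continuous.mul (continuous_pd contDiff_cutoff_one j)) ?_
  have h : HasCompactSupport (fderiv ℝ (cutoff (n := n))) := hasCompactSupport_cutoff.fderiv ℝ
  refine h.mono' fun x hx => ?_
  by_contra hc
  have h0 : fderiv ℝ (cutoff (n := n)) x = 0 := image_eq_zero_of_notMem_tsupport hc
  exact hx (by simp [pd, h0])

namespace IsSolution

/-- Integrate the divergence of |u|² χ x/(|x|² + κ). The divergence of x/(|x|² + κ) is large enough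
in dimension n ≥ 3 to leave a positive multiple of the weight after ∇|u|² has been absorbed by
Young's inequality. The derivative of χ contributes only where |x| ≥ 1, and there the weight is
bounded by 1. -/
theorem integral_cutoff_mul_regInvSq_le (hn : 3 ≤ n) (h : IsSolution A V z f u G) :
    ∃ C : ℝ, ∀ κ : ℝ, 0 < κ → κ ≤ 1 →
      Integrable (fun x => cutoff x * regInvSq κ x * ‖u x‖ ^ 2) volume ∧
      ∫ x, cutoff x * regInvSq κ x * ‖u x‖ ^ 2 ≤ C := by
  obtain ⟨C, hC0, hC⟩ := exists_sum_coord_mul_pd_cutoff_le (n := n)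
  refine ⟨4 * (∫ x, magGradSq A u G x) + 2 * C * ∫ x, ‖u x‖ ^ 2, fun κ hκ _ => ?_⟩
  set g := regInvSq (n := n) κ with hg
  have hgc : ContDiff ℝ 1 g := (contDiff_regInvSq hκ).of_le (by simp)
  have hg0 : ∀ x, 0 < g x := regInvSq_pos hκ
  set Z : Fin n → Eu n → ℝ := fun j x => cutoff x * (x j * g x) with hZ
  have hZ1 : ∀ j, ContDiff ℝ 1 (Z j) := fun j =>
    contDiff_cutoff_one.mul (((contDiff_coord j).of_le (by simp)).mul hgc)
  have hZc : ∀ j, HasCompactSupport (Z j) := fun j => hasCompactSupport_cutoff.mul_right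
  have hE := fun j => h.integral_sq_mul_pd (hZ1 j) (hZc j) j
  have hEi : Integrable (fun x => ∑ j, (‖u x‖ ^ 2 * pd j (Z j) x + gradSq A u G j x * Z j x)) volume :=
    integrable_finsetSum _ fun j _ => (hE j).1
  have hE0 : ∫ x, ∑ j, (‖u x‖ ^ 2 * pd j (Z j) x + gradSq A u G j x * Z j x) = 0 := by
    rw [integral_finsetSum _ fun j _ => (hE j).1]
    exact Finset.sum_eq_zero fun j _ => (hE j).2
  have hpd : ∀ j x, pd j (Z j) x = cutoff x * (g x - 2 * x j ^ 2 * g x ^ 2)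
      + x j * pd j cutoff x * g x := by
    intro j x
    have d1 : DifferentiableAt ℝ (fun y : Eu n => y j) x :=
      (contDiff_coord j).differentiable (by simp) x
    have d2 : DifferentiableAt ℝ g x := hgc.differentiable (by norm_num) x
    have d3 : DifferentiableAt ℝ cutoff x := contDiff_cutoff_one.differentiable (by norm_num) x
    have d12 : DifferentiableAt ℝ (fun y : Eu n => y j * g y) x := d1.mul d2
    show pd j (fun y => cutoff y * (y j * g y)) x = _
    rw [pd_mul j d3 d12, pd_mul j d1 d2, pd_coord, if_pos rfl, hg, pd_regInvSq hκ]
    ring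
  have hlow : ∀ x, 1 / 2 * (cutoff x * g x * ‖u x‖ ^ 2)
      ≤ (∑ j, (‖u x‖ ^ 2 * pd j (Z j) x + gradSq A u G j x * Z j x))
        + 2 * magGradSq A u G x + C * ‖u x‖ ^ 2 := by
    intro x
    have hc0 := cutoff_nonneg x
    have hc1 := cutoff_le_one x
    have hW : 0 ≤ ‖u x‖ ^ 2 := sq_nonneg _
    have t1 : ∀ j, ‖u x‖ ^ 2 * (cutoff x * (g x - 2 * x j ^ 2 * g x ^ 2)
          + x j * pd j cutoff x * g x)
        - cutoff x * (1 / 2 * x j ^ 2 * g x ^ 2 * ‖u x‖ ^ 2 + 2 * ‖magGrad A u G j x‖ ^ 2)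
        ≤ ‖u x‖ ^ 2 * pd j (Z j) x + gradSq A u G j x * Z j x := by
      intro j
      rw [hpd]
      have h1 : -(cutoff x * (1 / 2 * x j ^ 2 * g x ^ 2 * ‖u x‖ ^ 2 + 2 * ‖magGrad A u G j x‖ ^ 2))
          ≤ gradSq A u G j x * Z j x := by
        have h2 := abs_gradSq_le A u G j x
        have h3 : |gradSq A u G j x * (x j * g x)|
            ≤ 1 / 2 * x j ^ 2 * g x ^ 2 * ‖u x‖ ^ 2 + 2 * ‖magGrad A u G j x‖ ^ 2 := by
          rw [abs_mul]
          have h4 : |gradSq A u G j x| * |x j * g x|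
              ≤ 2 * (‖magGrad A u G j x‖ * ‖u x‖) * |x j * g x| := by gcongr
          have h5 : |x j * g x| ^ 2 = x j ^ 2 * g x ^ 2 := by rw [sq_abs]; ring
          -- Young's inequality in the form 2ab ≤ ½a² + 2b². The coefficient ½ is small enough to be
          -- absorbed when n = 3.
          nlinarith [sq_nonneg (|x j * g x| * ‖u x‖ - 2 * ‖magGrad A u G j x‖)]
        have h6 := neg_abs_le (gradSq A u G j x * (x j * g x))
        have h7 : gradSq A u G j x * Z j x = cutoff x * (gradSq A u G j x * (x j * g x)) := by
          simp only [hZ]; ring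
        rw [h7, ← mul_neg]
        exact mul_le_mul_of_nonneg_left (by linarith) hc0
      linarith
    have t2 := Finset.sum_le_sum fun j (_ : j ∈ Finset.univ) => t1 j
    have t3 : ∑ j, (‖u x‖ ^ 2 * (cutoff x * (g x - 2 * x j ^ 2 * g x ^ 2)
          + x j * pd j cutoff x * g x)
        - cutoff x * (1 / 2 * x j ^ 2 * g x ^ 2 * ‖u x‖ ^ 2 + 2 * ‖magGrad A u G j x‖ ^ 2))
        = cutoff x * (n * g x - 5 / 2 * (‖x‖ ^ 2 * g x) * g x) * ‖u x‖ ^ 2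
          + (∑ j, x j * pd j cutoff x) * g x * ‖u x‖ ^ 2 - 2 * cutoff x * magGradSq A u G x := by
      have : ∀ j, ‖u x‖ ^ 2 * (cutoff x * (g x - 2 * x j ^ 2 * g x ^ 2)
          + x j * pd j cutoff x * g x)
        - cutoff x * (1 / 2 * x j ^ 2 * g x ^ 2 * ‖u x‖ ^ 2 + 2 * ‖magGrad A u G j x‖ ^ 2)
        = ‖u x‖ ^ 2 * cutoff x * g x - (5 / 2 * ‖u x‖ ^ 2 * cutoff x * g x ^ 2) * x j ^ 2
          + ‖u x‖ ^ 2 * g x * (x j * pd j cutoff x) - 2 * cutoff x * ‖magGrad A u G j x‖ ^ 2 := by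
        intro j; ring
      simp_rw [this]
      rw [Finset.sum_sub_distrib, Finset.sum_add_distrib, Finset.sum_sub_distrib, ← Finset.mul_sum,
        ← Finset.mul_sum, ← Finset.mul_sum, sum_sq_eq_norm_sq]
      rw [show ∑ j, 2 * cutoff x * ‖magGrad A u G j x‖ ^ 2 = 2 * cutoff x * magGradSq A u G x from
        (Finset.mul_sum ..).symm]
      simp only [Finset.sum_const, Finset.card_univ, Fintype.card_fin, nsmul_eq_mul]
      ring
    rw [t3] at t2
    have t4 : -C ≤ (∑ j, x j * pd j cutoff x) * g x := by
      rcases lt_or_ge ‖x‖ 1 with hx | hx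
      · simp only [pd_cutoff_eq_zero hx, mul_zero, Finset.sum_const_zero, zero_mul]
        linarith
      · have hg1 : g x ≤ 1 := by
          have := norm_sq_mul_regInvSq_le hκ x
          have h1 : 1 ≤ ‖x‖ ^ 2 := one_le_pow₀ hx
          nlinarith [hg0 x]
        have h1 := neg_abs_le ((∑ j, x j * pd j cutoff x) * g x)
        rw [abs_mul, abs_of_pos (hg0 x)] at h1
        nlinarith [hC x, hg0 x, abs_nonneg (∑ j, x j * pd j cutoff x)]
    have hn' : (3 : ℝ) ≤ n := by exact_mod_cast hn
    -- The coefficient 5/2 is 2, from differentiating g, plus ½ from Young's inequality. Since |x|²g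
    -- ≤ 1, what remains is at least (n − 5/2)g ≥ ½g.
    have t5 : 1 / 2 * g x ≤ n * g x - 5 / 2 * (‖x‖ ^ 2 * g x) * g x := by
      nlinarith [norm_sq_mul_regInvSq_le hκ x, hg0 x, mul_nonneg (sub_nonneg.2 hn') (hg0 x).le,
        mul_nonneg (sub_nonneg.2 (norm_sq_mul_regInvSq_le hκ x)) (hg0 x).le]
    have t6 : cutoff x * (1 / 2 * g x) * ‖u x‖ ^ 2
        ≤ cutoff x * (n * g x - 5 / 2 * (‖x‖ ^ 2 * g x) * g x) * ‖u x‖ ^ 2 := by gcongr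
    have t7 : -C * ‖u x‖ ^ 2 ≤ (∑ j, x j * pd j cutoff x) * g x * ‖u x‖ ^ 2 := by gcongr
    have t8 : 2 * cutoff x * magGradSq A u G x ≤ 2 * 1 * magGradSq A u G x := by
      have : 0 ≤ magGradSq A u G x := Finset.sum_nonneg fun _ _ => sq_nonneg _
      gcongr
    linarith
  have hint : Integrable (fun x => cutoff x * g x * ‖u x‖ ^ 2) volume := by
    have := (h.integrable_sq.bdd_mul (c := κ⁻¹) (f := fun x => cutoff x * g x)
      (contDiff_cutoff.continuous.mul hgc.continuous).aestronglyMeasurable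
      (Eventually.of_forall fun x => ?_))
    · exact this
    · rw [Real.norm_of_nonneg (mul_nonneg (cutoff_nonneg x) (hg0 x).le)]
      have : g x ≤ κ⁻¹ := by
        simp only [hg, regInvSq]
        gcongr
        nlinarith [sq_nonneg ‖x‖]
      nlinarith [cutoff_nonneg x, cutoff_le_one x, hg0 x]
  refine ⟨hint, ?_⟩
  have i1 : Integrable (fun x => (∑ j, (‖u x‖ ^ 2 * pd j (Z j) x + gradSq A u G j x * Z j x))
        + 2 * magGradSq A u G x) volume := hEi.add (h.integrable_magGradSq.const_mul 2)
  have i2 : Integrable (fun x => C * ‖u x‖ ^ 2) volume := h.integrable_sq.const_mul C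
  have i3 : Integrable (fun x => (∑ j, (‖u x‖ ^ 2 * pd j (Z j) x + gradSq A u G j x * Z j x))
        + 2 * magGradSq A u G x + C * ‖u x‖ ^ 2) volume := i1.add i2
  have hfin := integral_mono (hint.const_mul (1 / 2)) i3 hlow
  rw [integral_const_mul, integral_add i1 i2,
    integral_add hEi (h.integrable_magGradSq.const_mul 2), hE0, integral_const_mul,
    integral_const_mul] at hfin
  linarith

end IsSolution

end Hardy

/-! ### Integrability of the solution's quantities against 1/|x| -/

section Hardy

variable {A : Eu n → Eu n} {V : Eu n → ℝ} {z : ℂ} {f u : Eu n → ℂ} {G : Fin n → Eu n → ℂ}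

theorem two_le_infty : (2 : WithTop ℕ∞) ≤ ∞ :=
  WithTop.coe_le_coe.2 le_top

theorem ae_ne_zero (hn : 3 ≤ n) : ∀ᵐ x : Eu n, x ≠ 0 := by
  have : Nonempty (Fin n) := ⟨⟨0, by omega⟩⟩
  exact Measure.ae_ne volume 0

theorem tendsto_inv_natCast_add_one : Tendsto (fun m : ℕ => ((m : ℝ) + 1)⁻¹) atTop (𝓝 0) := by
  simpa using tendsto_one_div_add_atTop_nhds_zero_nat (𝕜 := ℝ)

theorem tendsto_regInvSq {x : Eu n} (hx : x ≠ 0) :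
    Tendsto (fun m : ℕ => regInvSq ((m : ℝ) + 1)⁻¹ x) atTop (𝓝 ((‖x‖⁻¹) ^ 2)) := by
  have h1 : Tendsto (fun m : ℕ => (‖x‖ ^ 2 + ((m : ℝ) + 1)⁻¹)⁻¹) atTop (𝓝 (‖x‖ ^ 2 + 0)⁻¹) := by
    refine (tendsto_const_nhds.add tendsto_inv_natCast_add_one).inv₀ ?_
    have := norm_pos_iff.2 hx
    positivity
  rwa [add_zero, ← inv_pow] at h1

theorem tendsto_regInv {x : Eu n} (hx : x ≠ 0) :
    Tendsto (fun m : ℕ => regInv ((m : ℝ) + 1)⁻¹ x) atTop (𝓝 ‖x‖⁻¹) := by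
  have h1 := (tendsto_regInvSq hx).sqrt
  rw [Real.sqrt_sq (by positivity)] at h1
  refine h1.congr fun m => ?_
  rw [← regInv_sq (by positivity), Real.sqrt_sq (regInv_pos (by positivity) x).le]

theorem regInvSq_le {κ : ℝ} (hκ : 0 < κ) {x : Eu n} (hx : x ≠ 0) : regInvSq κ x ≤ ‖x‖⁻¹ ^ 2 := by
  have := norm_pos_iff.2 hx
  rw [regInvSq, inv_pow]
  gcongr
  linarith

theorem integrable_mul_of_continuous_compact {g h : Eu n → ℝ} (hg : Continuous g)
    (hc : HasCompactSupport g) (hh : Integrable h volume) :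
    Integrable (fun x => g x * h x) volume := by
  obtain ⟨C, -, hC⟩ := bounded_of_test hg hc
  exact hh.bdd_mul (c := C) hg.aestronglyMeasurable (Eventually.of_forall hC)

/-- Integrability near the origin suffices for weights bounded away from it. -/
theorem cutoff_add_norm_bound {x : Eu n} (a : ℕ) {t : ℝ} (ht : 0 ≤ t) :
    t * ‖x‖⁻¹ ^ a ≤ cutoff x * ‖x‖⁻¹ ^ a * t + t := by
  rcases le_or_gt ‖x‖ 1 with hx | hx
  · rw [cutoff_eq_one hx]; linarith
  · have h1 : ‖x‖⁻¹ ^ a ≤ 1 := pow_le_one₀ (by positivity) (inv_le_one_of_one_le₀ hx.le)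
    have h2 : 0 ≤ cutoff x * ‖x‖⁻¹ ^ a * t := by
      have := cutoff_nonneg x
      positivity
    nlinarith

theorem aestronglyMeasurable_inv_norm_pow (a : ℕ) :
    AEStronglyMeasurable (fun x : Eu n => ‖x‖⁻¹ ^ a) volume :=
  (measurable_norm.inv.pow_const a).aestronglyMeasurable

theorem Integrable.mul_inv_norm_pow_of_cutoff {g : Eu n → ℝ} (hg : Integrable g volume)
    (h0 : ∀ x, 0 ≤ g x) (a : ℕ) (hc : Integrable (fun x => cutoff x * ‖x‖⁻¹ ^ a * g x) volume) :
    Integrable (fun x => g x * ‖x‖⁻¹ ^ a) volume := by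
  refine (hc.add hg).mono' (hg.1.mul (aestronglyMeasurable_inv_norm_pow a))
    (Eventually.of_forall fun x => ?_)
  rw [Real.norm_of_nonneg (mul_nonneg (h0 x) (by positivity))]
  exact cutoff_add_norm_bound a (h0 x)

namespace IsSolution

/-- Hardy's inequality, in qualitative form. -/
theorem integrable_sq_mul_inv_sq (hn : 3 ≤ n) (h : IsSolution A V z f u G) :
    Integrable (fun x => ‖u x‖ ^ 2 * ‖x‖⁻¹ ^ 2) volume := by
  obtain ⟨C, hC⟩ := integral_cutoff_mul_regInvSq_le hn h
  have hκ : ∀ m : ℕ, 0 < ((m : ℝ) + 1)⁻¹ := fun m => by positivity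
  have hκ1 : ∀ m : ℕ, ((m : ℝ) + 1)⁻¹ ≤ 1 := fun m =>
    inv_le_one_of_one_le₀ (by linarith [(m.cast_nonneg : (0 : ℝ) ≤ m)])
  refine Integrable.mul_inv_norm_pow_of_cutoff h.integrable_sq (fun x => sq_nonneg _) 2 ?_
  refine integrable_of_tendsto_of_integral_le (fun m => (hC _ (hκ m) (hκ1 m)).1) (fun m x => ?_)
    (fun m => (hC _ (hκ m) (hκ1 m)).2) ?_
  · have := cutoff_nonneg x
    have := (regInvSq_pos (hκ m) x).le
    positivity
  · filter_upwards [ae_ne_zero hn] with x hx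
    exact ((tendsto_regInvSq hx).const_mul _).mul_const _

theorem integrable_sq_mul_inv (hn : 3 ≤ n) (h : IsSolution A V z f u G) :
    Integrable (fun x => ‖u x‖ ^ 2 * ‖x‖⁻¹) volume := by
  refine (h.integrable_sq.add (h.integrable_sq_mul_inv_sq hn)).mono'
    (h.integrable_sq.1.mul measurable_norm.inv.aestronglyMeasurable)
    (Eventually.of_forall fun x => ?_)
  rw [Real.norm_of_nonneg (by positivity), Pi.add_apply, ← mul_one_add]
  gcongr
  nlinarith [sq_nonneg (‖x‖⁻¹ - 1 / 2)]

/-- In the Leibniz expansion of Δ(χe), the term χΔe is nonpositive by superharmonicity. The others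
contain derivatives of χ and vanish for |x| < 1, while for |x| ≥ 1 both e and its first derivatives
are bounded by 1. Only this one-sided bound is uniform in κ. -/
theorem exists_sum_pd_pd_cutoff_mul_regInv_le (hn : 3 ≤ n) :
    ∃ C : ℝ, ∀ κ : ℝ, 0 < κ → ∀ x : Eu n,
      ∑ j, pd j (pd j (fun y => cutoff y * regInv κ y)) x ≤ C := by
  have hb1 : ∀ j : Fin n, ∃ C : ℝ, 0 ≤ C ∧ ∀ x : Eu n, |pd j cutoff x| ≤ C := fun j =>
    bounded_of_test (continuous_pd contDiff_cutoff_one j)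
      (HasCompactSupport_pd hasCompactSupport_cutoff j)
  have hb2 : ∀ j : Fin n, ∃ C : ℝ, 0 ≤ C ∧ ∀ x : Eu n, |pd j (pd j cutoff) x| ≤ C := fun j =>
    bounded_of_test (continuous_pd (ContDiff_pd (k := 1) (m := 2) (contDiff_cutoff.of_le two_le_infty)
      (by norm_num) j) j) (HasCompactSupport_pd (HasCompactSupport_pd hasCompactSupport_cutoff j) j)
  choose B1 hB10 hB1 using hb1
  choose B2 hB20 hB2 using hb2
  refine ⟨∑ j, (2 * B1 j + B2 j), fun κ hκ x => ?_⟩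
  have hχ : ContDiff ℝ 2 (cutoff (n := n)) := contDiff_cutoff.of_le two_le_infty
  have he : ContDiff ℝ 2 (regInv (n := n) κ) := (contDiff_regInv hκ).of_le two_le_infty
  have hχ' : ∀ (j : Fin n), ContDiff ℝ 1 (pd j (cutoff (n := n))) := fun j =>
    ContDiff_pd hχ (by norm_num) j
  have he' : ∀ (j : Fin n), ContDiff ℝ 1 (pd j (regInv (n := n) κ)) := fun j =>
    ContDiff_pd he (by norm_num) j
  have hpp : ∀ j : Fin n, pd j (pd j (fun y => cutoff y * regInv κ y)) x
      = cutoff x * pd j (pd j (regInv κ)) x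
        + (2 * (pd j cutoff x * pd j (regInv κ) x) + pd j (pd j cutoff) x * regInv κ x) := by
    intro j
    have a1 : ∀ y, DifferentiableAt ℝ (cutoff (n := n)) y := hχ.differentiable (by norm_num)
    have a2 : ∀ y, DifferentiableAt ℝ (regInv (n := n) κ) y := he.differentiable (by norm_num)
    have a3 := (hχ' j).differentiable (by norm_num) x
    have a4 := (he' j).differentiable (by norm_num) x
    have a5 : DifferentiableAt ℝ (fun y => cutoff y * pd j (regInv κ) y) x := (a1 x).mul a4
    have a6 : DifferentiableAt ℝ (fun y => pd j cutoff y * regInv κ y) x := a3.mul (a2 x)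
    rw [pd_congr (g := fun y => cutoff y * pd j (regInv κ) y + pd j cutoff y * regInv κ y) j
      (Eventually.of_forall fun y => pd_mul j (a1 y) (a2 y)), pd_add j a5 a6,
      pd_mul j (a1 x) a4, pd_mul j a3 (a2 x)]
    ring
  simp_rw [hpp]
  rw [Finset.sum_add_distrib, ← Finset.mul_sum]
  have h1 : cutoff x * ∑ j, pd j (pd j (regInv κ)) x ≤ 0 :=
    mul_nonpos_of_nonneg_of_nonpos (cutoff_nonneg x) (sum_pd_pd_regInv_nonpos hn hκ x)
  have h2 : ∑ j, (2 * (pd j cutoff x * pd j (regInv κ) x) + pd j (pd j cutoff) x * regInv κ x)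
      ≤ ∑ j, (2 * B1 j + B2 j) := by
    refine Finset.sum_le_sum fun j _ => ?_
    rcases lt_or_ge ‖x‖ 1 with hx | hx
    · rw [pd_cutoff_eq_zero hx, pd_pd_cutoff_eq_zero hx]
      linarith [hB10 j, hB20 j]
    · have e0 := regInv_pos hκ x
      have e1 : regInv κ x ≤ 1 := by
        have := norm_mul_regInv_le hκ x
        nlinarith
      have e2 : |pd j (regInv κ) x| ≤ 1 := by
        rw [pd_regInv hκ, abs_neg, abs_mul, abs_of_pos (pow_pos e0 3)]
        have hxj : |x j| ≤ ‖x‖ := PiLp.norm_apply_le x j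
        have := norm_mul_regInv_le hκ x
        calc |x j| * regInv κ x ^ 3 ≤ ‖x‖ * regInv κ x ^ 3 := by gcongr
          _ = (‖x‖ * regInv κ x) * regInv κ x ^ 2 := by ring
          _ ≤ 1 * 1 := by gcongr; exact pow_le_one₀ e0.le e1
          _ = 1 := one_mul 1
      have e3 : pd j cutoff x * pd j (regInv κ) x ≤ B1 j * 1 := by
        refine (le_abs_self _).trans ?_
        rw [abs_mul]
        exact mul_le_mul (hB1 j x) e2 (abs_nonneg _) (hB10 j)
      have e4 : pd j (pd j cutoff) x * regInv κ x ≤ B2 j * 1 := by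
        refine (le_abs_self _).trans ?_
        rw [abs_mul, abs_of_pos e0]
        exact mul_le_mul (hB2 j x) e1 e0.le (hB20 j)
      linarith
  linarith

/-- Test Δ|u|² = `lapSq` against the cut-off regularisation of 1/|x|. The bound from above on the
Laplacian of this test function controls ∫ χe|∇_A u|² uniformly in κ, since the terms with V, Re z
and f are bounded through |u|²/|x|² ∈ L¹ and f ∈ L². Fatou's lemma removes the regularisation. -/
theorem integrable_magGradSq_mul_inv (hn : 3 ≤ n) (h : IsSolution A V z f u G) :
    Integrable (fun x => magGradSq A u G x * ‖x‖⁻¹) volume := by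
  obtain ⟨C, hC⟩ := exists_sum_pd_pd_cutoff_mul_regInv_le hn
  obtain ⟨K, hK0, hK⟩ : ∃ K : ℝ, 0 ≤ K ∧ ∀ x, |cutoff x * (V x - z.re)| ≤ K :=
    bounded_of_test (contDiff_cutoff.continuous.mul (h.hV.continuous.sub continuous_const))
      hasCompactSupport_cutoff.mul_right
  have hD0 : ∀ x, 0 ≤ magGradSq A u G x := fun x => Finset.sum_nonneg fun _ _ => sq_nonneg _
  have hκ : ∀ m : ℕ, 0 < ((m : ℝ) + 1)⁻¹ := fun m => by positivity
  have key : ∀ κ : ℝ, 0 < κ →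
      Integrable (fun x => cutoff x * regInv κ x * magGradSq A u G x) volume ∧
      ∫ x, cutoff x * regInv κ x * magGradSq A u G x
        ≤ 1 / 2 * ∫ x, (C * ‖u x‖ ^ 2 + (2 * K + 1) * (‖u x‖ ^ 2 + ‖u x‖ ^ 2 * ‖x‖⁻¹ ^ 2)
          + ‖f x‖ ^ 2) := by
    intro κ hκ
    have hec : ContDiff ℝ 2 (fun x : Eu n => cutoff x * regInv κ x) :=
      (contDiff_cutoff.of_le two_le_infty).mul ((contDiff_regInv hκ).of_le two_le_infty)
    have hcs : HasCompactSupport (fun x : Eu n => cutoff x * regInv κ x) :=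
      hasCompactSupport_cutoff.mul_right
    have hE := h.integral_sq_mul_lap hec hcs
    have i1 := integrable_mul_of_continuous_compact hec.continuous hcs h.integrable_magGradSq
    have i2 : Integrable (fun x => C * ‖u x‖ ^ 2 + (2 * K + 1) * (‖u x‖ ^ 2 + ‖u x‖ ^ 2 * ‖x‖⁻¹ ^ 2)
          + ‖f x‖ ^ 2) volume :=
      ((h.integrable_sq.const_mul C).add ((h.integrable_sq.add
        (h.integrable_sq_mul_inv_sq hn)).const_mul (2 * K + 1))).add (memLp_integrable_sq h.hf)
    have i3 := i2.sub hE.1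
    refine ⟨i1, ?_⟩
    have hm : ∫ x, 2 * (cutoff x * regInv κ x * magGradSq A u G x)
        ≤ ∫ x, ((C * ‖u x‖ ^ 2 + (2 * K + 1) * (‖u x‖ ^ 2 + ‖u x‖ ^ 2 * ‖x‖⁻¹ ^ 2) + ‖f x‖ ^ 2)
          - (‖u x‖ ^ 2 * ∑ j, pd j (pd j (fun y => cutoff y * regInv κ y)) x
            - lapSq A V z f u G x * (cutoff x * regInv κ x))) := by
      refine integral_mono_ae (i1.const_mul 2) i3 ?_
      filter_upwards [ae_ne_zero hn] with x hx
      have hc0 := cutoff_nonneg x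
      have hc1 := cutoff_le_one x
      have he0 := regInv_pos hκ x
      have he2 : regInv κ x ^ 2 ≤ ‖x‖⁻¹ ^ 2 := by rw [regInv_sq hκ]; exact regInvSq_le hκ hx
      have hW : 0 ≤ ‖u x‖ ^ 2 := sq_nonneg _
      have p1 : ‖u x‖ ^ 2 * ∑ j, pd j (pd j (fun y => cutoff y * regInv κ y)) x
          ≤ C * ‖u x‖ ^ 2 := by
        rw [mul_comm]; exact mul_le_mul_of_nonneg_right (hC κ hκ x) hW
      have p2 : -(K * (‖u x‖ ^ 2 + ‖u x‖ ^ 2 * ‖x‖⁻¹ ^ 2))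
          ≤ cutoff x * (V x - z.re) * (‖u x‖ ^ 2 * regInv κ x) := by
        have q1 : ‖u x‖ ^ 2 * regInv κ x ≤ ‖u x‖ ^ 2 + ‖u x‖ ^ 2 * ‖x‖⁻¹ ^ 2 := by
          rw [← mul_one_add]
          gcongr
          nlinarith [sq_nonneg (regInv κ x - 1 / 2)]
        have q2 := neg_abs_le (cutoff x * (V x - z.re) * (‖u x‖ ^ 2 * regInv κ x))
        have q3 : 0 ≤ ‖u x‖ ^ 2 * regInv κ x := by positivity
        have q4 : |cutoff x * (V x - z.re)| * (‖u x‖ ^ 2 * regInv κ x)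
            ≤ K * (‖u x‖ ^ 2 + ‖u x‖ ^ 2 * ‖x‖⁻¹ ^ 2) := by gcongr; exact hK x
        rw [abs_mul, abs_of_nonneg q3] at q2
        linarith
      have p3 : -(‖f x‖ ^ 2 + ‖u x‖ ^ 2 * ‖x‖⁻¹ ^ 2)
          ≤ 2 * (cutoff x * regInv κ x * (f x * star (u x)).re) := by
        have q1 := (abs_le.1 (Complex.abs_re_le_norm (f x * star (u x)))).1
        rw [norm_mul, norm_star] at q1
        have q2 : 0 ≤ cutoff x * regInv κ x := by positivity
        have q3 : cutoff x * regInv κ x * (‖f x‖ * ‖u x‖) ≤ 1 * regInv κ x * (‖f x‖ * ‖u x‖) := by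
          gcongr
        have q4 := mul_le_mul_of_nonneg_left q1 q2
        have q5 : ‖u x‖ ^ 2 * regInv κ x ^ 2 ≤ ‖u x‖ ^ 2 * ‖x‖⁻¹ ^ 2 := by gcongr
        nlinarith [sq_nonneg (‖f x‖ - ‖u x‖ * regInv κ x)]
      have p4 : 0 ≤ ‖u x‖ ^ 2 * ‖x‖⁻¹ ^ 2 := by positivity
      rw [lapSq]
      linarith
    rw [integral_const_mul, integral_sub i2 hE.1, hE.2, sub_zero] at hm
    linarith
  have := integrable_of_tendsto_of_integral_le (fun m : ℕ => (key _ (hκ m)).1)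
    (fun m x => mul_nonneg (mul_nonneg (cutoff_nonneg x) (regInv_pos (hκ m) x).le) (hD0 x))
    (fun m => (key _ (hκ m)).2)
    (g := fun x => cutoff x * ‖x‖⁻¹ ^ 1 * magGradSq A u G x) (by
      filter_upwards [ae_ne_zero hn] with x hx
      rw [pow_one]
      exact ((tendsto_regInv hx).const_mul _).mul_const _)
  simpa using Integrable.mul_inv_norm_pow_of_cutoff h.integrable_magGradSq hD0 1 this

theorem integrable_gradSq_mul_inv (hn : 3 ≤ n) (h : IsSolution A V z f u G) (j : Fin n) :
    Integrable (fun x => gradSq A u G j x * ‖x‖⁻¹) volume := by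
  refine ((memLp_integrable_sq (h.hu.magGrad_memLp j)).add (h.integrable_sq_mul_inv_sq hn)).mono'
    ((h.integrable_gradSq j).1.mul measurable_norm.inv.aestronglyMeasurable)
    (Eventually.of_forall fun x => ?_)
  rw [norm_mul, Real.norm_eq_abs, Real.norm_of_nonneg (by positivity : 0 ≤ ‖x‖⁻¹), Pi.add_apply]
  have h1 := mul_le_mul_of_nonneg_right (abs_gradSq_le A u G j x) (by positivity : 0 ≤ ‖x‖⁻¹)
  nlinarith [sq_nonneg (‖magGrad A u G j x‖ - ‖u x‖ * ‖x‖⁻¹)]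

theorem integrable_norm_mul_norm_mul_inv (hn : 3 ≤ n) (h : IsSolution A V z f u G) :
    Integrable (fun x => ‖f x‖ * ‖u x‖ * ‖x‖⁻¹) volume := by
  refine ((memLp_integrable_sq h.hf).add (h.integrable_sq_mul_inv_sq hn)).mono'
    ((h.hf.1.norm.mul h.hu.memLp.1.norm).mul measurable_norm.inv.aestronglyMeasurable)
    (Eventually.of_forall fun x => ?_)
  rw [Real.norm_of_nonneg (by positivity), Pi.add_apply]
  nlinarith [sq_nonneg (‖f x‖ - ‖u x‖ * ‖x‖⁻¹), sq_nonneg (‖f x‖ + ‖u x‖ * ‖x‖⁻¹)]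

/-- Near the origin V is bounded, so |u|²/|x| suffices; elsewhere 1/|x| is bounded and the form
domain condition suffices. -/
theorem integrable_potential_mul_inv (hn : 3 ≤ n) (h : IsSolution A V z f u G) :
    Integrable (fun x => V x * ‖u x‖ ^ 2 * ‖x‖⁻¹) volume := by
  have h1 := integrable_mul_of_continuous_compact (contDiff_cutoff.continuous.mul
    h.hV.continuous.abs) hasCompactSupport_cutoff.mul_right (h.integrable_sq_mul_inv hn)
  have h2 := Integrable.mul_inv_norm_pow_of_cutoff h.hu.potential (fun x => by positivity) 1
    (h1.congr (Eventually.of_forall fun x => by simp; ring))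
  refine h2.mono ((h.integrable_potential).1.mul measurable_norm.inv.aestronglyMeasurable)
    (Eventually.of_forall fun x => by simp)

theorem integrable_lapSq_mul_inv (hn : 3 ≤ n) (h : IsSolution A V z f u G) :
    Integrable (fun x => lapSq A V z f u G x * ‖x‖⁻¹) volume := by
  have h1 : Integrable (fun x => (f x * star (u x)).re * ‖x‖⁻¹) volume := by
    refine (h.integrable_norm_mul_norm_mul_inv hn).mono'
      ((memLp_integrable_mul_star h.hf h.hu.memLp).re.1.mul
        measurable_norm.inv.aestronglyMeasurable) (Eventually.of_forall fun x => ?_)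
    rw [norm_mul, Real.norm_of_nonneg (by positivity : 0 ≤ ‖x‖⁻¹)]
    gcongr
    refine (Complex.abs_re_le_norm _).trans (le_of_eq ?_)
    rw [norm_mul, norm_star]
  refine ((((h.integrable_magGradSq_mul_inv hn).const_mul 2).add
    (((h.integrable_potential_mul_inv hn).sub
      ((h.integrable_sq_mul_inv hn).const_mul z.re)).const_mul 2)).add (h1.const_mul 2)).congr
    (Eventually.of_forall fun x => ?_)
  simp only [lapSq, Pi.add_apply, Pi.sub_apply]
  ring

end IsSolution

end Hardy

/-! ### Derivatives and growth of the radial multipliers -/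

section RadialCalculus

theorem pd_norm {x : Eu n} (hx : x ≠ 0) (j : Fin n) :
    pd j (fun y : Eu n => ‖y‖) x = x j * ‖x‖⁻¹ := by
  have h0 : 0 < ‖x‖ := norm_pos_iff.2 hx
  have h1 : HasDerivAt (fun t : ℝ => √t) (1 / (2 * √(‖x‖ ^ 2))) (‖x‖ ^ 2) :=
    Real.hasDerivAt_sqrt (by positivity)
  have h2 := pd_scomp (f := fun y : Eu n => ‖y‖ ^ 2) (x := x) j h1.differentiableAt
    (contDiff_normSq.differentiable (by simp) x)
  rw [h1.deriv, pd_normSq] at h2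
  simp only [Real.sqrt_sq (norm_nonneg _)] at h2
  rw [h2]
  field_simp

theorem differentiableAt_norm {x : Eu n} (hx : x ≠ 0) : DifferentiableAt ℝ (fun y : Eu n => ‖y‖) x :=
  (contDiffAt_norm ℝ hx (n := 1)).differentiableAt (by norm_num)

theorem pd_radial {φ : ℝ → ℝ} {x : Eu n} (hx : x ≠ 0) (hφ : DifferentiableAt ℝ φ ‖x‖) (j : Fin n) :
    pd j (radial φ) x = deriv φ ‖x‖ * (x j * ‖x‖⁻¹) := by
  rw [← pd_norm hx]
  exact pd_scomp j hφ (differentiableAt_norm hx)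

theorem pd_coord_mul_inv_norm {x : Eu n} (hx : x ≠ 0) (i j : Fin n) :
    pd i (fun y : Eu n => y j * ‖y‖⁻¹) x
      = (if j = i then ‖x‖⁻¹ else 0) - x i * x j * ‖x‖⁻¹ ^ 3 := by
  have h0 : ‖x‖ ≠ 0 := norm_ne_zero_iff.2 hx
  have d1 : DifferentiableAt ℝ (fun y : Eu n => y j) x :=
    (contDiff_coord j).differentiable (by simp) x
  have d2 : DifferentiableAt ℝ (fun y : Eu n => ‖y‖⁻¹) x := (differentiableAt_norm hx).inv h0
  have h1 := pd_scomp (h := fun t => t⁻¹) i (differentiableAt_inv h0) (differentiableAt_norm hx)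
  rw [deriv_inv, pd_norm hx] at h1
  rw [pd_mul i d1 d2, h1, pd_coord]
  split_ifs <;> ring

theorem norm_coord_mul_inv_norm_le (x : Eu n) (j : Fin n) : |x j * ‖x‖⁻¹| ≤ 1 := by
  rw [abs_mul, abs_inv, abs_norm, ← div_eq_mul_inv]
  exact div_le_one_of_le₀ (PiLp.norm_apply_le x j) (norm_nonneg _)

theorem measurable_pd {F : Type*} [NormedAddCommGroup F] [NormedSpace ℝ F] [CompleteSpace F]
    [MeasurableSpace F] [BorelSpace F] (j : Fin n) (g : Eu n → F) : Measurable (pd j g) :=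
  measurable_fderiv_apply_const ℝ g _

theorem aestronglyMeasurable_comp_norm (hn : 3 ≤ n) {g : ℝ → ℝ} (hg : ContinuousOn g (Ioi 0)) :
    AEStronglyMeasurable (fun x : Eu n => g ‖x‖) volume := by
  have hs : MeasurableSet ({0}ᶜ : Set (Eu n)) := (measurableSet_singleton 0).compl
  have h1 : ContinuousOn (fun x : Eu n => g ‖x‖) {0}ᶜ :=
    hg.comp continuous_norm.continuousOn fun x hx => norm_pos_iff.2 hx
  have h2 := h1.aestronglyMeasurable (μ := volume) hs
  rwa [Measure.restrict_eq_self_of_ae_mem] at h2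
  filter_upwards [ae_ne_zero hn] with x hx using hx

namespace AdmissibleMultipliers

variable {φ θ : ℝ → ℝ}

theorem contDiffOn_deriv (h : AdmissibleMultipliers φ θ) : ContDiffOn ℝ 1 (deriv φ) (Ioi 0) :=
  h.contDiffOn.deriv_of_isOpen isOpen_Ioi (by norm_num)

theorem contDiffAt_radial (h : AdmissibleMultipliers φ θ) {x : Eu n} (hx : x ≠ 0) :
    ContDiffAt ℝ 2 (radial φ) x :=
  (h.contDiffOn.contDiffAt (Ioi_mem_nhds (norm_pos_iff.2 hx))).comp x (contDiffAt_norm ℝ hx)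

theorem contDiffAt_pd_radial (h : AdmissibleMultipliers φ θ) {x : Eu n} (hx : x ≠ 0) (j : Fin n) :
    ContDiffAt ℝ 1 (pd j (radial φ)) x :=
  ContDiffAt_pd (h.contDiffAt_radial hx) (by norm_num) j

theorem pd_radial_eq (h : AdmissibleMultipliers φ θ) {x : Eu n} (hx : x ≠ 0) (j : Fin n) :
    pd j (radial φ) x = deriv φ ‖x‖ * (x j * ‖x‖⁻¹) :=
  pd_radial hx ((h.contDiffOn.contDiffAt (Ioi_mem_nhds (norm_pos_iff.2 hx))).differentiableAt
    (by norm_num)) j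

theorem pd_pd_radial_eq (h : AdmissibleMultipliers φ θ) {x : Eu n} (hx : x ≠ 0) (i j : Fin n) :
    pd i (pd j (radial φ)) x = deriv (deriv φ) ‖x‖ * ((x i * ‖x‖⁻¹) * (x j * ‖x‖⁻¹))
      + deriv φ ‖x‖ * ((if j = i then ‖x‖⁻¹ else 0) - x i * x j * ‖x‖⁻¹ ^ 3) := by
  have h0 : 0 < ‖x‖ := norm_pos_iff.2 hx
  have d0 : DifferentiableAt ℝ (deriv φ) ‖x‖ :=
    (h.contDiffOn_deriv.contDiffAt (Ioi_mem_nhds h0)).differentiableAt (by norm_num)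
  have d1 : DifferentiableAt ℝ (fun y : Eu n => deriv φ ‖y‖) x :=
    d0.comp x (differentiableAt_norm hx)
  have d2 : DifferentiableAt ℝ (fun y : Eu n => y j * ‖y‖⁻¹) x :=
    ((contDiff_coord j).differentiable (by simp) x).mul
      ((differentiableAt_norm hx).inv h0.ne')
  rw [pd_congr (g := fun y : Eu n => deriv φ ‖y‖ * (y j * ‖y‖⁻¹)) i (by
    filter_upwards [isOpen_ne.mem_nhds hx] with y hy using h.pd_radial_eq hy j),
    pd_mul i d1 d2, pd_coord_mul_inv_norm hx, pd_scomp i d0 (differentiableAt_norm hx), pd_norm hx]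
  ring

theorem exists_bounds (h : AdmissibleMultipliers φ θ) : ∃ C : ℝ, 0 ≤ C ∧ ∀ x : Eu n, x ≠ 0 →
    |θ ‖x‖| ≤ C ∧ (∀ j, |pd j (radial φ) x| ≤ C * (1 + ‖x‖)) ∧
    ∀ i j, |pd i (pd j (radial φ)) x| ≤ C * (1 + ‖x‖⁻¹) := by
  obtain ⟨C, hC⟩ := h.bounds
  have hC0 : 0 ≤ C := (abs_nonneg _).trans (hC 1 one_pos).2.2.1
  -- The Hessian is bounded by |φ''| + 2|φ'|/r ≤ C(1 + 1/r) + 2C(1 + r)/r = 3C(1 + 1/r).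
  refine ⟨3 * C, by positivity, fun x hx => ?_⟩
  have h0 : 0 < ‖x‖ := norm_pos_iff.2 hx
  obtain ⟨b1, b2, b3, -⟩ := hC ‖x‖ h0
  have hinv : ‖x‖ * ‖x‖⁻¹ = 1 := mul_inv_cancel₀ h0.ne'
  have hi : 0 < ‖x‖⁻¹ := by positivity
  refine ⟨b3.trans (by linarith), fun j => ?_, fun i j => ?_⟩
  · rw [h.pd_radial_eq hx, abs_mul]
    have := mul_le_mul b1 (norm_coord_mul_inv_norm_le x j) (abs_nonneg _) (by positivity)
    nlinarith
  · rw [h.pd_pd_radial_eq hx]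
    have e1 : |(x i * ‖x‖⁻¹) * (x j * ‖x‖⁻¹)| ≤ 1 := by
      rw [abs_mul]
      exact mul_le_one₀ (norm_coord_mul_inv_norm_le x i) (abs_nonneg _)
        (norm_coord_mul_inv_norm_le x j)
    have e2 : |(if j = i then ‖x‖⁻¹ else 0) - x i * x j * ‖x‖⁻¹ ^ 3| ≤ 2 * ‖x‖⁻¹ := by
      have e3 : |(if j = i then ‖x‖⁻¹ else 0 : ℝ)| ≤ ‖x‖⁻¹ := by
        split_ifs
        · rw [abs_of_pos hi]
        · simp
      have e4 : |x i * x j * ‖x‖⁻¹ ^ 3| ≤ ‖x‖⁻¹ := by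
        rw [show x i * x j * ‖x‖⁻¹ ^ 3 = (x i * ‖x‖⁻¹) * (x j * ‖x‖⁻¹) * ‖x‖⁻¹ by ring, abs_mul,
          abs_of_pos hi]
        nlinarith
      have := abs_sub (if j = i then ‖x‖⁻¹ else 0 : ℝ) (x i * x j * ‖x‖⁻¹ ^ 3)
      linarith
    have e5 : |deriv (deriv φ) ‖x‖ * ((x i * ‖x‖⁻¹) * (x j * ‖x‖⁻¹))| ≤ C * (1 + 1 / ‖x‖) * 1 := by
      rw [abs_mul]
      exact mul_le_mul b2 e1 (abs_nonneg _) (by positivity)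
    have e6 : |deriv φ ‖x‖ * ((if j = i then ‖x‖⁻¹ else 0) - x i * x j * ‖x‖⁻¹ ^ 3)|
        ≤ C * (1 + ‖x‖) * (2 * ‖x‖⁻¹) := by
      rw [abs_mul]
      exact mul_le_mul b1 e2 (abs_nonneg _) (by positivity)
    have e7 := abs_add_le (deriv (deriv φ) ‖x‖ * ((x i * ‖x‖⁻¹) * (x j * ‖x‖⁻¹)))
      (deriv φ ‖x‖ * ((if j = i then ‖x‖⁻¹ else 0) - x i * x j * ‖x‖⁻¹ ^ 3))
    rw [one_div] at e5
    have e8 : C * (1 + ‖x‖) * (2 * ‖x‖⁻¹) = 2 * C * ‖x‖⁻¹ + 2 * C * (‖x‖ * ‖x‖⁻¹) := by ring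
    rw [e8, hinv] at e6
    nlinarith

/-- The Lipschitz bound in the hypotheses depends on the smaller of the two radii, so it is uniform
on (r/2, ∞). -/
theorem continuousOn_snd (h : AdmissibleMultipliers φ θ) : ContinuousOn θ (Ioi 0) := by
  obtain ⟨C, hC⟩ := h.bounds
  have hC0 : 0 ≤ C := (abs_nonneg _).trans (hC 1 one_pos).2.2.1
  intro r hr
  have hr : 0 < r := hr
  refine ContinuousAt.continuousWithinAt ?_
  have key : ∀ s, r / 2 < s → |θ s - θ r| ≤ C * (1 + 1 / (r / 2) ^ 2) * |s - r| := by
    have mono : ∀ t, r / 2 ≤ t → C * (1 + 1 / t ^ 2) ≤ C * (1 + 1 / (r / 2) ^ 2) := by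
      intro t ht
      gcongr
    intro s hs
    rcases lt_trichotomy s r with hsr | rfl | hsr
    · have := ((hC s (by linarith)).2.2.2 r hsr).2
      rw [abs_sub_comm, abs_sub_comm s r, abs_of_pos (sub_pos.2 hsr)]
      exact this.trans (mul_le_mul_of_nonneg_right (mono s hs.le) (sub_nonneg.2 hsr.le))
    · simp
    · have := ((hC r hr).2.2.2 s hsr).2
      rw [abs_of_pos (sub_pos.2 hsr)]
      exact this.trans (mul_le_mul_of_nonneg_right (mono r (by linarith)) (sub_nonneg.2 hsr.le))
  rw [ContinuousAt, tendsto_iff_norm_sub_tendsto_zero]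
  have hlim : Tendsto (fun s => C * (1 + 1 / (r / 2) ^ 2) * |s - r|) (𝓝 r) (𝓝 0) := by
    have : Continuous fun s => C * (1 + 1 / (r / 2) ^ 2) * |s - r| := by fun_prop
    simpa using this.tendsto r
  refine squeeze_zero' (Eventually.of_forall fun _ => norm_nonneg _) ?_ hlim
  filter_upwards [Ioi_mem_nhds (show r / 2 < r by linarith)] with s hs using key s hs

theorem aestronglyMeasurable_snd (hn : 3 ≤ n) (h : AdmissibleMultipliers φ θ) :
    AEStronglyMeasurable (fun x : Eu n => θ ‖x‖) volume :=
  aestronglyMeasurable_comp_norm hn h.continuousOn_snd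

theorem laplacian_radial_eq (h : AdmissibleMultipliers φ θ) {x : Eu n} (hx : x ≠ 0) :
    Laplacian.laplacian (radial φ) x = ∑ j, pd j (pd j (radial φ)) x :=
  laplacian_eq_sum_pd (h.contDiffAt_radial hx)

theorem sum_pd_mul_pd_eq (h : AdmissibleMultipliers φ θ) {x : Eu n} (hx : x ≠ 0)
    (V : Eu n → ℝ) : ∑ k, pd k (radial φ) x * pd k V x = deriv φ ‖x‖ * radialDeriv V x := by
  have hs : (‖x‖⁻¹ • x : Eu n) = ∑ k, (x k * ‖x‖⁻¹) • EuclideanSpace.single k (1 : ℝ) := by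
    ext i
    simp [Finset.sum_apply, Pi.single_apply, mul_comm]
  rw [radialDeriv, hs, map_sum, Finset.mul_sum]
  refine Finset.sum_congr rfl fun k _ => ?_
  rw [h.pd_radial_eq hx, map_smul, pd, smul_eq_mul]
  ring

theorem sum_pd_mul_curl_eq (h : AdmissibleMultipliers φ θ) {A : Eu n → Eu n} {x : Eu n} (hx : x ≠ 0)
    (j : Fin n) :
    ∑ k, pd k (radial φ) x * (pd j A x k - pd k A x j) = deriv φ ‖x‖ * magTangential A x j := by
  rw [magTangential, Matrix.vecMul, dotProduct, Finset.mul_sum]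
  refine Finset.sum_congr rfl fun k _ => ?_
  rw [h.pd_radial_eq hx, magField, Matrix.of_apply]
  ring

end AdmissibleMultipliers

end RadialCalculus

/-! ### Integrability of the terms with weights O(1 + 1/|x|) -/

section Integrability

variable {A : Eu n → Eu n} {V : Eu n → ℝ} {z : ℂ} {f u : Eu n → ℂ} {G : Fin n → Eu n → ℂ}
  {φ θ : ℝ → ℝ}

/-- A weight of size `O(1 + |x|⁻¹)` preserves integrability of functions
that are integrable against `|x|⁻¹`. -/
theorem Integrable.mul_of_abs_le_inv_norm {E : Type*} [NormedAddCommGroup E] [NormedSpace ℝ E]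
    {g : Eu n → ℝ} {k : Eu n → E} (hn : 3 ≤ n) (hg : Integrable g volume)
    (hg' : Integrable (fun x => g x * ‖x‖⁻¹) volume) (hk : AEStronglyMeasurable k volume) {C : ℝ}
    (hC : ∀ x, x ≠ 0 → ‖k x‖ ≤ C * (1 + ‖x‖⁻¹) * |g x|) : Integrable k volume := by
  refine ((hg.abs.add hg'.abs).const_mul C).mono' hk ?_
  filter_upwards [ae_ne_zero hn] with x hx
  refine (hC x hx).trans (le_of_eq ?_)
  rw [Pi.add_apply, abs_mul, abs_inv, abs_norm]
  ring

theorem magGradSq_nonneg (A : Eu n → Eu n) (u : Eu n → ℂ) (G : Fin n → Eu n → ℂ) (x : Eu n) :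
    0 ≤ magGradSq A u G x := Finset.sum_nonneg fun _ _ => sq_nonneg _

theorem norm_magGrad_mul_le (A : Eu n → Eu n) (u : Eu n → ℂ) (G : Fin n → Eu n → ℂ) (i j : Fin n)
    (x : Eu n) : ‖magGrad A u G i x‖ * ‖magGrad A u G j x‖ ≤ magGradSq A u G x := by
  have h1 : ∀ i, ‖magGrad A u G i x‖ ^ 2 ≤ magGradSq A u G x := fun i =>
    Finset.single_le_sum (f := fun i => ‖magGrad A u G i x‖ ^ 2) (fun _ _ => sq_nonneg _)
      (Finset.mem_univ i)
  nlinarith [h1 i, h1 j, sq_nonneg (‖magGrad A u G i x‖ - ‖magGrad A u G j x‖)]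

namespace IsSolution

theorem aestronglyMeasurable_magGrad (h : IsSolution A V z f u G) (j : Fin n) :
    AEStronglyMeasurable (magGrad A u G j) volume := (h.hu.magGrad_memLp j).1

theorem hessTerm_eq (Φ : Eu n → ℝ) (A : Eu n → Eu n) (u : Eu n → ℂ) (G : Fin n → Eu n → ℂ)
    (x : Eu n) : hessTerm Φ A u G x
      = ∑ i, ∑ j, pd i (pd j Φ) x * (magGrad A u G i x * star (magGrad A u G j x)).re := by
  rw [hessTerm, Complex.re_sum]
  refine Finset.sum_congr rfl fun i _ => ?_
  rw [Complex.re_sum]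
  refine Finset.sum_congr rfl fun j _ => ?_
  rw [mul_assoc, Complex.re_ofReal_mul]

theorem aestronglyMeasurable_re_mul_star {g h : Eu n → ℂ} (hg : AEStronglyMeasurable g volume)
    (hh : AEStronglyMeasurable h volume) :
    AEStronglyMeasurable (fun x => (g x * star (h x)).re) volume :=
  Complex.continuous_re.comp_aestronglyMeasurable (hg.mul hh.star)

theorem abs_re_mul_star_le (a b : ℂ) : |(a * star b).re| ≤ ‖a‖ * ‖b‖ := by
  refine (Complex.abs_re_le_norm _).trans (le_of_eq ?_)
  rw [norm_mul, norm_star]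

theorem integrable_mul_re_magGrad (hn : 3 ≤ n) (h : IsSolution A V z f u G) {k : Eu n → ℝ}
    (hk : AEStronglyMeasurable k volume) {C : ℝ}
    (hC : ∀ x, x ≠ 0 → |k x| ≤ C * (1 + ‖x‖⁻¹)) (i j : Fin n) :
    Integrable (fun x => k x * (magGrad A u G i x * star (magGrad A u G j x)).re) volume := by
  refine Integrable.mul_of_abs_le_inv_norm hn h.integrable_magGradSq
    (h.integrable_magGradSq_mul_inv hn) (hk.mul (aestronglyMeasurable_re_mul_star
      (h.aestronglyMeasurable_magGrad i) (h.aestronglyMeasurable_magGrad j))) (C := C) fun x hx => ?_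
  rw [norm_mul, abs_of_nonneg (magGradSq_nonneg A u G x), Real.norm_eq_abs, Real.norm_eq_abs]
  exact mul_le_mul (hC x hx) ((abs_re_mul_star_le _ _).trans (norm_magGrad_mul_le A u G i j x))
    (abs_nonneg _) ((abs_nonneg _).trans (hC x hx))

/-- D²φ is O(1 + 1/|x|), and both |∇_A u|² and |∇_A u|²/|x| are integrable. -/
theorem integrable_hessTerm (hn : 3 ≤ n) (h : IsSolution A V z f u G)
    (hm : AdmissibleMultipliers φ θ) : Integrable (hessTerm (radial φ) A u G) volume := by
  obtain ⟨C, -, hC⟩ := hm.exists_bounds (n := n)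
  refine Integrable.congr ?_ (Eventually.of_forall fun x => (hessTerm_eq (radial φ) A u G x).symm)
  exact integrable_finsetSum _ fun i _ => integrable_finsetSum _ fun j _ =>
    h.integrable_mul_re_magGrad hn (measurable_pd i _).aestronglyMeasurable
      (fun x hx => (hC x hx).2.2 i j) i j

theorem integrable_snd_mul {E : Type*} [NormedAddCommGroup E] [NormedSpace ℝ E] {g : Eu n → E}
    (hn : 3 ≤ n) (hm : AdmissibleMultipliers φ θ) (hg : Integrable g volume) :
    Integrable (fun x => θ ‖x‖ • g x) volume := by
  obtain ⟨C, -, hC⟩ := hm.exists_bounds (n := n)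
  refine hg.bdd_smul C (hm.aestronglyMeasurable_snd hn) ?_
  filter_upwards [ae_ne_zero hn] with x hx using (hC x hx).1

theorem norm_sum_pd_pd_radial_le {C : ℝ} {x : Eu n}
    (hC : ∀ i j, |pd i (pd j (radial φ)) x| ≤ C * (1 + ‖x‖⁻¹)) :
    |∑ j, pd j (pd j (radial φ)) x| ≤ n * C * (1 + ‖x‖⁻¹) := by
  refine (Finset.abs_sum_le_sum_abs _ _).trans
    ((Finset.sum_le_sum fun j _ => hC j j).trans (le_of_eq ?_))
  simp only [Finset.sum_const, Finset.card_univ, Fintype.card_fin, nsmul_eq_mul]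
  ring

theorem integrable_laplacian_mul (hn : 3 ≤ n) (h : IsSolution A V z f u G)
    (hm : AdmissibleMultipliers φ θ) : Integrable (fun x => f x *
      ((1 / 2) * ((Laplacian.laplacian (radial φ) x : ℝ) : ℂ) * star (u x))) volume := by
  obtain ⟨C, -, hC⟩ := hm.exists_bounds (n := n)
  have h1 : Integrable (fun x => ((∑ j, pd j (pd j (radial φ)) x : ℝ) : ℂ) *
      (f x * star (u x))) volume := by
    refine Integrable.mul_of_abs_le_inv_norm (g := fun x => ‖f x‖ * ‖u x‖) hn ?_
      (h.integrable_norm_mul_norm_mul_inv hn) ?_ (C := n * C) fun x hx => ?_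
    · exact (memLp_integrable_mul_star h.hf h.hu.memLp).norm.congr
        (Eventually.of_forall fun x => by simp)
    · exact (Complex.continuous_ofReal.comp_aestronglyMeasurable
        (Finset.measurable_sum _ fun j _ => measurable_pd j _).aestronglyMeasurable).mul
          (memLp_integrable_mul_star h.hf h.hu.memLp).1
    · rw [norm_mul, norm_mul, norm_star, Complex.norm_real, Real.norm_eq_abs,
        abs_of_nonneg (by positivity : 0 ≤ ‖f x‖ * ‖u x‖)]
      gcongr
      exact norm_sum_pd_pd_radial_le (hC x hx).2.2
  refine (h1.const_mul (1 / 2)).congr ?_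
  filter_upwards [ae_ne_zero hn] with x hx
  rw [hm.laplacian_radial_eq hx]
  ring

end IsSolution

end Integrability

/-! ### Cutoffs to annuli, with scale-invariant derivative bounds -/

section AnnularCutoff

theorem pd_comp_smul {g : Eu n → ℝ} {x : Eu n} (c : ℝ) (j : Fin n)
    (hg : DifferentiableAt ℝ g (c • x)) : pd j (fun y => g (c • y)) x = c * pd j g (c • x) := by
  have h1 : HasFDerivAt (fun y : Eu n => c • y) (c • ContinuousLinearMap.id ℝ (Eu n)) x :=
    (hasFDerivAt_id x).const_smul c
  have h2 : HasFDerivAt (fun y => g (c • y))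
      ((fderiv ℝ g (c • x)).comp (c • ContinuousLinearMap.id ℝ (Eu n))) x :=
    hg.hasFDerivAt.comp x h1
  rw [pd, h2.fderiv, pd]
  simp

/-- A smooth cutoff to the annulus `1 / (m + 1) ≤ |x| ≤ 2 (m + 1)`. -/
def annulus (m : ℕ) (x : Eu n) : ℝ :=
  (1 - cutoff (((m : ℝ) + 1) • x)) * cutoff (((m : ℝ) + 1)⁻¹ • x)

theorem contDiff_cutoff_smul (c : ℝ) : ContDiff ℝ ∞ (fun x : Eu n => cutoff (c • x)) :=
  contDiff_cutoff.comp (contDiff_const_smul c)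

theorem contDiff_annulus (m : ℕ) : ContDiff ℝ ∞ (annulus (n := n) m) :=
  (contDiff_const.sub (contDiff_cutoff_smul _)).mul (contDiff_cutoff_smul _)

theorem hasCompactSupport_cutoff_smul {c : ℝ} (hc : c ≠ 0) :
    HasCompactSupport (fun x : Eu n => cutoff (c • x)) :=
  hasCompactSupport_cutoff.comp_smul hc

theorem hasCompactSupport_annulus (m : ℕ) : HasCompactSupport (annulus (n := n) m) :=
  (hasCompactSupport_cutoff_smul (by positivity)).mul_left

theorem annulus_nonneg (m : ℕ) (x : Eu n) : 0 ≤ annulus m x :=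
  mul_nonneg (sub_nonneg.2 (cutoff_le_one _)) (cutoff_nonneg _)

theorem annulus_le_one (m : ℕ) (x : Eu n) : annulus m x ≤ 1 :=
  mul_le_one₀ (by linarith [cutoff_nonneg (((m : ℝ) + 1) • x)]) (cutoff_nonneg _) (cutoff_le_one _)

theorem annulus_eventuallyEq_zero (m : ℕ) : annulus (n := n) m =ᶠ[𝓝 0] fun _ => 0 := by
  have hm : (0 : ℝ) < (m : ℝ) + 1 := by positivity
  filter_upwards [Metric.ball_mem_nhds (0 : Eu n) (inv_pos.2 hm)] with x hx
  rw [mem_ball_zero_iff] at hx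
  rw [annulus, cutoff_eq_one (x := ((m : ℝ) + 1) • x), sub_self, zero_mul]
  rw [norm_smul, Real.norm_of_nonneg hm.le]
  calc ((m : ℝ) + 1) * ‖x‖ ≤ ((m : ℝ) + 1) * ((m : ℝ) + 1)⁻¹ := by gcongr
    _ = 1 := mul_inv_cancel₀ hm.ne'

theorem annulus_eventually_eq_one {x : Eu n} (hx : x ≠ 0) :
    ∀ᶠ m : ℕ in atTop, annulus m =ᶠ[𝓝 x] fun _ => 1 := by
  have h0 : 0 < ‖x‖ := norm_pos_iff.2 hx
  have h1 : ∀ᶠ m : ℕ in atTop, 4 / ‖x‖ ≤ (m : ℝ) ∧ 2 * ‖x‖ ≤ (m : ℝ) :=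
    (tendsto_natCast_atTop_atTop.eventually_ge_atTop _).and
      (tendsto_natCast_atTop_atTop.eventually_ge_atTop _)
  filter_upwards [h1] with m ⟨hm1, hm2⟩
  have hm : (0 : ℝ) < (m : ℝ) + 1 := by positivity
  rw [div_le_iff₀ h0] at hm1
  filter_upwards [Metric.ball_mem_nhds x (half_pos h0)] with y hy
  rw [mem_ball_iff_norm] at hy
  have y1 : ‖x‖ / 2 ≤ ‖y‖ := by
    have := norm_sub_norm_le x y
    rw [norm_sub_rev] at this
    linarith
  have y2 : ‖y‖ ≤ 2 * ‖x‖ := by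
    have := norm_sub_norm_le y x
    linarith
  rw [annulus, cutoff_eq_zero (x := ((m : ℝ) + 1) • y), cutoff_eq_one, sub_zero, one_mul]
  · rw [norm_smul, norm_inv, Real.norm_of_nonneg hm.le, inv_mul_le_iff₀ hm]
    linarith
  · rw [norm_smul, Real.norm_of_nonneg hm.le]
    nlinarith

theorem exists_norm_mul_pd_cutoff_le :
    ∃ C : ℝ, 0 ≤ C ∧ ∀ (x : Eu n) (j : Fin n), ‖x‖ * |pd j cutoff x| ≤ C := by
  have h : ∀ j : Fin n, ∃ C : ℝ, 0 ≤ C ∧ ∀ x : Eu n, |‖x‖ * pd j cutoff x| ≤ C := fun j =>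
    bounded_of_test (continuous_norm.mul (continuous_pd contDiff_cutoff_one j))
      (HasCompactSupport_pd hasCompactSupport_cutoff j).mul_left
  choose C hC0 hC using h
  refine ⟨∑ j, C j, Finset.sum_nonneg fun j _ => hC0 j, fun x j => ?_⟩
  have := hC j x
  rw [abs_mul, abs_norm] at this
  exact this.trans (Finset.single_le_sum (fun j _ => hC0 j) (Finset.mem_univ j))

/-- The quantity |x||∇χ| is invariant under dilation, so one constant serves both the inner and the
outer scale. This bound compensates the linear growth of ∇φ at infinity and costs only 1/|x| at the
origin. -/
theorem exists_pd_annulus_le :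
    ∃ C : ℝ, 0 ≤ C ∧ ∀ (m : ℕ) (x : Eu n) (j : Fin n), ‖x‖ * |pd j (annulus m) x| ≤ C := by
  obtain ⟨C, hC0, hC⟩ := exists_norm_mul_pd_cutoff_le (n := n)
  refine ⟨2 * C, by positivity, fun m x j => ?_⟩
  have key : ∀ c : ℝ, 0 < c → ‖x‖ * |pd j (fun y => cutoff (c • y)) x| ≤ C := by
    intro c hc
    rw [pd_comp_smul c j (contDiff_cutoff_one.differentiable (by norm_num) _), abs_mul,
      abs_of_pos hc]
    have := hC (c • x) j
    rw [norm_smul, Real.norm_of_nonneg hc.le] at this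
    linarith
  have hm : (0 : ℝ) < (m : ℝ) + 1 := by positivity
  have d1 : DifferentiableAt ℝ (fun y : Eu n => cutoff (((m : ℝ) + 1) • y)) x :=
    (contDiff_cutoff_smul _).differentiable (by simp) x
  have d2 : DifferentiableAt ℝ (fun y : Eu n => cutoff (((m : ℝ) + 1)⁻¹ • y)) x :=
    (contDiff_cutoff_smul _).differentiable (by simp) x
  have d3 : DifferentiableAt ℝ (fun y : Eu n => 1 - cutoff (((m : ℝ) + 1) • y)) x :=
    (differentiableAt_const _).sub d1
  have e : pd j (annulus m) x = (1 - cutoff (((m : ℝ) + 1) • x))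
        * pd j (fun y => cutoff (((m : ℝ) + 1)⁻¹ • y)) x
      - pd j (fun y => cutoff (((m : ℝ) + 1) • y)) x * cutoff (((m : ℝ) + 1)⁻¹ • x) := by
    rw [show annulus (n := n) m = fun y => (1 - cutoff (((m : ℝ) + 1) • y))
      * cutoff (((m : ℝ) + 1)⁻¹ • y) from rfl, pd_mul j d3 d2,
      pd_sub j (differentiableAt_const _) d1, pd_const]
    ring
  have k1 := key _ hm
  have k2 := key _ (inv_pos.2 hm)
  have c1 := cutoff_nonneg (((m : ℝ) + 1) • x)
  have c2 := cutoff_le_one (((m : ℝ) + 1) • x)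
  have c3 := cutoff_nonneg (((m : ℝ) + 1)⁻¹ • x)
  have c4 := cutoff_le_one (((m : ℝ) + 1)⁻¹ • x)
  have a1 := abs_sub ((1 - cutoff (((m : ℝ) + 1) • x))
        * pd j (fun y => cutoff (((m : ℝ) + 1)⁻¹ • y)) x)
      (pd j (fun y => cutoff (((m : ℝ) + 1) • y)) x * cutoff (((m : ℝ) + 1)⁻¹ • x))
  rw [← e, abs_mul, abs_mul, abs_of_nonneg c3, abs_of_nonneg (sub_nonneg.2 c2)] at a1
  have b1 : (1 - cutoff (((m : ℝ) + 1) • x)) * |pd j (fun y => cutoff (((m : ℝ) + 1)⁻¹ • y)) x|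
      ≤ 1 * |pd j (fun y => cutoff (((m : ℝ) + 1)⁻¹ • y)) x| := by gcongr; linarith
  have b2 : |pd j (fun y => cutoff (((m : ℝ) + 1) • y)) x| * cutoff (((m : ℝ) + 1)⁻¹ • x)
      ≤ |pd j (fun y => cutoff (((m : ℝ) + 1) • y)) x| * 1 := by gcongr
  have := mul_le_mul_of_nonneg_left (a1.trans (add_le_add b1 b2)) (norm_nonneg x)
  linarith

theorem tendsto_annulus {x : Eu n} (hx : x ≠ 0) :
    Tendsto (fun m : ℕ => annulus m x) atTop (𝓝 1) :=
  tendsto_const_nhds.congr' ((annulus_eventually_eq_one hx).mono fun _ hm => hm.self_of_nhds.symm)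

theorem tendsto_pd_annulus {x : Eu n} (hx : x ≠ 0) (j : Fin n) :
    Tendsto (fun m : ℕ => pd j (annulus m) x) atTop (𝓝 0) :=
  tendsto_const_nhds.congr' ((annulus_eventually_eq_one hx).mono fun _ hm =>
    ((pd_congr j hm).trans (pd_const j (1 : ℝ) x)).symm)

/-- Multiplication with an annular cutoff removes a singularity at the origin. -/
theorem contDiff_annulus_mul {g : Eu n → ℝ} {k : WithTop ℕ∞} (hk : k ≤ ∞)
    (hg : ∀ x, x ≠ 0 → ContDiffAt ℝ k g x)
    (m : ℕ) : ContDiff ℝ k (fun x => annulus m x * g x) := by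
  refine contDiff_iff_contDiffAt.2 fun x => ?_
  by_cases hx : x = 0
  · subst hx
    refine (contDiffAt_const (c := (0 : ℝ))).congr_of_eventuallyEq ?_
    filter_upwards [annulus_eventuallyEq_zero (n := n) m] with y hy
    rw [hy, zero_mul]
  · exact ((contDiff_annulus m).contDiffAt.of_le hk).mul (hg x hx)

end AnnularCutoff

/-! ### The virial density of a gradient field and its cutoff error -/

section VirialIdentity

variable {A : Eu n → Eu n} {V : Eu n → ℝ} {z : ℂ} {f u : Eu n → ℂ} {G : Fin n → Eu n → ℂ}
  {φ θ : ℝ → ℝ}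

namespace IsSolution

/-- The cutoff error in the virial identity. -/
def cutoffError (A : Eu n → Eu n) (V : Eu n → ℝ) (z : ℂ) (f u : Eu n → ℂ)
    (G : Fin n → Eu n → ℂ) (Φ η : Eu n → ℝ) (x : Eu n) : ℝ :=
  (∑ j, ∑ k, pd j η x * pd k Φ x * (magGrad A u G j x * star (magGrad A u G k x)).re)
    + (∑ k, pd k η x * pd k Φ x) * (1 / 2 * (f x * star (u x)).re - 1 / 4 * lapSq A V z f u G x)

/-- The density is linear in X and its first derivatives. Only the terms containing DX or div X
produce an error, and it is of first order in ∇η. -/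
theorem virialDensity_mul {Φ η : Eu n → ℝ} {x : Eu n} (hη : DifferentiableAt ℝ η x)
    (hΦ : ∀ k, DifferentiableAt ℝ (pd k Φ) x) :
    virialDensity A V z f u G (fun k y => η y * pd k Φ y) x
      = η x * virialDensity A V z f u G (fun k => pd k Φ) x + cutoffError A V z f u G Φ η x := by
  have e : ∀ j k, pd j (fun y => η y * pd k Φ y) x = η x * pd j (pd k Φ) x + pd j η x * pd k Φ x :=
    fun j k => pd_mul j hη (hΦ k)
  simp only [virialDensity, cutoffError, e, add_mul, Finset.sum_add_distrib, mul_assoc,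
    ← Finset.mul_sum]
  ring

theorem virialDensity_radial_eq (hm : AdmissibleMultipliers φ θ) {x : Eu n} (hx : x ≠ 0) :
    virialDensity A V z f u G (fun k => pd k (radial φ)) x
      = hessTerm (radial φ) A u G x
        - 1 / 2 * (deriv φ ‖x‖ * radialDeriv V x * ‖u x‖ ^ 2)
        + (((deriv φ ‖x‖ : ℝ) : ℂ) * u x * tangTerm A u G x).im
        + (f x * (gradTerm (radial φ) A u G x
          + (1 / 2) * ((Laplacian.laplacian (radial φ) x : ℝ) : ℂ) * star (u x))).re
        + z.im * (u x * gradTerm (radial φ) A u G x).im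
        - 1 / 4 * (Laplacian.laplacian (radial φ) x * lapSq A V z f u G x) := by
  have e1 : (((deriv φ ‖x‖ : ℝ) : ℂ) * u x * tangTerm A u G x).im
      = ∑ j, ∑ k, pd k (radial φ) x * ((pd j A x k - pd k A x j)
        * (u x * star (magGrad A u G j x)).im) := by
    rw [tangTerm, Finset.mul_sum, Complex.im_sum]
    refine Finset.sum_congr rfl fun j _ => ?_
    simp_rw [← mul_assoc]
    rw [← Finset.sum_mul, hm.sum_pd_mul_curl_eq hx,
      show ((deriv φ ‖x‖ : ℝ) : ℂ) * u x * ((magTangential A x j : ℝ) : ℂ) * star (magGrad A u G j x)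
        = ((deriv φ ‖x‖ * magTangential A x j : ℝ) : ℂ) * (u x * star (magGrad A u G j x)) by
        push_cast; ring, Complex.im_ofReal_mul]
  have e2 : ∀ g : ℂ, g * gradTerm (radial φ) A u G x
      = ∑ k, ((pd k (radial φ) x : ℝ) : ℂ) * (g * star (magGrad A u G k x)) := by
    intro g
    rw [gradTerm, Finset.mul_sum]
    exact Finset.sum_congr rfl fun k _ => by ring
  have e3 : (f x * ((1 / 2) * ((Laplacian.laplacian (radial φ) x : ℝ) : ℂ) * star (u x))).re
      = 1 / 2 * Laplacian.laplacian (radial φ) x * (f x * star (u x)).re := by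
    rw [← Complex.re_ofReal_mul]
    congr 1
    push_cast
    ring
  rw [e1, mul_add, Complex.add_re, e3, e2, e2, Complex.re_sum, Complex.im_sum, hessTerm_eq,
    virialDensity, hm.sum_pd_mul_pd_eq hx, hm.laplacian_radial_eq hx]
  simp only [Complex.re_ofReal_mul, Complex.im_ofReal_mul]
  ring

end IsSolution

end VirialIdentity

/-! ### Removing the annular cutoff; the identity before moving the Laplacian -/

section VirialIdentity

variable {A : Eu n → Eu n} {V : Eu n → ℝ} {z : ℂ} {f u : Eu n → ℂ} {G : Fin n → Eu n → ℂ}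
  {φ θ : ℝ → ℝ}

namespace IsSolution

theorem integrable_norm_mul_norm (h : IsSolution A V z f u G) :
    Integrable (fun x => ‖f x‖ * ‖u x‖) volume :=
  (memLp_integrable_mul_star h.hf h.hu.memLp).norm.congr (Eventually.of_forall fun x => by simp)

theorem aestronglyMeasurable_cutoffError (h : IsSolution A V z f u G) (Φ η : Eu n → ℝ) :
    AEStronglyMeasurable (cutoffError A V z f u G Φ η) volume := by
  have hp : ∀ j k, AEStronglyMeasurable (fun x => pd j η x * pd k Φ x) volume := fun j k =>
    ((measurable_pd j η).mul (measurable_pd k Φ)).aestronglyMeasurable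
  refine AEStronglyMeasurable.add ?_ ?_
  · refine Finset.aestronglyMeasurable_fun_sum _ fun j _ =>
      Finset.aestronglyMeasurable_fun_sum _ fun k _ => (hp j k).mul ?_
    exact aestronglyMeasurable_re_mul_star (h.aestronglyMeasurable_magGrad j)
      (h.aestronglyMeasurable_magGrad k)
  · refine (Finset.aestronglyMeasurable_fun_sum _ fun k _ => hp k k).mul ?_
    exact ((aestronglyMeasurable_re_mul_star h.hf.1 h.hu.memLp.1).const_mul _).sub
      (h.integrable_lapSq.1.const_mul _)

theorem abs_cutoffError_le {Φ η : Eu n → ℝ} {x : Eu n} {K : ℝ}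
    (hK : ∀ j k, |pd j η x * pd k Φ x| ≤ K) :
    |cutoffError A V z f u G Φ η x| ≤ K * (n * n * magGradSq A u G x
      + n * (‖f x‖ * ‖u x‖ + |lapSq A V z f u G x|)) := by
  rcases Nat.eq_zero_or_pos n with rfl | hn
  · simp [cutoffError]
  have hK0 : 0 ≤ K := (abs_nonneg _).trans (hK ⟨0, hn⟩ ⟨0, hn⟩)
  have h1 : |∑ j, ∑ k, pd j η x * pd k Φ x * (magGrad A u G j x * star (magGrad A u G k x)).re|
      ≤ ∑ _j : Fin n, ∑ _k : Fin n, K * magGradSq A u G x := by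
    refine (Finset.abs_sum_le_sum_abs _ _).trans (Finset.sum_le_sum fun j _ =>
      (Finset.abs_sum_le_sum_abs _ _).trans (Finset.sum_le_sum fun k _ => ?_))
    rw [abs_mul]
    exact mul_le_mul (hK j k) ((abs_re_mul_star_le _ _).trans (norm_magGrad_mul_le A u G j k x))
      (abs_nonneg _) hK0
  have h2 : |∑ k, pd k η x * pd k Φ x| ≤ n * K := by
    refine (Finset.abs_sum_le_sum_abs _ _).trans ((Finset.sum_le_sum fun k _ => hK k k).trans ?_)
    simp
  have h3 : |1 / 2 * (f x * star (u x)).re - 1 / 4 * lapSq A V z f u G x|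
      ≤ ‖f x‖ * ‖u x‖ + |lapSq A V z f u G x| := by
    have a1 := abs_sub (1 / 2 * (f x * star (u x)).re) (1 / 4 * lapSq A V z f u G x)
    have a2 := abs_re_mul_star_le (f x) (u x)
    rw [abs_mul, abs_mul, abs_of_pos (by norm_num : (0 : ℝ) < 1 / 2),
      abs_of_pos (by norm_num : (0 : ℝ) < 1 / 4)] at a1
    nlinarith [abs_nonneg (f x * star (u x)).re, abs_nonneg (lapSq A V z f u G x)]
  have h4 := abs_add_le
    (∑ j, ∑ k, pd j η x * pd k Φ x * (magGrad A u G j x * star (magGrad A u G k x)).re)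
    ((∑ k, pd k η x * pd k Φ x) * (1 / 2 * (f x * star (u x)).re - 1 / 4 * lapSq A V z f u G x))
  rw [abs_mul] at h4
  have h5 := mul_le_mul h2 h3 (abs_nonneg _) (by positivity)
  simp only [Finset.sum_const, Finset.card_univ, Fintype.card_fin, nsmul_eq_mul] at h1
  rw [cutoffError]
  linarith

theorem tendsto_cutoffError {Φ : Eu n → ℝ} {x : Eu n} (hx : x ≠ 0) :
    Tendsto (fun m : ℕ => cutoffError A V z f u G Φ (annulus m) x) atTop (𝓝 0) := by
  have h1 : ∀ j k, Tendsto (fun m : ℕ => pd j (annulus m) x * pd k Φ x) atTop (𝓝 0) := fun j k => by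
    simpa using (tendsto_pd_annulus hx j).mul_const (pd k Φ x)
  have h2 := (tendsto_finsetSum Finset.univ fun j _ => tendsto_finsetSum Finset.univ fun k _ =>
    (h1 j k).mul_const (magGrad A u G j x * star (magGrad A u G k x)).re).add
    ((tendsto_finsetSum Finset.univ fun k _ => h1 k k).mul_const
      (1 / 2 * (f x * star (u x)).re - 1 / 4 * lapSq A V z f u G x))
  simp only [zero_mul, Finset.sum_const_zero, add_zero] at h2
  exact h2

/-- The field η_m∇φ is C¹ with compact support because η_m vanishes near the origin. From |x||∇η_m|
≤ K and |∇φ| ≤ C(1 + |x|), the products of their components are bounded by KC(1 + 1/|x|), so the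
cutoff error is dominated by an integrable function. It tends to zero pointwise since η_m is
eventually 1 near every x ≠ 0. -/
theorem integral_virialDensity_radial (hn : 3 ≤ n) (h : IsSolution A V z f u G)
    (hm : AdmissibleMultipliers φ θ)
    (hint : Integrable (virialDensity A V z f u G (fun k => pd k (radial φ))) volume) :
    ∫ x, virialDensity A V z f u G (fun k => pd k (radial φ)) x = 0 := by
  obtain ⟨C, hC0, hC⟩ := hm.exists_bounds (n := n)
  obtain ⟨K, hK0, hK⟩ := exists_pd_annulus_le (n := n)
  have hbound : ∀ (m : ℕ) (x : Eu n), x ≠ 0 → ∀ j k,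
      |pd j (annulus m) x * pd k (radial φ) x| ≤ K * C * (1 + ‖x‖⁻¹) := by
    intro m x hx j k
    have h0 : 0 < ‖x‖ := norm_pos_iff.2 hx
    have h1 := mul_le_mul (hK m x j) (mul_le_mul_of_nonneg_left ((hC x hx).2.1 k)
      (by positivity : 0 ≤ ‖x‖⁻¹)) (by positivity) hK0
    rw [abs_mul]
    calc |pd j (annulus m) x| * |pd k (radial φ) x|
        = ‖x‖ * |pd j (annulus m) x| * (‖x‖⁻¹ * |pd k (radial φ) x|) := by field_simp
      _ ≤ K * (‖x‖⁻¹ * (C * (1 + ‖x‖))) := h1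
      _ = K * C * (1 + ‖x‖⁻¹) := by field_simp; ring
  set g : Eu n → ℝ := fun x => n * n * magGradSq A u G x
      + n * (‖f x‖ * ‖u x‖ + |lapSq A V z f u G x|) with hg
  have hgi : Integrable g volume := (h.integrable_magGradSq.const_mul _).add
    ((h.integrable_norm_mul_norm.add h.integrable_lapSq.abs).const_mul _)
  have hgi' : Integrable (fun x => g x * ‖x‖⁻¹) volume := by
    refine (((h.integrable_magGradSq_mul_inv hn).const_mul (n * n : ℝ)).add
      (((h.integrable_norm_mul_norm_mul_inv hn).add
        (h.integrable_lapSq_mul_inv hn).abs).const_mul (n : ℝ))).congr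
        (Eventually.of_forall fun x => ?_)
    simp only [hg, Pi.add_apply, abs_mul, abs_inv, abs_norm]
    ring
  have hX1 : ∀ (m : ℕ) k, ContDiff ℝ 1 (fun x : Eu n => annulus m x * pd k (radial φ) x) := fun m k =>
    contDiff_annulus_mul (one_le_two.trans two_le_infty) (fun x hx => hm.contDiffAt_pd_radial hx k) m
  have hvir := fun m => integral_virialDensity h (hX1 m) fun k => (hasCompactSupport_annulus m).mul_right
  have heq : ∀ m, ∀ᵐ x : Eu n, virialDensity A V z f u G
        (fun k y => annulus m y * pd k (radial φ) y) x
      = annulus m x * virialDensity A V z f u G (fun k => pd k (radial φ)) x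
        + cutoffError A V z f u G (radial φ) (annulus m) x := by
    intro m
    filter_upwards [ae_ne_zero hn] with x hx
    exact virialDensity_mul ((contDiff_annulus m).differentiable (by simp) x)
      fun k => (hm.contDiffAt_pd_radial hx k).differentiableAt (by norm_num)
  have hlim : Tendsto (fun m : ℕ => ∫ x, (annulus m x *
        virialDensity A V z f u G (fun k => pd k (radial φ)) x
        + cutoffError A V z f u G (radial φ) (annulus m) x)) atTop
      (𝓝 (∫ x, virialDensity A V z f u G (fun k => pd k (radial φ)) x)) := by
    refine tendsto_integral_of_dominated_convergence
      (fun x => |virialDensity A V z f u G (fun k => pd k (radial φ)) x|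
        + K * C * (g x + g x * ‖x‖⁻¹)) (fun m => ?_)
      (hint.abs.add ((hgi.add hgi').const_mul _)) (fun m => ?_) ?_
    · exact ((contDiff_annulus m).continuous.aestronglyMeasurable.mul hint.1).add
        (h.aestronglyMeasurable_cutoffError _ _)
    · filter_upwards [ae_ne_zero hn] with x hx
      refine (norm_add_le _ _).trans (add_le_add ?_ ?_)
      · rw [norm_mul, Real.norm_of_nonneg (annulus_nonneg m x)]
        exact mul_le_of_le_one_left (abs_nonneg _) (annulus_le_one m x)
      · refine (abs_cutoffError_le (hbound m x hx)).trans (le_of_eq ?_)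
        simp only [hg]
        ring
    · filter_upwards [ae_ne_zero hn] with x hx
      simpa using ((tendsto_annulus hx).mul_const _).add (tendsto_cutoffError hx)
  have hzero : ∀ m : ℕ, ∫ x, (annulus m x *
        virialDensity A V z f u G (fun k => pd k (radial φ)) x
        + cutoffError A V z f u G (radial φ) (annulus m) x) = 0 := fun m => by
    rw [← hvir m]
    exact integral_congr_ae ((heq m).mono fun x hx => hx.symm)
  simp only [hzero] at hlim
  exact tendsto_nhds_unique hlim tendsto_const_nhds |>.trans rfl

theorem integrable_laplacian_mul_lapSq (hn : 3 ≤ n) (h : IsSolution A V z f u G)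
    (hm : AdmissibleMultipliers φ θ) : Integrable (fun x =>
      Laplacian.laplacian (radial φ) x * lapSq A V z f u G x) volume := by
  obtain ⟨C, -, hC⟩ := hm.exists_bounds (n := n)
  have h1 : Integrable (fun x => (∑ j, pd j (pd j (radial φ)) x) * lapSq A V z f u G x) volume := by
    refine Integrable.mul_of_abs_le_inv_norm hn h.integrable_lapSq
      (h.integrable_lapSq_mul_inv hn) ?_ (C := n * C) fun x hx => ?_
    · exact (Finset.measurable_fun_sum _ fun j _ => measurable_pd j _).aestronglyMeasurable.mul
        h.integrable_lapSq.1
    · rw [norm_mul, Real.norm_eq_abs, Real.norm_eq_abs]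
      gcongr
      exact norm_sum_pd_pd_radial_le (hC x hx).2.2
  refine h1.congr ?_
  filter_upwards [ae_ne_zero hn] with x hx
  rw [hm.laplacian_radial_eq hx]

/-- The identity of the lemma, with the bilaplacian term in the form obtained before
integrating by parts. -/
theorem integral_identity (hn : 3 ≤ n) (h : IsSolution A V z f u G)
    (hm : AdmissibleMultipliers φ θ)
    (hV : Integrable (fun x => deriv φ ‖x‖ * radialDeriv V x * ‖u x‖ ^ 2) volume)
    (hB : Integrable (fun x => ((deriv φ ‖x‖ : ℝ) : ℂ) * u x * tangTerm A u G x) volume)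
    (hf : Integrable (fun x => f x * gradTerm (radial φ) A u G x) volume)
    (hu : Integrable (fun x => u x * gradTerm (radial φ) A u G x) volume) :
    Integrable (hessTerm (radial φ) A u G) volume ∧
    Integrable (fun x => θ ‖x‖ * magGradSq A u G x) volume ∧
    Integrable (fun x => ((1 / 2) * deriv φ ‖x‖ * radialDeriv V x + θ ‖x‖ * V x) * ‖u x‖ ^ 2)
      volume ∧
    Integrable (fun x => θ ‖x‖ * ‖u x‖ ^ 2) volume ∧
    Integrable (fun x => f x * (gradTerm (radial φ) A u G x
      + (1 / 2) * ((Laplacian.laplacian (radial φ) x : ℝ) : ℂ) * star (u x))) volume ∧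
    Integrable (fun x => f x * ((θ ‖x‖ : ℝ) : ℂ) * star (u x)) volume ∧
    Integrable (fun x => (1 / 2 * Laplacian.laplacian (radial φ) x - θ ‖x‖) * lapSq A V z f u G x)
      volume ∧
    (∫ x, hessTerm (radial φ) A u G x) - (∫ x, θ ‖x‖ * magGradSq A u G x)
        - (1 / 2 * ∫ x, (1 / 2 * Laplacian.laplacian (radial φ) x - θ ‖x‖) * lapSq A V z f u G x)
        - (∫ x, ((1 / 2) * deriv φ ‖x‖ * radialDeriv V x + θ ‖x‖ * V x) * ‖u x‖ ^ 2)
        + (∫ x, ((deriv φ ‖x‖ : ℝ) : ℂ) * u x * tangTerm A u G x).im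
        + z.re * (∫ x, θ ‖x‖ * ‖u x‖ ^ 2)
      = - (∫ x, f x * (gradTerm (radial φ) A u G x
            + (1 / 2) * ((Laplacian.laplacian (radial φ) x : ℝ) : ℂ) * star (u x))).re
        + (∫ x, f x * ((θ ‖x‖ : ℝ) : ℂ) * star (u x)).re
        - z.im * (∫ x, u x * gradTerm (radial φ) A u G x).im := by
  have i1 := h.integrable_hessTerm hn hm
  have i2 : Integrable (fun x => θ ‖x‖ * magGradSq A u G x) volume :=
    integrable_snd_mul hn hm h.integrable_magGradSq
  have i3 : Integrable (fun x => θ ‖x‖ * (V x * ‖u x‖ ^ 2)) volume :=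
    integrable_snd_mul hn hm h.integrable_potential
  have i4 : Integrable (fun x => θ ‖x‖ * ‖u x‖ ^ 2) volume :=
    integrable_snd_mul hn hm h.integrable_sq
  have i5 : Integrable (fun x => f x * (gradTerm (radial φ) A u G x
      + (1 / 2) * ((Laplacian.laplacian (radial φ) x : ℝ) : ℂ) * star (u x))) volume := by
    refine (hf.add (h.integrable_laplacian_mul hn hm)).congr (Eventually.of_forall fun x => ?_)
    simp only [Pi.add_apply]
    ring
  have i6 : Integrable (fun x => f x * ((θ ‖x‖ : ℝ) : ℂ) * star (u x)) volume := by
    refine (integrable_snd_mul hn hm (memLp_integrable_mul_star h.hf h.hu.memLp)).congr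
      (Eventually.of_forall fun x => ?_)
    simp only [Complex.real_smul]
    ring
  have i7 := h.integrable_laplacian_mul_lapSq hn hm
  have i8 : Integrable (fun x => θ ‖x‖ * lapSq A V z f u G x) volume :=
    integrable_snd_mul hn hm h.integrable_lapSq
  have i9 : Integrable (fun x => ((1 / 2) * deriv φ ‖x‖ * radialDeriv V x + θ ‖x‖ * V x)
      * ‖u x‖ ^ 2) volume := by
    refine ((hV.const_mul (1 / 2)).add i3).congr (Eventually.of_forall fun x => ?_)
    simp only [Pi.add_apply]
    ring
  have i10 : Integrable (fun x => (1 / 2 * Laplacian.laplacian (radial φ) x - θ ‖x‖)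
      * lapSq A V z f u G x) volume := by
    refine ((i7.const_mul (1 / 2)).sub i8).congr (Eventually.of_forall fun x => ?_)
    simp only [Pi.sub_apply]
    ring
  refine ⟨i1, i2, i9, i4, i5, i6, i10, ?_⟩
  have eV : ∫ x, ((1 / 2) * deriv φ ‖x‖ * radialDeriv V x + θ ‖x‖ * V x) * ‖u x‖ ^ 2
      = 1 / 2 * (∫ x, deriv φ ‖x‖ * radialDeriv V x * ‖u x‖ ^ 2)
        + ∫ x, θ ‖x‖ * (V x * ‖u x‖ ^ 2) := by
    rw [← integral_const_mul, ← integral_add (hV.const_mul (1 / 2)) i3]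
    exact integral_congr_ae (Eventually.of_forall fun x => by ring)
  have eL : ∫ x, (1 / 2 * Laplacian.laplacian (radial φ) x - θ ‖x‖) * lapSq A V z f u G x
      = 1 / 2 * (∫ x, Laplacian.laplacian (radial φ) x * lapSq A V z f u G x)
        - ∫ x, θ ‖x‖ * lapSq A V z f u G x := by
    rw [← integral_const_mul, ← integral_sub (i7.const_mul (1 / 2)) i8]
    exact integral_congr_ae (Eventually.of_forall fun x => by ring)
  have j6 : Integrable (fun x => (f x * ((θ ‖x‖ : ℝ) : ℂ) * star (u x)).re) volume := i6.re
  -- The second multiplier identity is the defining formula of `lapSq` times θ. It converts ½∫ θ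
  -- `lapSq` into exactly the θ-terms of the claim.
  have eT : ∫ x, θ ‖x‖ * lapSq A V z f u G x
      = 2 * (∫ x, θ ‖x‖ * magGradSq A u G x) + 2 * (∫ x, θ ‖x‖ * (V x * ‖u x‖ ^ 2))
        - 2 * z.re * (∫ x, θ ‖x‖ * ‖u x‖ ^ 2)
        + 2 * (∫ x, f x * ((θ ‖x‖ : ℝ) : ℂ) * star (u x)).re := by
    have er : (∫ x, f x * ((θ ‖x‖ : ℝ) : ℂ) * star (u x)).re
        = ∫ x, (f x * ((θ ‖x‖ : ℝ) : ℂ) * star (u x)).re := (integral_re i6).symm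
    have k1 : Integrable (fun x => 2 * (θ ‖x‖ * magGradSq A u G x)
        + 2 * (θ ‖x‖ * (V x * ‖u x‖ ^ 2))) volume := (i2.const_mul 2).add (i3.const_mul 2)
    have k2 : Integrable (fun x => 2 * (θ ‖x‖ * magGradSq A u G x)
        + 2 * (θ ‖x‖ * (V x * ‖u x‖ ^ 2)) - 2 * z.re * (θ ‖x‖ * ‖u x‖ ^ 2)) volume :=
      k1.sub (i4.const_mul _)
    rw [er, ← integral_const_mul, ← integral_const_mul, ← integral_const_mul, ← integral_const_mul,
      ← integral_add (i2.const_mul 2) (i3.const_mul 2), ← integral_sub k1 (i4.const_mul _),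
      ← integral_add k2 (j6.const_mul 2)]
    refine integral_congr_ae (Eventually.of_forall fun x => ?_)
    have : (f x * ((θ ‖x‖ : ℝ) : ℂ) * star (u x)).re = θ ‖x‖ * (f x * star (u x)).re := by
      rw [← Complex.re_ofReal_mul]
      congr 1
      ring
    simp only [this, lapSq]
    ring
  have jB : Integrable (fun x => (((deriv φ ‖x‖ : ℝ) : ℂ) * u x * tangTerm A u G x).im) volume := hB.im
  have j5 : Integrable (fun x => (f x * (gradTerm (radial φ) A u G x
      + (1 / 2) * ((Laplacian.laplacian (radial φ) x : ℝ) : ℂ) * star (u x))).re) volume := i5.re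
  have ju : Integrable (fun x => (u x * gradTerm (radial φ) A u G x).im) volume := hu.im
  have eB : (∫ x, ((deriv φ ‖x‖ : ℝ) : ℂ) * u x * tangTerm A u G x).im
      = ∫ x, (((deriv φ ‖x‖ : ℝ) : ℂ) * u x * tangTerm A u G x).im := (integral_im hB).symm
  have e5 : (∫ x, f x * (gradTerm (radial φ) A u G x
      + (1 / 2) * ((Laplacian.laplacian (radial φ) x : ℝ) : ℂ) * star (u x))).re
      = ∫ x, (f x * (gradTerm (radial φ) A u G x
      + (1 / 2) * ((Laplacian.laplacian (radial φ) x : ℝ) : ℂ) * star (u x))).re :=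
    (integral_re i5).symm
  have eu : (∫ x, u x * gradTerm (radial φ) A u G x).im
      = ∫ x, (u x * gradTerm (radial φ) A u G x).im := (integral_im hu).symm
  have l1 : Integrable (fun x => hessTerm (radial φ) A u G x
        - 1 / 2 * (deriv φ ‖x‖ * radialDeriv V x * ‖u x‖ ^ 2)) volume := i1.sub (hV.const_mul _)
  have l2 : Integrable (fun x => hessTerm (radial φ) A u G x
        - 1 / 2 * (deriv φ ‖x‖ * radialDeriv V x * ‖u x‖ ^ 2)
        + (((deriv φ ‖x‖ : ℝ) : ℂ) * u x * tangTerm A u G x).im) volume := l1.add jB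
  have l3 : Integrable (fun x => hessTerm (radial φ) A u G x
        - 1 / 2 * (deriv φ ‖x‖ * radialDeriv V x * ‖u x‖ ^ 2)
        + (((deriv φ ‖x‖ : ℝ) : ℂ) * u x * tangTerm A u G x).im
        + (f x * (gradTerm (radial φ) A u G x
          + (1 / 2) * ((Laplacian.laplacian (radial φ) x : ℝ) : ℂ) * star (u x))).re) volume :=
    l2.add j5
  have l4 : Integrable (fun x => hessTerm (radial φ) A u G x
        - 1 / 2 * (deriv φ ‖x‖ * radialDeriv V x * ‖u x‖ ^ 2)
        + (((deriv φ ‖x‖ : ℝ) : ℂ) * u x * tangTerm A u G x).im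
        + (f x * (gradTerm (radial φ) A u G x
          + (1 / 2) * ((Laplacian.laplacian (radial φ) x : ℝ) : ℂ) * star (u x))).re
        + z.im * (u x * gradTerm (radial φ) A u G x).im) volume := l3.add (ju.const_mul _)
  have hvae : ∀ᵐ x : Eu n, _ := (ae_ne_zero hn).mono fun x hx =>
    virialDensity_radial_eq (A := A) (V := V) (z := z) (f := f) (u := u) (G := G) hm hx
  have hmain := h.integral_virialDensity_radial hn hm
    ((l4.sub (i7.const_mul (1 / 4))).congr (hvae.mono fun x hx => hx.symm))
  rw [integral_congr_ae hvae, integral_sub l4 (i7.const_mul _), integral_add l3 (ju.const_mul _),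
    integral_add l2 j5, integral_add l1 jB, integral_sub i1 (hV.const_mul _), integral_const_mul,
    integral_const_mul, integral_const_mul, ← eB, ← e5, ← eu] at hmain
  rw [eL, eV, eT]
  linarith

end IsSolution

end VirialIdentity

/-! ### Green's identity for the radial multiplier across the origin -/

section Green

theorem pd_pd_mul {g h : Eu n → ℝ} {x : Eu n} (hg : ContDiffAt ℝ 2 g x) (hh : ContDiffAt ℝ 2 h x)
    (j : Fin n) : pd j (pd j (fun y => g y * h y)) x
      = g x * pd j (pd j h) x + 2 * (pd j g x * pd j h x) + pd j (pd j g) x * h x := by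
  have a1 : DifferentiableAt ℝ g x := hg.differentiableAt (by norm_num)
  have a2 : DifferentiableAt ℝ h x := hh.differentiableAt (by norm_num)
  have a3 : DifferentiableAt ℝ (pd j g) x :=
    (ContDiffAt_pd (k := 1) hg (by norm_num) j).differentiableAt (by norm_num)
  have a4 : DifferentiableAt ℝ (pd j h) x :=
    (ContDiffAt_pd (k := 1) hh (by norm_num) j).differentiableAt (by norm_num)
  have a5 : DifferentiableAt ℝ (fun y => g y * pd j h y) x := a1.mul a4
  have a6 : DifferentiableAt ℝ (fun y => pd j g y * h y) x := a3.mul a2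
  rw [pd_congr (g := fun y => g y * pd j h y + pd j g y * h y) j (by
    filter_upwards [hg.eventually (by simp), hh.eventually (by simp)] with y h1 h2
    exact pd_mul j (h1.differentiableAt (by norm_num)) (h2.differentiableAt (by norm_num))),
    pd_add j a5 a6, pd_mul j a1 a4, pd_mul j a3 a2]
  ring

theorem pd_eq_zero_of_notMem_tsupport {g : Eu n → ℝ} {x : Eu n} (hx : x ∉ tsupport g) (j : Fin n) :
    pd j g x = 0 := by
  rw [pd_congr j (notMem_tsupport_iff_eventuallyEq.1 hx)]
  exact pd_const j (0 : ℝ) x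

theorem pd_pd_eq_zero_of_notMem_tsupport {g : Eu n → ℝ} {x : Eu n} (hx : x ∉ tsupport g)
    (i j : Fin n) : pd i (pd j g) x = 0 := by
  rw [pd_congr i (pd_eventuallyEq (g := fun _ => (0 : ℝ)) (notMem_tsupport_iff_eventuallyEq.1 hx) j),
    pd_congr i (Eventually.of_forall fun y => pd_const j (0 : ℝ) y), pd_const]

/-- A polynomially weighted bound for the second order jet of a test function. -/
theorem exists_jet_le_indicator {g : Eu n → ℝ} (hg : ContDiff ℝ 2 g) (hc : HasCompactSupport g) :
    ∃ B R : ℝ, 0 ≤ B ∧ ∀ x, (1 + ‖x‖) ^ 2 * (|g x| + ∑ j, |pd j g x| + |∑ j, pd j (pd j g) x|)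
      ≤ B * (Metric.closedBall (0 : Eu n) R).indicator (fun _ => (1 : ℝ)) x := by
  set q : Eu n → ℝ := fun x => (1 + ‖x‖) ^ 2 * (|g x| + ∑ j, |pd j g x| + |∑ j, pd j (pd j g) x|)
    with hq
  have hqc : Continuous q := by
    have h1 : ∀ j, Continuous (pd j g) := continuous_pd (hg.of_le one_le_two)
    have h2 : ∀ j, Continuous (pd j (pd j g)) := fun j =>
      continuous_pd (ContDiff_pd hg (by norm_num) j) j
    have h3 := hg.continuous
    fun_prop
  have hqz : ∀ x, x ∉ tsupport g → q x = 0 := by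
    intro x hx
    simp [hq, image_eq_zero_of_notMem_tsupport hx, pd_eq_zero_of_notMem_tsupport hx,
      pd_pd_eq_zero_of_notMem_tsupport hx]
  obtain ⟨B, hB0, hB⟩ := bounded_of_test hqc (HasCompactSupport.intro hc hqz)
  obtain ⟨R, hR⟩ := hc.isCompact.isBounded.subset_closedBall (0 : Eu n)
  refine ⟨B, R, hB0, fun x => ?_⟩
  by_cases hx : x ∈ Metric.closedBall (0 : Eu n) R
  · rw [indicator_of_mem hx, mul_one]
    exact (le_abs_self _).trans (hB x)
  · rw [indicator_of_notMem hx, mul_zero]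
    exact (hqz x fun h => hx (hR h)).le

theorem integrable_indicator_one (R : ℝ) : Integrable
    ((Metric.closedBall (0 : Eu n) R).indicator (fun _ => (1 : ℝ))) volume :=
  (integrable_indicator_iff Metric.isClosed_closedBall.measurableSet).2
    ((locallyIntegrable_const 1).integrableOn_isCompact (isCompact_closedBall _ _))

theorem integrable_inv_norm_mul_indicator (hn : 3 ≤ n) (R : ℝ) : Integrable
    (fun x => ‖x‖⁻¹ * (Metric.closedBall (0 : Eu n) R).indicator (fun _ => (1 : ℝ)) x) volume := by
  have := (integrable_indicator_iff (Metric.isClosed_closedBall (x := (0 : Eu n)) (ε := R)).measurableSet).2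
    ((locallyIntegrable_inv_norm (n := n) (by omega)).integrableOn_isCompact
      (isCompact_closedBall 0 R))
  refine this.congr (Eventually.of_forall fun x => ?_)
  by_cases hx : x ∈ Metric.closedBall (0 : Eu n) R <;> simp [hx]

namespace AdmissibleMultipliers

variable {φ θ : ℝ → ℝ}

/-- The mean value inequality from radius 1, with |φ'| ≤ C(2 + |x|) on (0, 1 + |x|]. In particular φ
is bounded near the origin. -/
theorem exists_abs_radial_le (h : AdmissibleMultipliers φ θ) :
    ∃ C : ℝ, 0 ≤ C ∧ ∀ x : Eu n, x ≠ 0 → |radial φ x| ≤ C * (1 + ‖x‖) ^ 2 := by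
  obtain ⟨C, hC⟩ := h.bounds
  have hC0 : 0 ≤ C := (abs_nonneg _).trans (hC 1 one_pos).2.2.1
  refine ⟨|φ 1| + 2 * C, by positivity, fun x hx => ?_⟩
  have h0 : 0 < ‖x‖ := norm_pos_iff.2 hx
  have h1 := (convex_Ioc (0 : ℝ) (1 + ‖x‖)).norm_image_sub_le_of_norm_deriv_le (f := φ)
    (C := C * (2 + ‖x‖)) (x := 1) (y := ‖x‖)
    (fun r hr => (h.contDiffOn.contDiffAt (Ioi_mem_nhds hr.1)).differentiableAt (by norm_num))
    (fun r hr => (hC r hr.1).1.trans (mul_le_mul_of_nonneg_left (by linarith [hr.2]) hC0))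
    ⟨one_pos, by linarith⟩ ⟨h0, by linarith⟩
  rw [Real.norm_eq_abs, Real.norm_eq_abs] at h1
  have h2 : |‖x‖ - 1| ≤ 1 + ‖x‖ := abs_le.2 ⟨by linarith, by linarith⟩
  have h3 : |φ ‖x‖| ≤ |φ 1| + |φ ‖x‖ - φ 1| := by
    have := abs_add_le (φ 1) (φ ‖x‖ - φ 1)
    rwa [add_sub_cancel] at this
  have h4 : C * (2 + ‖x‖) * |‖x‖ - 1| ≤ C * (2 + ‖x‖) * (1 + ‖x‖) := by gcongr
  have h5 : |φ 1| ≤ |φ 1| * (1 + ‖x‖) ^ 2 :=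
    le_mul_of_one_le_right (abs_nonneg _) (one_le_pow₀ (by linarith))
  have h6 : C * (2 + ‖x‖) * (1 + ‖x‖) ≤ 2 * C * (1 + ‖x‖) ^ 2 := by
    have : 0 ≤ C * (‖x‖ * (1 + ‖x‖)) := by positivity
    nlinarith
  rw [radial]
  linarith

/-- Green's identity for the radial multiplier, across its singularity at the origin. -/
theorem integral_radial_mul_laplacian (hn : 3 ≤ n) (h : AdmissibleMultipliers φ θ) {g : Eu n → ℝ}
    (hg : ContDiff ℝ 2 g) (hc : HasCompactSupport g) :
    Integrable (fun x => radial φ x * ∑ j, pd j (pd j g) x) volume ∧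
    Integrable (fun x => (∑ j, pd j (pd j (radial φ)) x) * g x) volume ∧
    ∫ x, radial φ x * ∑ j, pd j (pd j g) x = ∫ x, (∑ j, pd j (pd j (radial φ)) x) * g x := by
  obtain ⟨B, R, hB0, hB⟩ := exists_jet_le_indicator hg hc
  obtain ⟨C, hC0, hC⟩ := h.exists_abs_radial_le (n := n)
  obtain ⟨D, hD0, hD⟩ := h.exists_bounds (n := n)
  obtain ⟨K, hK0, hK⟩ := exists_pd_annulus_le (n := n)
  set b : Eu n → ℝ := (Metric.closedBall (0 : Eu n) R).indicator (fun _ => (1 : ℝ)) with hb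
  have hb0 : ∀ x, 0 ≤ b x := fun x => indicator_nonneg (fun _ _ => zero_le_one) x
  have hone : ∀ x : Eu n, 1 ≤ (1 + ‖x‖) ^ 2 := fun x => one_le_pow₀ (by linarith [norm_nonneg x])
  have hsum0 : ∀ x, 0 ≤ ∑ j, |pd j g x| := fun x => Finset.sum_nonneg fun _ _ => abs_nonneg _
  have hg1 : ∀ x, (1 + ‖x‖) ^ 2 * |g x| ≤ B * b x := fun x =>
    (mul_le_mul_of_nonneg_left (by linarith [hsum0 x, abs_nonneg (∑ j, pd j (pd j g) x)])
      (by positivity)).trans (hB x)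
  have hg2 : ∀ x j, (1 + ‖x‖) ^ 2 * |pd j g x| ≤ B * b x := fun x j => by
    have := Finset.single_le_sum (f := fun j => |pd j g x|) (fun _ _ => abs_nonneg _)
      (Finset.mem_univ j)
    exact (mul_le_mul_of_nonneg_left (by
      linarith [abs_nonneg (g x), abs_nonneg (∑ j, pd j (pd j g) x)]) (by positivity)).trans (hB x)
  have hg3 : ∀ x, (1 + ‖x‖) ^ 2 * |∑ j, pd j (pd j g) x| ≤ B * b x := fun x =>
    (mul_le_mul_of_nonneg_left (by linarith [hsum0 x, abs_nonneg (g x)])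
      (by positivity)).trans (hB x)
  have hgd : ∀ j, ContDiff ℝ 1 (pd j g) := ContDiff_pd hg (by norm_num)
  have hlapc : Continuous fun x => ∑ j, pd j (pd j g) x :=
    continuous_finsetSum _ fun j _ => continuous_pd (hgd j) j
  have hΦm : AEStronglyMeasurable (radial φ : Eu n → ℝ) volume :=
    aestronglyMeasurable_comp_norm hn h.contDiffOn.continuousOn
  have hbi : Integrable b volume := integrable_indicator_one R
  have hbi' : Integrable (fun x => ‖x‖⁻¹ * b x) volume := integrable_inv_norm_mul_indicator hn R
  have i1 : Integrable (fun x => radial φ x * ∑ j, pd j (pd j g) x) volume := by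
    refine (hbi.const_mul (C * B)).mono' (hΦm.mul hlapc.aestronglyMeasurable) ?_
    filter_upwards [ae_ne_zero hn] with x hx
    rw [norm_mul, Real.norm_eq_abs, Real.norm_eq_abs]
    calc |radial φ x| * |∑ j, pd j (pd j g) x|
        ≤ C * (1 + ‖x‖) ^ 2 * |∑ j, pd j (pd j g) x| := by gcongr; exact hC x hx
      _ = C * ((1 + ‖x‖) ^ 2 * |∑ j, pd j (pd j g) x|) := by ring
      _ ≤ C * (B * b x) := mul_le_mul_of_nonneg_left (hg3 x) hC0
      _ = C * B * b x := by ring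
  have i2 : Integrable (fun x => (∑ j, pd j (pd j (radial φ)) x) * g x) volume := by
    refine ((hbi.add hbi').const_mul (n * D * B)).mono'
      ((Finset.measurable_fun_sum _ fun j _ => measurable_pd j _).aestronglyMeasurable.mul
        hg.continuous.aestronglyMeasurable) ?_
    filter_upwards [ae_ne_zero hn] with x hx
    rw [norm_mul, Real.norm_eq_abs, Real.norm_eq_abs, Pi.add_apply]
    have e1 := IsSolution.norm_sum_pd_pd_radial_le (hD x hx).2.2
    have e2 : |g x| ≤ B * b x := (le_mul_of_one_le_left (abs_nonneg _) (hone x)).trans (hg1 x)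
    have := mul_le_mul e1 e2 (abs_nonneg _) (by positivity)
    linarith
  refine ⟨i1, i2, ?_⟩
  -- Green's vector field φ∇g − g∇φ. It is bounded up to the origin because φ and φ' are, so
  -- multiplying by ∇η_m costs only 1/|x|, which is locally integrable; hence no point mass appears
  -- at 0.
  set Z : Fin n → Eu n → ℝ := fun k x => radial φ x * pd k g x - pd k (radial φ) x * g x with hZ
  have hZd : ∀ k x, x ≠ 0 → ContDiffAt ℝ 1 (Z k) x := fun k x hx =>
    (((h.contDiffAt_radial hx).of_le one_le_two).mul (hgd k).contDiffAt).sub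
      ((h.contDiffAt_pd_radial hx k).mul (hg.of_le one_le_two).contDiffAt)
  have hZb : ∀ k x, x ≠ 0 → |Z k x| ≤ (C + D) * B * b x := by
    intro k x hx
    have e1 := abs_sub (radial φ x * pd k g x) (pd k (radial φ) x * g x)
    rw [abs_mul, abs_mul] at e1
    have e2 : |radial φ x| * |pd k g x| ≤ C * (B * b x) :=
      (mul_le_mul_of_nonneg_right (hC x hx) (abs_nonneg _)).trans (by
        rw [mul_assoc]; exact mul_le_mul_of_nonneg_left (hg2 x k) hC0)
    have e3 : |pd k (radial φ) x| * |g x| ≤ D * (B * b x) := by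
      have e4 : D * (1 + ‖x‖) ≤ D * (1 + ‖x‖) ^ 2 := by
        gcongr
        nlinarith [norm_nonneg x]
      refine (mul_le_mul_of_nonneg_right (((hD x hx).2.1 k).trans e4) (abs_nonneg _)).trans ?_
      rw [mul_assoc]
      exact mul_le_mul_of_nonneg_left (hg1 x) hD0
    calc |Z k x| ≤ _ := e1
      _ ≤ C * (B * b x) + D * (B * b x) := add_le_add e2 e3
      _ = _ := by ring
  have hZpd : ∀ k x, x ≠ 0 → pd k (Z k) x
      = radial φ x * pd k (pd k g) x - pd k (pd k (radial φ)) x * g x := by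
    intro k x hx
    have a1 : DifferentiableAt ℝ (radial φ) x := (h.contDiffAt_radial hx).differentiableAt (by norm_num)
    have a2 : DifferentiableAt ℝ (pd k g) x := (hgd k).differentiable (by norm_num) x
    have a3 : DifferentiableAt ℝ (pd k (radial φ)) x :=
      (h.contDiffAt_pd_radial hx k).differentiableAt (by norm_num)
    have a4 : DifferentiableAt ℝ g x := hg.differentiable (by norm_num) x
    have a5 : DifferentiableAt ℝ (fun y => radial φ y * pd k g y) x := a1.mul a2
    have a6 : DifferentiableAt ℝ (fun y => pd k (radial φ) y * g y) x := a3.mul a4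
    simp only [hZ]
    rw [pd_sub k a5 a6, pd_mul k a1 a2, pd_mul k a3 a4]
    ring
  have hX1 : ∀ (m : ℕ) k, ContDiff ℝ 1 (fun x => annulus m x * Z k x) := fun m k =>
    contDiff_annulus_mul (one_le_two.trans two_le_infty) (hZd k) m
  have hX0 : ∀ m : ℕ, ∫ x, ∑ k, pd k (fun y => annulus m y * Z k y) x = 0 := by
    intro m
    have hcs : ∀ k, HasCompactSupport (fun y => annulus m y * Z k y) := fun k =>
      (hasCompactSupport_annulus m).mul_right
    rw [integral_finsetSum _ fun k _ => (continuous_pd (hX1 m k) k).integrable_of_hasCompactSupport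
      (HasCompactSupport_pd (hcs k) k)]
    exact Finset.sum_eq_zero fun k _ => integral_pd_eq_zero (hX1 m k) (hcs k) k
  have hXe : ∀ (m : ℕ) x, x ≠ 0 → ∑ k, pd k (fun y => annulus m y * Z k y) x
      = annulus m x * (radial φ x * ∑ j, pd j (pd j g) x - (∑ j, pd j (pd j (radial φ)) x) * g x)
        + ∑ k, pd k (annulus m) x * Z k x := by
    intro m x hx
    have : ∀ k, pd k (fun y => annulus m y * Z k y) x
        = annulus m x * (radial φ x * pd k (pd k g) x - pd k (pd k (radial φ)) x * g x)
          + pd k (annulus m) x * Z k x := fun k => by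
      rw [pd_mul k ((contDiff_annulus m).differentiable (by simp) x)
        ((hZd k x hx).differentiableAt (by norm_num)), hZpd k x hx]
    simp_rw [this]
    rw [Finset.sum_add_distrib, ← Finset.mul_sum, Finset.sum_sub_distrib, ← Finset.mul_sum,
      ← Finset.sum_mul]
  have hlim : Tendsto (fun m : ℕ => ∫ x, ∑ k, pd k (fun y => annulus m y * Z k y) x) atTop
      (𝓝 (∫ x, (radial φ x * ∑ j, pd j (pd j g) x - (∑ j, pd j (pd j (radial φ)) x) * g x))) := by
    refine tendsto_integral_of_dominated_convergence
      (fun x => |radial φ x * ∑ j, pd j (pd j g) x - (∑ j, pd j (pd j (radial φ)) x) * g x|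
        + n * (K * ((C + D) * B)) * (‖x‖⁻¹ * b x)) (fun m => ?_)
      ((i1.sub i2).abs.add (hbi'.const_mul _)) (fun m => ?_) ?_
    · exact (Finset.measurable_fun_sum _ fun j _ => measurable_pd j _).aestronglyMeasurable
    · filter_upwards [ae_ne_zero hn] with x hx
      rw [hXe m x hx]
      refine (norm_add_le _ _).trans (add_le_add ?_ ?_)
      · rw [norm_mul, Real.norm_of_nonneg (annulus_nonneg m x)]
        exact mul_le_of_le_one_left (abs_nonneg _) (annulus_le_one m x)
      · have hk : ∀ k, |pd k (annulus m) x * Z k x| ≤ K * ((C + D) * B) * (‖x‖⁻¹ * b x) := by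
          intro k
          have h0 : 0 < ‖x‖ := norm_pos_iff.2 hx
          have e1 : |pd k (annulus m) x| ≤ K * ‖x‖⁻¹ := by
            rw [← div_eq_mul_inv, le_div_iff₀ h0, mul_comm]
            exact hK m x k
          rw [abs_mul]
          have := mul_le_mul e1 (hZb k x hx) (abs_nonneg _) (by positivity)
          linarith
        refine (Finset.abs_sum_le_sum_abs _ _).trans ((Finset.sum_le_sum fun k _ => hk k).trans ?_)
        simp [mul_assoc]
    · filter_upwards [ae_ne_zero hn] with x hx
      simp_rw [hXe _ x hx]
      have h1 := ((tendsto_annulus hx).mul_const (radial φ x * ∑ j, pd j (pd j g) x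
        - (∑ j, pd j (pd j (radial φ)) x) * g x)).add
        (tendsto_finsetSum Finset.univ fun k _ => (tendsto_pd_annulus hx k).mul_const (Z k x))
      simpa using h1
  simp only [hX0] at hlim
  have := tendsto_nhds_unique hlim tendsto_const_nhds
  rw [integral_sub i1 i2] at this
  linarith

end AdmissibleMultipliers

end Green

/-! ### Truncated test functions η S_N(g) and their Laplacians -/

section Truncation

/-- A smooth bounded concave approximation of the identity on `[0, ∞)`. -/
def satur (N t : ℝ) : ℝ := N * t / (N + t)

theorem hasDerivAt_satur {N t : ℝ} (h : N + t ≠ 0) :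
    HasDerivAt (satur N) ((N / (N + t)) ^ 2) t := by
  have := ((hasDerivAt_id t).const_mul N).div ((hasDerivAt_id t).const_add N) h
  refine this.congr_deriv ?_
  simp only [id]
  field_simp
  ring

theorem hasDerivAt_deriv_satur {N t : ℝ} (h : N + t ≠ 0) :
    HasDerivAt (fun t => (N / (N + t)) ^ 2) (-(2 * N ^ 2 / (N + t) ^ 3)) t := by
  have := ((hasDerivAt_const t N).div ((hasDerivAt_id t).const_add N) h).pow 2
  refine this.congr_deriv ?_
  norm_num
  field_simp

theorem contDiffAt_satur {N t : ℝ} (h : N + t ≠ 0) : ContDiffAt ℝ ∞ (satur N) t :=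
  (contDiffAt_const.mul contDiffAt_id).div (contDiffAt_const.add contDiffAt_id) h

theorem satur_nonneg {N t : ℝ} (hN : 0 < N) (ht : 0 ≤ t) : 0 ≤ satur N t := by
  unfold satur; positivity

theorem satur_le {N t : ℝ} (hN : 0 < N) (ht : 0 ≤ t) : satur N t ≤ t := by
  unfold satur
  rw [div_le_iff₀ (by positivity)]
  nlinarith [mul_nonneg ht ht]

theorem satur_le_bound {N t : ℝ} (hN : 0 < N) (ht : 0 ≤ t) : satur N t ≤ N := by
  unfold satur
  rw [div_le_iff₀ (by positivity)]
  nlinarith [mul_pos hN hN]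

/-- The Laplacian of `η · satur N (g)` in terms of the second order jet of `g`. -/
def truncLap (N : ℝ) (η : Eu n → ℝ) (x : Eu n) (t : ℝ) (p : Fin n → ℝ) (q : ℝ) : ℝ :=
  (∑ j, pd j (pd j η) x) * satur N t + 2 * (N / (N + t)) ^ 2 * (∑ j, pd j η x * p j)
    + η x * ((N / (N + t)) ^ 2 * q - 2 * N ^ 2 / (N + t) ^ 3 * ∑ j, p j ^ 2)

theorem sum_pd_pd_mul_satur {N : ℝ} (hN : 0 < N) {η g : Eu n → ℝ} (hη : ContDiff ℝ 2 η)
    (hg : ContDiff ℝ 2 g) (hg0 : ∀ x, 0 ≤ g x) (x : Eu n) :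
    ∑ j, pd j (pd j (fun y => η y * satur N (g y))) x
      = truncLap N η x (g x) (fun j => pd j g x) (∑ j, pd j (pd j g) x) := by
  have hne : ∀ y, N + g y ≠ 0 := fun y => (add_pos_of_pos_of_nonneg hN (hg0 y)).ne'
  have hs : ContDiff ℝ 2 (fun y => satur N (g y)) := contDiff_iff_contDiffAt.2 fun y =>
    ((contDiffAt_satur (hne y)).of_le two_le_infty).comp y hg.contDiffAt
  have hgd : ∀ y, DifferentiableAt ℝ g y := hg.differentiable (by norm_num)
  have e1 : ∀ j y, pd j (fun y => satur N (g y)) y = (N / (N + g y)) ^ 2 * pd j g y := fun j y => by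
    rw [pd_scomp j (hasDerivAt_satur (hne y)).differentiableAt (hgd y),
      (hasDerivAt_satur (hne y)).deriv]
  have e2 : ∀ j, pd j (pd j (fun y => satur N (g y))) x
      = (N / (N + g x)) ^ 2 * pd j (pd j g) x - 2 * N ^ 2 / (N + g x) ^ 3 * pd j g x ^ 2 := by
    intro j
    have a1 : DifferentiableAt ℝ (fun y => (N / (N + g y)) ^ 2) x :=
      (hasDerivAt_deriv_satur (hne x)).differentiableAt.comp x (hgd x)
    have a2 : DifferentiableAt ℝ (pd j g) x :=
      (ContDiff_pd (k := 1) hg (by norm_num) j).differentiable (by norm_num) x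
    rw [pd_congr j (Eventually.of_forall (e1 j)), pd_mul j a1 a2,
      pd_scomp (h := fun t => (N / (N + t)) ^ 2) j
        (hasDerivAt_deriv_satur (hne x)).differentiableAt (hgd x),
      (hasDerivAt_deriv_satur (hne x)).deriv]
    ring
  simp_rw [pd_pd_mul hη.contDiffAt hs.contDiffAt, e2, e1]
  simp only [truncLap, Finset.sum_add_distrib, Finset.sum_sub_distrib, ← Finset.mul_sum,
    ← Finset.sum_mul]
  have e3 : ∑ j, pd j η x * ((N / (N + g x)) ^ 2 * pd j g x)
      = (N / (N + g x)) ^ 2 * ∑ j, pd j η x * pd j g x := by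
    rw [Finset.mul_sum]
    exact Finset.sum_congr rfl fun j _ => by ring
  rw [e3]
  ring

/-- The bound is independent of N. The first derivative of S_N lies between 0 and 1. The second has
size 2N²/(N+t)³, and the hypothesis Σ p_j² ≤ 4ts, which models |∇|u|²|² ≤ 4|u|²|∇_A u|², turns its
product with Σ p_j² into at most 8s because N²t ≤ (N+t)³. -/
theorem abs_truncLap_le {N K t q s : ℝ} {η : Eu n → ℝ} {x : Eu n} {p : Fin n → ℝ} (hN : 0 < N)
    (ht : 0 ≤ t) (hη0 : 0 ≤ η x) (hη1 : η x ≤ 1) (hK1 : ∀ j, |pd j η x| ≤ K) (hK : 0 ≤ K)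
    (hK2 : |∑ j, pd j (pd j η) x| ≤ K) (hs : 0 ≤ s) (hp : ∑ j, p j ^ 2 ≤ 4 * t * s) :
    |truncLap N η x t p q| ≤ K * t + 2 * K * (∑ j, |p j|) + |q| + 8 * s := by
  have hNt : 0 < N + t := by linarith
  have hr0 : 0 ≤ (N / (N + t)) ^ 2 := sq_nonneg _
  have hr1 : (N / (N + t)) ^ 2 ≤ 1 :=
    pow_le_one₀ (by positivity) ((div_le_one hNt).2 (by linarith))
  have hp0 : 0 ≤ ∑ j, p j ^ 2 := Finset.sum_nonneg fun _ _ => sq_nonneg _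
  have e1 : |(∑ j, pd j (pd j η) x) * satur N t| ≤ K * t := by
    rw [abs_mul, abs_of_nonneg (satur_nonneg hN ht)]
    exact mul_le_mul hK2 (satur_le hN ht) (satur_nonneg hN ht) hK
  have e2 : |2 * (N / (N + t)) ^ 2 * (∑ j, pd j η x * p j)| ≤ 2 * K * ∑ j, |p j| := by
    have : |∑ j, pd j η x * p j| ≤ K * ∑ j, |p j| := by
      rw [Finset.mul_sum]
      refine (Finset.abs_sum_le_sum_abs _ _).trans (Finset.sum_le_sum fun j _ => ?_)
      rw [abs_mul]
      exact mul_le_mul_of_nonneg_right (hK1 j) (abs_nonneg _)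
    rw [abs_mul, abs_of_nonneg (by positivity : 0 ≤ 2 * (N / (N + t)) ^ 2), mul_assoc 2 K]
    exact mul_le_mul (by linarith) this (abs_nonneg _) (by norm_num)
  have e3 : |(N / (N + t)) ^ 2 * q| ≤ |q| := by
    rw [abs_mul, abs_of_nonneg hr0]
    exact mul_le_of_le_one_left (abs_nonneg _) hr1
  have e4 : |2 * N ^ 2 / (N + t) ^ 3 * ∑ j, p j ^ 2| ≤ 8 * s := by
    rw [abs_of_nonneg (by positivity)]
    have h1 : 2 * N ^ 2 / (N + t) ^ 3 * ∑ j, p j ^ 2 ≤ 2 * N ^ 2 / (N + t) ^ 3 * (4 * t * s) := by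
      gcongr
    refine h1.trans ?_
    rw [div_mul_eq_mul_div, div_le_iff₀ (by positivity)]
    have h2 : N ^ 2 * t ≤ (N + t) ^ 3 := by
      have : 0 ≤ N ^ 3 + 2 * N ^ 2 * t + 3 * N * t ^ 2 + t ^ 3 := by positivity
      nlinarith
    nlinarith [mul_le_mul_of_nonneg_left h2 hs]
  have e5 : |η x * ((N / (N + t)) ^ 2 * q - 2 * N ^ 2 / (N + t) ^ 3 * ∑ j, p j ^ 2)|
      ≤ |q| + 8 * s := by
    rw [abs_mul, abs_of_nonneg hη0]
    refine (mul_le_of_le_one_left (abs_nonneg _) hη1).trans ?_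
    exact (abs_sub _ _).trans (add_le_add e3 e4)
  exact (abs_add_three _ _ _).trans (by linarith)

theorem tendsto_truncLap {N : ℝ} (hN : 0 < N) (η : Eu n → ℝ) (x : Eu n) {t : ℕ → ℝ} {t' : ℝ}
    {p : ℕ → Fin n → ℝ} {p' : Fin n → ℝ} {q : ℕ → ℝ} {q' : ℝ} (ht' : 0 ≤ t')
    (ht : Tendsto t atTop (𝓝 t')) (hp : ∀ j, Tendsto (fun m => p m j) atTop (𝓝 (p' j)))
    (hq : Tendsto q atTop (𝓝 q')) :
    Tendsto (fun m => truncLap N η x (t m) (p m) (q m)) atTop (𝓝 (truncLap N η x t' p' q')) := by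
  have hne : N + t' ≠ 0 := by positivity
  have h0 : Tendsto (fun m => N + t m) atTop (𝓝 (N + t')) := ht.const_add N
  have h1 : Tendsto (fun m => (N / (N + t m)) ^ 2) atTop (𝓝 ((N / (N + t')) ^ 2)) :=
    (tendsto_const_nhds.div h0 hne).pow 2
  have h2 : Tendsto (fun m => 2 * N ^ 2 / (N + t m) ^ 3) atTop (𝓝 (2 * N ^ 2 / (N + t') ^ 3)) :=
    tendsto_const_nhds.div (h0.pow 3) (pow_ne_zero 3 hne)
  have h3 : Tendsto (fun m => satur N (t m)) atTop (𝓝 (satur N t')) :=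
    (hasDerivAt_satur hne).continuousAt.tendsto.comp ht
  exact ((h3.const_mul _).add ((h1.const_mul 2).mul
    (tendsto_finsetSum _ fun j _ => (hp j).const_mul _))).add
    (((h1.mul hq).sub (h2.mul (tendsto_finsetSum _ fun j _ => (hp j).pow 2))).const_mul _)

end Truncation

/-! ### The mollified second order jet of |u|² and bounds for the weight -/

section Mollified

variable {A : Eu n → Eu n} {V : Eu n → ℝ} {z : ℂ} {f u : Eu n → ℂ} {G : Fin n → Eu n → ℂ}
  {φ θ : ℝ → ℝ}

namespace IsSolution

theorem contDiff_ker_sub (m : ℕ) (x : Eu n) : ContDiff ℝ 1 (fun y => ker n m (x - y)) :=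
  (isTest_ker_sub m x).1.of_le (by simp)

theorem pd_mollify_sq (h : IsSolution A V z f u G) (m : ℕ) (j : Fin n) (x : Eu n) :
    pd j (mollify m fun y => ‖u y‖ ^ 2) x = mollify m (gradSq A u G j) x := by
  have h1 := (h.integral_sq_mul_pd (contDiff_ker_sub m x) (hasCompactSupport_ker_sub m x) j).2
  have i1 := integrable_pd_ker_smul h.integrable_sq.locallyIntegrable m j x
  have i2 := integrable_ker_smul (h.integrable_gradSq j).locallyIntegrable m x
  rw [pd_mollify h.integrable_sq.locallyIntegrable, mollify, eq_comm, ← sub_eq_zero,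
    ← integral_sub i2 i1, ← h1]
  refine integral_congr_ae (Eventually.of_forall fun y => ?_)
  simp only [pd_ker_sub, smul_eq_mul]
  ring

theorem sum_pd_pd_mollify_sq (h : IsSolution A V z f u G) (m : ℕ) (x : Eu n) :
    ∑ j, pd j (pd j (mollify m fun y => ‖u y‖ ^ 2)) x = mollify m (lapSq A V z f u G) x := by
  have h1 := (h.integral_lapSq_mul (contDiff_ker_sub m x) (hasCompactSupport_ker_sub m x)).2
  have i1 : Integrable (fun y => ∑ j, pd j (ker n m) (x - y) • gradSq A u G j y) volume :=
    integrable_finsetSum _ fun j _ =>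
      integrable_pd_ker_smul (h.integrable_gradSq j).locallyIntegrable m j x
  have i2 := integrable_ker_smul h.integrable_lapSq.locallyIntegrable m x
  have e : ∀ j, pd j (pd j (mollify m fun y => ‖u y‖ ^ 2)) x
      = ∫ y, pd j (ker n m) (x - y) • gradSq A u G j y := fun j => by
    rw [pd_congr j (Eventually.of_forall (h.pd_mollify_sq m j)),
      pd_mollify (h.integrable_gradSq j).locallyIntegrable]
  simp_rw [e]
  rw [← integral_finsetSum _ fun j _ =>
    integrable_pd_ker_smul (h.integrable_gradSq j).locallyIntegrable m j x, mollify, eq_comm,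
    ← sub_eq_zero, ← integral_sub i2 i1, ← h1]
  refine integral_congr_ae (Eventually.of_forall fun y => ?_)
  simp only [pd_ker_sub, smul_eq_mul, mul_neg, Finset.sum_neg_distrib]
  rw [Finset.sum_congr rfl fun j _ => mul_comm (gradSq A u G j y) _]
  ring

theorem sum_sq_gradSq_le (A : Eu n → Eu n) (u : Eu n → ℂ) (G : Fin n → Eu n → ℂ) (x : Eu n) :
    ∑ j, gradSq A u G j x ^ 2 ≤ 4 * ‖u x‖ ^ 2 * magGradSq A u G x := by
  rw [magGradSq, Finset.mul_sum]
  refine Finset.sum_le_sum fun j _ => ?_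
  have := pow_le_pow_left₀ (abs_nonneg _) (abs_gradSq_le A u G j x) 2
  rw [sq_abs] at this
  linarith

/-- Cauchy–Schwarz for the kernel: the pointwise inequality |∇|u|²|² ≤ 4|u|²|∇_A u|² survives
mollifying each of the three quantities separately. -/
theorem sum_sq_mollify_gradSq_le (h : IsSolution A V z f u G) (m : ℕ) (x : Eu n) :
    ∑ j, mollify m (gradSq A u G j) x ^ 2
      ≤ 4 * mollify m (fun y => ‖u y‖ ^ 2) x * mollify m (magGradSq A u G) x := by
  have iD : ∀ j, Integrable (fun y => ‖magGrad A u G j y‖ ^ 2) volume := fun j =>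
    memLp_integrable_sq (h.hu.magGrad_memLp j)
  have iDu : ∀ j, Integrable (fun y => ‖magGrad A u G j y‖ * ‖u y‖) volume := fun j =>
    (memLp_integrable_mul_star (h.hu.magGrad_memLp j) h.hu.memLp).norm.congr
      (Eventually.of_forall fun x => by simp)
  have e : mollify m (magGradSq A u G) x = ∑ j, mollify m (fun y => ‖magGrad A u G j y‖ ^ 2) x := by
    simp only [mollify, magGradSq, Finset.smul_sum]
    exact integral_finsetSum _ fun j _ => integrable_ker_smul (iD j).locallyIntegrable m x
  rw [e, Finset.mul_sum]
  refine Finset.sum_le_sum fun j _ => ?_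
  have h1 := sq_integral_mul_le (μ := volume) (a := fun y => ‖magGrad A u G j y‖)
    (b := fun y => ‖u y‖) (fun y => ker n m (x - y)) (fun y => ker_nonneg _ _)
    (integrable_ker_smul (iDu j).locallyIntegrable m x)
    (integrable_ker_smul (iD j).locallyIntegrable m x)
    (integrable_ker_smul h.integrable_sq.locallyIntegrable m x)
  have h2 : |mollify m (gradSq A u G j) x|
      ≤ 2 * ∫ y, ker n m (x - y) * (‖magGrad A u G j y‖ * ‖u y‖) := by
    refine (norm_mollify_le (g := gradSq A u G j) ((iDu j).const_mul 2).locallyIntegrable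
      (abs_gradSq_le A u G j) m x).trans (le_of_eq ?_)
    rw [mollify, ← integral_const_mul]
    refine integral_congr_ae (Eventually.of_forall fun y => ?_)
    simp only [smul_eq_mul]
    ring
  have h3 := pow_le_pow_left₀ (abs_nonneg _) h2 2
  rw [sq_abs, mul_pow] at h3
  simp only [mollify, smul_eq_mul] at h1 h3 ⊢
  linarith

/-- A common bound for the weak second order jet of `|u|²`. -/
def jetBound (A : Eu n → Eu n) (V : Eu n → ℝ) (z : ℂ) (f u : Eu n → ℂ) (G : Fin n → Eu n → ℂ)
    (x : Eu n) : ℝ :=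
  ‖u x‖ ^ 2 + (∑ j, |gradSq A u G j x|) + |lapSq A V z f u G x| + magGradSq A u G x

theorem integrable_jetBound (h : IsSolution A V z f u G) :
    Integrable (jetBound A V z f u G) volume :=
  ((h.integrable_sq.add (integrable_finsetSum _ fun j _ => (h.integrable_gradSq j).abs)).add
    h.integrable_lapSq.abs).add h.integrable_magGradSq

theorem integrable_jetBound_mul_inv (hn : 3 ≤ n) (h : IsSolution A V z f u G) :
    Integrable (fun x => jetBound A V z f u G x * ‖x‖⁻¹) volume := by
  refine ((((h.integrable_sq_mul_inv hn).add (integrable_finsetSum Finset.univ fun j _ =>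
    (h.integrable_gradSq_mul_inv hn j).abs)).add (h.integrable_lapSq_mul_inv hn).abs).add
    (h.integrable_magGradSq_mul_inv hn)).congr (Eventually.of_forall fun x => ?_)
  simp only [jetBound, Pi.add_apply, abs_mul, abs_inv, abs_norm, add_mul, Finset.sum_mul]

theorem le_jetBound (A : Eu n → Eu n) (V : Eu n → ℝ) (z : ℂ) (f u : Eu n → ℂ)
    (G : Fin n → Eu n → ℂ) (x : Eu n) :
    0 ≤ jetBound A V z f u G x ∧ ‖u x‖ ^ 2 ≤ jetBound A V z f u G x ∧
    (∀ j, |gradSq A u G j x| ≤ jetBound A V z f u G x) ∧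
    |lapSq A V z f u G x| ≤ jetBound A V z f u G x ∧
    magGradSq A u G x ≤ jetBound A V z f u G x := by
  have h1 : 0 ≤ ‖u x‖ ^ 2 := sq_nonneg _
  have h2 : 0 ≤ ∑ j, |gradSq A u G j x| := Finset.sum_nonneg fun _ _ => abs_nonneg _
  have h3 := abs_nonneg (lapSq A V z f u G x)
  have h4 := magGradSq_nonneg A u G x
  refine ⟨?_, ?_, fun j => ?_, ?_, ?_⟩ <;> rw [jetBound]
  · positivity
  · linarith
  · have := Finset.single_le_sum (f := fun j => |gradSq A u G j x|) (fun _ _ => abs_nonneg _)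
      (Finset.mem_univ j)
    linarith
  · linarith
  · linarith

theorem abs_truncLap_le_jetBound {N K : ℝ} {η : Eu n → ℝ} {x : Eu n} (hN : 0 < N)
    (hη0 : 0 ≤ η x) (hη1 : η x ≤ 1) (hK1 : ∀ j, |pd j η x| ≤ K) (hK : 0 ≤ K)
    (hK2 : |∑ j, pd j (pd j η) x| ≤ K) :
    |truncLap N η x (‖u x‖ ^ 2) (fun j => gradSq A u G j x) (lapSq A V z f u G x)|
      ≤ (K + 2 * K * n + 9) * jetBound A V z f u G x := by
  obtain ⟨-, b1, b2, b3, b4⟩ := le_jetBound A V z f u G x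
  have h1 := abs_truncLap_le (q := lapSq A V z f u G x) hN (sq_nonneg ‖u x‖) hη0 hη1 hK1 hK hK2
    (magGradSq_nonneg A u G x) (sum_sq_gradSq_le A u G x)
  have h2 : ∑ j, |gradSq A u G j x| ≤ n * jetBound A V z f u G x := by
    refine (Finset.sum_le_sum fun j _ => b2 j).trans (by simp)
  have h3 := mul_le_mul_of_nonneg_left h2 (by positivity : 0 ≤ 2 * K)
  have h4 := mul_le_mul_of_nonneg_left b1 hK
  linarith

theorem abs_truncLap_mollify_le (h : IsSolution A V z f u G) {N K : ℝ} {η : Eu n → ℝ} {x : Eu n}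
    (hN : 0 < N) (hη0 : 0 ≤ η x) (hη1 : η x ≤ 1) (hK1 : ∀ j, |pd j η x| ≤ K) (hK : 0 ≤ K)
    (hK2 : |∑ j, pd j (pd j η) x| ≤ K) (m : ℕ) :
    |truncLap N η x (mollify m (fun y => ‖u y‖ ^ 2) x) (fun j => mollify m (gradSq A u G j) x)
        (mollify m (lapSq A V z f u G) x)|
      ≤ (K + 2 * K * n + 9) * mollify m (jetBound A V z f u G) x := by
  have hb := le_jetBound A V z f u G
  have hJ := h.integrable_jetBound.locallyIntegrable
  have b1 := mollify_mono h.integrable_sq.locallyIntegrable hJ (fun y => (hb y).2.1) m x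
  have b2 := fun j => norm_mollify_le (g := gradSq A u G j) hJ (fun y => (hb y).2.2.1 j) m x
  have b3 := norm_mollify_le (g := lapSq A V z f u G) hJ (fun y => (hb y).2.2.2.1) m x
  have b4 := mollify_mono h.integrable_magGradSq.locallyIntegrable hJ (fun y => (hb y).2.2.2.2) m x
  have h1 := abs_truncLap_le (q := mollify m (lapSq A V z f u G) x) hN
    (mollify_nonneg (fun y => sq_nonneg ‖u y‖) m x) hη0 hη1 hK1 hK hK2
    (mollify_nonneg (magGradSq_nonneg A u G) m x) (h.sum_sq_mollify_gradSq_le m x)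
  have h2 : ∑ j, |mollify m (gradSq A u G j) x| ≤ n * mollify m (jetBound A V z f u G) x := by
    refine (Finset.sum_le_sum fun j _ => b2 j).trans (by simp)
  have h3 := mul_le_mul_of_nonneg_left h2 (by positivity : 0 ≤ 2 * K)
  have h4 := mul_le_mul_of_nonneg_left b1 hK
  rw [Real.norm_eq_abs] at b3
  linarith

end IsSolution

theorem IsTest.sum_pd_pd {ψ : Eu n → ℝ} (hψ : IsTest ψ) :
    IsTest (fun x => ∑ j, pd j (pd j ψ) x) := by
  refine ⟨ContDiff.sum fun j _ => (isTest_pd (isTest_pd hψ j) j).1, ?_⟩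
  exact HasCompactSupport.intro hψ.2 fun x hx => by simp [pd_pd_eq_zero_of_notMem_tsupport hx]

theorem laplacian_eq_of_isTest {ψ : Eu n → ℝ} (hψ : IsTest ψ) :
    Laplacian.laplacian ψ = fun x => ∑ j, pd j (pd j ψ) x :=
  funext fun _ => laplacian_eq_sum_pd (hψ.1.of_le two_le_infty).contDiffAt

/-- The weight `½ Δφ(|x|) - θ(|x|)`. -/
def weight (φ θ : ℝ → ℝ) (x : Eu n) : ℝ :=
  1 / 2 * Laplacian.laplacian (radial φ) x - θ ‖x‖

namespace AdmissibleMultipliers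

theorem aestronglyMeasurable_laplacian (hn : 3 ≤ n) (hm : AdmissibleMultipliers φ θ) :
    AEStronglyMeasurable (Laplacian.laplacian (radial φ : Eu n → ℝ)) volume := by
  refine AEStronglyMeasurable.congr
    (f := fun x => ∑ j, pd j (pd j (radial φ)) x) ?_ ?_
  · exact (Finset.measurable_fun_sum _ fun j _ => measurable_pd j _).aestronglyMeasurable
  · filter_upwards [ae_ne_zero hn] with x hx using (hm.laplacian_radial_eq hx).symm

theorem aestronglyMeasurable_weight (hn : 3 ≤ n) (hm : AdmissibleMultipliers φ θ) :
    AEStronglyMeasurable (weight φ θ : Eu n → ℝ) volume :=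
  ((hm.aestronglyMeasurable_laplacian hn).const_mul _).sub (hm.aestronglyMeasurable_snd hn)

theorem exists_abs_weight_le (hm : AdmissibleMultipliers φ θ) :
    ∃ C : ℝ, 0 ≤ C ∧ ∀ x : Eu n, x ≠ 0 → |weight φ θ x| ≤ C * (1 + ‖x‖⁻¹) := by
  obtain ⟨D, hD0, hD⟩ := hm.exists_bounds (n := n)
  refine ⟨n * D + D, by positivity, fun x hx => ?_⟩
  have h1 := IsSolution.norm_sum_pd_pd_radial_le (hD x hx).2.2
  have h2 := (hD x hx).1
  have h3 := abs_sub (1 / 2 * Laplacian.laplacian (radial φ) x) (θ ‖x‖)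
  rw [abs_mul, abs_of_pos (by norm_num : (0 : ℝ) < 1 / 2), hm.laplacian_radial_eq hx] at h3
  rw [weight, hm.laplacian_radial_eq hx]
  have h4 : 0 ≤ D * ‖x‖⁻¹ := by positivity
  have h5 : 0 ≤ |∑ j, pd j (pd j (radial φ)) x| := abs_nonneg _
  linarith

/-- Green's identity applied to Δψ moves one Laplacian from ψ to φ across the singularity. The
factor 2 arises because formally Δ(½Δφ − θ) is twice ¼Δ²φ − ½Δθ. -/
theorem integral_weight_mul_lap (hn : 3 ≤ n) (hm : AdmissibleMultipliers φ θ) {ψ : Eu n → ℝ}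
    (hψ : IsTest ψ) :
    ∫ x, weight φ θ x * ∑ j, pd j (pd j ψ) x
      = 2 * ∫ x, ((1 / 4) * radial φ x * Laplacian.laplacian (Laplacian.laplacian ψ) x
          - (1 / 2) * radial θ x * Laplacian.laplacian ψ x) := by
  have hg := hψ.sum_pd_pd
  rw [laplacian_eq_of_isTest hψ, laplacian_eq_of_isTest hg]
  obtain ⟨i1, i2, e⟩ := hm.integral_radial_mul_laplacian hn (hg.1.of_le two_le_infty) hg.2
  have i3 : Integrable (fun x => θ ‖x‖ * ∑ j, pd j (pd j ψ) x) volume :=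
    IsSolution.integrable_snd_mul hn hm (hg.1.continuous.integrable_of_hasCompactSupport hg.2)
  have e1 : ∫ x, weight φ θ x * ∑ j, pd j (pd j ψ) x
      = ∫ x, (1 / 2 * ((∑ j, pd j (pd j (radial φ)) x) * ∑ j, pd j (pd j ψ) x)
        - θ ‖x‖ * ∑ j, pd j (pd j ψ) x) := by
    refine integral_congr_ae ?_
    filter_upwards [ae_ne_zero hn] with x hx
    rw [weight, hm.laplacian_radial_eq hx]
    ring
  have e2 : ∀ x : Eu n, (1 / 4) * radial φ x
        * (∑ j, pd j (pd j fun y => ∑ j, pd j (pd j ψ) y) x)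
          - (1 / 2) * radial θ x * ∑ j, pd j (pd j ψ) x
      = 1 / 4 * (radial φ x * ∑ j, pd j (pd j fun y => ∑ j, pd j (pd j ψ) y) x)
        - 1 / 2 * (θ ‖x‖ * ∑ j, pd j (pd j ψ) x) := fun x => by
    simp only [radial]; ring
  rw [e1, integral_sub (i2.const_mul _) i3, integral_const_mul, ← e,
    integral_congr_ae (Eventually.of_forall e2), integral_sub (i1.const_mul _) (i3.const_mul _),
    integral_const_mul, integral_const_mul]
  ring

end AdmissibleMultipliers

end Mollified

/-! ### Limits of the truncated identities and the distributional term -/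

section Limit

variable {A : Eu n → Eu n} {V : Eu n → ℝ} {z : ℂ} {f u : Eu n → ℂ} {G : Fin n → Eu n → ℂ}
  {φ θ : ℝ → ℝ}

/-- The indicator is at most 1, constants are preserved by mollification, and 1/|x| is an A₁ weight.
-/
theorem exists_mollify_weight_indicator_le (hn : 3 ≤ n) (R : ℝ) :
    ∃ C : ℝ, ∀ m : ℕ, ∀ᵐ x : Eu n, mollify m (fun x =>
      (1 + ‖x‖⁻¹) * (Metric.closedBall (0 : Eu n) R).indicator (fun _ => (1 : ℝ)) x) x
        ≤ C * (1 + ‖x‖⁻¹) := by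
  obtain ⟨C, hC1, hC⟩ := exists_mollify_inv_norm_le (n := n) (by omega)
  refine ⟨C, fun m => ?_⟩
  have hl1 : LocallyIntegrable (fun x : Eu n => (1 + ‖x‖⁻¹)
      * (Metric.closedBall (0 : Eu n) R).indicator (fun _ => (1 : ℝ)) x) volume := by
    refine Integrable.locallyIntegrable (((integrable_indicator_one R).add
      (integrable_inv_norm_mul_indicator hn R)).congr (Eventually.of_forall fun x => ?_))
    simp only [Pi.add_apply]
    ring
  have hl2 := locallyIntegrable_inv_norm (n := n) (by omega)
  have hl3 : LocallyIntegrable (fun x : Eu n => 1 + ‖x‖⁻¹) volume := (locallyIntegrable_const 1).add hl2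
  filter_upwards [ae_ne_zero hn] with x hx
  refine (mollify_mono hl1 hl3 (fun y => mul_le_of_le_one_right (by positivity)
    (indicator_le_self' (fun _ _ => zero_le_one) y)) m x).trans ?_
  have e : mollify m (fun x : Eu n => 1 + ‖x‖⁻¹) x = 1 + mollify m (fun x : Eu n => ‖x‖⁻¹) x := by
    have i1 := integrable_ker_smul (locallyIntegrable_const (1 : ℝ)) m x
    have i2 := integrable_ker_smul hl2 m x
    simp only [mollify, smul_add]
    rw [integral_add i1 i2]
    simp [integral_ker_sub]
  rw [e]
  linarith [hC m x hx]

theorem truncLap_eq_zero {N : ℝ} {η : Eu n → ℝ} {x : Eu n} (hx : x ∉ tsupport η) (t : ℝ)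
    (p : Fin n → ℝ) (q : ℝ) : truncLap N η x t p q = 0 := by
  simp [truncLap, image_eq_zero_of_notMem_tsupport hx, pd_eq_zero_of_notMem_tsupport hx,
    pd_pd_eq_zero_of_notMem_tsupport hx]

theorem aestronglyMeasurable_truncLap (N : ℝ) {η : Eu n → ℝ} (hη : IsTest η) {t q : Eu n → ℝ}
    {p : Fin n → Eu n → ℝ} (ht : AEStronglyMeasurable t volume)
    (hp : ∀ j, AEStronglyMeasurable (p j) volume) (hq : AEStronglyMeasurable q volume) :
    AEStronglyMeasurable (fun x => truncLap N η x (t x) (fun j => p j x) (q x)) volume := by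
  have h1 : AEStronglyMeasurable (fun x => (N / (N + t x)) ^ 2) volume :=
    (((ht.aemeasurable.const_add N).const_div N).pow_const 2).aestronglyMeasurable
  have h2 : AEStronglyMeasurable (fun x => 2 * N ^ 2 / (N + t x) ^ 3) volume :=
    (((ht.aemeasurable.const_add N).pow_const 3).const_div _).aestronglyMeasurable
  have h3 : AEStronglyMeasurable (fun x => satur N (t x)) volume :=
    ((ht.aemeasurable.const_mul N).div (ht.aemeasurable.const_add N)).aestronglyMeasurable
  have h4 : AEStronglyMeasurable (fun x => ∑ j, pd j (pd j η) x) volume :=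
    hη.sum_pd_pd.1.continuous.aestronglyMeasurable
  have h5 : AEStronglyMeasurable (fun x => ∑ j, pd j η x * p j x) volume :=
    Finset.aestronglyMeasurable_fun_sum _ fun j _ =>
      (measurable_pd j η).aestronglyMeasurable.mul (hp j)
  have h6 : AEStronglyMeasurable (fun x => ∑ j, p j x ^ 2) volume :=
    Finset.aestronglyMeasurable_fun_sum _ fun j _ => (hp j).pow 2
  have h7 : AEStronglyMeasurable η volume := hη.1.continuous.aestronglyMeasurable
  unfold truncLap
  exact ((h4.mul h3).add ((h1.const_mul 2).mul h5)).add (h7.mul ((h1.mul hq).sub (h2.mul h6)))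

namespace IsSolution

/-- Mollifications of |u|² have no integrable bound with respect to μ, but S_N ≤ N supplies the
dominant Nη. Pointwise convergence holds at Lebesgue points, hence μ-almost everywhere. -/
theorem tendsto_integral_mul_satur {μ : Measure (Eu n)} [IsFiniteMeasureOnCompacts μ] (hn : n ≠ 0)
    (h : IsSolution A V z f u G) (hL : ∀ᵐ x ∂μ, IsLebesguePoint (fun y => ‖u y‖ ^ 2) x) {N : ℝ}
    (hN : 0 < N) {η : Eu n → ℝ} (hη : IsTest η) (hη0 : ∀ x, 0 ≤ η x) :
    Tendsto (fun m => ∫ x, η x * satur N (mollify m (fun y => ‖u y‖ ^ 2) x) ∂μ) atTop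
      (𝓝 (∫ x, η x * satur N (‖u x‖ ^ 2) ∂μ)) := by
  have hW := h.integrable_sq.locallyIntegrable
  have hW0 : ∀ m x, 0 ≤ mollify m (fun y : Eu n => ‖u y‖ ^ 2) x := fun m x =>
    mollify_nonneg (fun y => sq_nonneg ‖u y‖) m x
  have hne : ∀ t : ℝ, 0 ≤ t → N + t ≠ 0 := fun t ht => by positivity
  refine tendsto_integral_of_dominated_convergence (fun x => η x * N) (fun m => ?_)
    ((hη.1.continuous.integrable_of_hasCompactSupport hη.2).mul_const N) (fun m => ?_) ?_
  · refine Continuous.aestronglyMeasurable (hη.1.continuous.mul ?_)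
    exact continuous_iff_continuousAt.2 fun x =>
      (hasDerivAt_satur (hne _ (hW0 m x))).continuousAt.comp (contDiff_mollify hW m).continuous.continuousAt
  · refine Eventually.of_forall fun x => ?_
    rw [Real.norm_of_nonneg (mul_nonneg (hη0 x) (satur_nonneg hN (hW0 m x)))]
    exact mul_le_mul_of_nonneg_left (satur_le_bound hN (hW0 m x)) (hη0 x)
  · filter_upwards [hL] with x hx
    exact ((hasDerivAt_satur (hne _ (sq_nonneg _))).continuousAt.tendsto.comp
      (tendsto_mollify_of_isLebesguePoint hn hW hx)).const_mul _

/-- Insert the test function η S_N(W_m), with W_m the mollification of |u|², into the distributional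
identity and let m → ∞. On the measure side truncation and Lebesgue points suffice. On the volume
side the Laplacian is bounded by the mollification of `jetBound`, and the limit follows from Pratt's
lemma. -/
theorem integral_weight_mul_truncLap (hn : 3 ≤ n) (h : IsSolution A V z f u G)
    (hm : AdmissibleMultipliers φ θ) {μ₁ μ₂ : Measure (Eu n)} [IsFiniteMeasureOnCompacts μ₁]
    [IsFiniteMeasureOnCompacts μ₂]
    (hμ : ∀ ψ : Eu n → ℝ, IsTest ψ →
      ∫ x, weight φ θ x * ∑ j, pd j (pd j ψ) x = 2 * ((∫ x, ψ x ∂μ₁) - ∫ x, ψ x ∂μ₂))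
    (hL₁ : ∀ᵐ x ∂μ₁, IsLebesguePoint (fun y => ‖u y‖ ^ 2) x)
    (hL₂ : ∀ᵐ x ∂μ₂, IsLebesguePoint (fun y => ‖u y‖ ^ 2) x) {N : ℝ} (hN : 0 < N) {η : Eu n → ℝ}
    (hη : IsTest η) (hη0 : ∀ x, 0 ≤ η x) (hη1 : ∀ x, η x ≤ 1) :
    ∫ x, weight φ θ x
        * truncLap N η x (‖u x‖ ^ 2) (fun j => gradSq A u G j x) (lapSq A V z f u G x)
      = 2 * ((∫ x, η x * satur N (‖u x‖ ^ 2) ∂μ₁) - ∫ x, η x * satur N (‖u x‖ ^ 2) ∂μ₂) := by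
  have hW := h.integrable_sq.locallyIntegrable
  have hW0 : ∀ m x, 0 ≤ mollify m (fun y : Eu n => ‖u y‖ ^ 2) x := fun m x =>
    mollify_nonneg (fun y => sq_nonneg ‖u y‖) m x
  have hWc : ∀ m, ContDiff ℝ ∞ (mollify m (fun y : Eu n => ‖u y‖ ^ 2)) := contDiff_mollify hW
  have hne : ∀ m x, N + mollify m (fun y : Eu n => ‖u y‖ ^ 2) x ≠ 0 := fun m x =>
    (add_pos_of_pos_of_nonneg hN (hW0 m x)).ne'
  obtain ⟨C, hC0, hC⟩ := hm.exists_abs_weight_le (n := n)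
  obtain ⟨B, R', hB0, hB⟩ := exists_jet_le_indicator (hη.1.of_le two_le_infty) hη.2
  obtain ⟨R, hR⟩ := hη.2.isCompact.isBounded.subset_closedBall (0 : Eu n)
  obtain ⟨C', hC'⟩ := exists_mollify_weight_indicator_le (n := n) hn R
  have hjet : ∀ x, |η x| + ∑ j, |pd j η x| + |∑ j, pd j (pd j η) x| ≤ B := by
    intro x
    have h0 : 0 ≤ |η x| + ∑ j, |pd j η x| + |∑ j, pd j (pd j η) x| := by
      have : 0 ≤ ∑ j, |pd j η x| := Finset.sum_nonneg fun _ _ => abs_nonneg _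
      positivity
    have h1 : (1 : ℝ) ≤ (1 + ‖x‖) ^ 2 := one_le_pow₀ (by linarith [norm_nonneg x])
    have h2 : (Metric.closedBall (0 : Eu n) R').indicator (fun _ => (1 : ℝ)) x ≤ 1 :=
      indicator_le_self' (fun _ _ => zero_le_one) x
    exact (le_mul_of_one_le_left h0 h1).trans ((hB x).trans (mul_le_of_le_one_right hB0 h2))
  have hK1 : ∀ x j, |pd j η x| ≤ B := fun x j => by
    have := Finset.single_le_sum (f := fun j => |pd j η x|) (fun _ _ => abs_nonneg _)
      (Finset.mem_univ j)
    linarith [hjet x, abs_nonneg (η x), abs_nonneg (∑ j, pd j (pd j η) x)]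
  have hK2 : ∀ x, |∑ j, pd j (pd j η) x| ≤ B := fun x => by
    have : 0 ≤ ∑ j, |pd j η x| := Finset.sum_nonneg fun _ _ => abs_nonneg _
    linarith [hjet x, abs_nonneg (η x)]
  set k : Eu n → ℝ := fun x =>
    (1 + ‖x‖⁻¹) * (Metric.closedBall (0 : Eu n) R).indicator (fun _ => (1 : ℝ)) x with hk
  have hk0 : ∀ x, 0 ≤ k x := fun x =>
    mul_nonneg (by positivity) (indicator_nonneg (fun _ _ => zero_le_one) x)
  have hki : Integrable k volume := by
    refine ((integrable_indicator_one R).add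
      (integrable_inv_norm_mul_indicator hn R)).congr (Eventually.of_forall fun x => ?_)
    simp only [hk, Pi.add_apply]
    ring
  have hJ0 : ∀ x, 0 ≤ jetBound A V z f u G x := fun x => (le_jetBound A V z f u G x).1
  have hk'J : Integrable (fun x => C' * (1 + ‖x‖⁻¹) * jetBound A V z f u G x) volume := by
    refine ((h.integrable_jetBound.add (h.integrable_jetBound_mul_inv hn)).const_mul C').congr
      (Eventually.of_forall fun x => ?_)
    simp only [Pi.add_apply]
    ring
  -- The bounds k · (mollified `jetBound`) converge in integral by the A₁ estimate. This supplies
  -- the convergent sequence of bounds for Pratt's lemma.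
  obtain ⟨j1, j2, j3⟩ := tendsto_integral_mul_mollify hki hk0 h.integrable_jetBound.locallyIntegrable
    hJ0 hC' hk'J
  set M := C * (B + 2 * B * n + 9) with hM
  have hM0 : 0 ≤ B + 2 * B * n + 9 := by positivity
  have hψ : ∀ m, IsTest (fun x => η x * satur N (mollify m (fun y => ‖u y‖ ^ 2) x)) := fun m =>
    ⟨hη.1.mul (contDiff_iff_contDiffAt.2 fun y =>
      (contDiffAt_satur (hne m y)).comp y (hWc m).contDiffAt), hη.2.mul_right⟩
  have hlap : ∀ m x, ∑ j, pd j (pd j (fun x => η x * satur N (mollify m (fun y => ‖u y‖ ^ 2) x))) x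
      = truncLap N η x (mollify m (fun y => ‖u y‖ ^ 2) x) (fun j => mollify m (gradSq A u G j) x)
        (mollify m (lapSq A V z f u G) x) := by
    intro m x
    rw [sum_pd_pd_mul_satur hN (hη.1.of_le two_le_infty) ((hWc m).of_le two_le_infty) (hW0 m),
      h.sum_pd_pd_mollify_sq]
    simp_rw [h.pd_mollify_sq]
  have hlim := (tendsto_integral_of_tendsto_bound (μ := volume)
    (f := fun m x => weight φ θ x * truncLap N η x (mollify m (fun y => ‖u y‖ ^ 2) x)
      (fun j => mollify m (gradSq A u G j) x) (mollify m (lapSq A V z f u G) x))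
    (f' := fun x => weight φ θ x
        * truncLap N η x (‖u x‖ ^ 2) (fun j => gradSq A u G j x) (lapSq A V z f u G x))
    (g := fun m x => M * (k x * mollify m (jetBound A V z f u G) x))
    (g' := fun x => M * (k x * jetBound A V z f u G x)) (fun m => ?_)
    (fun m => (j1 m).const_mul M) (j2.const_mul M) (fun m => ?_) ?_ ?_ ?_).2
  · have h1 : ∀ m, ∫ x, weight φ θ x * truncLap N η x (mollify m (fun y => ‖u y‖ ^ 2) x)
        (fun j => mollify m (gradSq A u G j) x) (mollify m (lapSq A V z f u G) x)
        = 2 * ((∫ x, η x * satur N (mollify m (fun y => ‖u y‖ ^ 2) x) ∂μ₁)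
          - ∫ x, η x * satur N (mollify m (fun y => ‖u y‖ ^ 2) x) ∂μ₂) := fun m => by
      rw [← hμ _ (hψ m)]
      simp_rw [hlap]
    simp_rw [h1] at hlim
    exact tendsto_nhds_unique hlim
      (((h.tendsto_integral_mul_satur (by omega) hL₁ hN hη hη0).sub
        (h.tendsto_integral_mul_satur (by omega) hL₂ hN hη hη0)).const_mul 2)
  · refine (hm.aestronglyMeasurable_weight hn).mul ?_
    simp_rw [← hlap]
    exact (hψ m).sum_pd_pd.1.continuous.aestronglyMeasurable
  · filter_upwards [ae_ne_zero hn] with x hx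
    by_cases hxs : x ∈ tsupport η
    · have hkx : k x = 1 + ‖x‖⁻¹ := by
        simp only [hk]
        rw [indicator_of_mem (hR hxs), mul_one]
      rw [norm_mul, Real.norm_eq_abs, Real.norm_eq_abs, hkx]
      have h1 := mul_le_mul (hC x hx)
        (h.abs_truncLap_mollify_le hN (hη0 x) (hη1 x) (hK1 x) hB0 (hK2 x) m) (abs_nonneg _)
        (by positivity)
      refine h1.trans (le_of_eq ?_)
      rw [hM]
      ring
    · rw [truncLap_eq_zero hxs, mul_zero, norm_zero]
      have := mollify_nonneg hJ0 m x
      have := hk0 x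
      positivity
  · filter_upwards [tendsto_mollify_ae hW, tendsto_mollify_ae h.integrable_lapSq.locallyIntegrable,
      ae_all_iff.2 fun j => tendsto_mollify_ae (h.integrable_gradSq j).locallyIntegrable]
      with x h1 h2 h3
    exact (tendsto_truncLap hN η x (sq_nonneg _) h1 h3 h2).const_mul _
  · filter_upwards [tendsto_mollify_ae h.integrable_jetBound.locallyIntegrable] with x hx
    exact (hx.const_mul _).const_mul _
  · simp_rw [integral_const_mul]
    exact j3.const_mul M

theorem exists_pd_cutoff_smul_le : ∃ K : ℝ, 0 ≤ K ∧ ∀ (m : ℕ) (x : Eu n),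
    (∀ j, |pd j (fun y => cutoff (((m : ℝ) + 1)⁻¹ • y)) x| ≤ K) ∧
    |∑ j, pd j (pd j (fun y => cutoff (((m : ℝ) + 1)⁻¹ • y))) x| ≤ K := by
  obtain ⟨B, R', hB0, hB⟩ := exists_jet_le_indicator (n := n)
    (contDiff_cutoff.of_le two_le_infty) hasCompactSupport_cutoff
  have hjet : ∀ x : Eu n, |cutoff x| + ∑ j, |pd j cutoff x| + |∑ j, pd j (pd j cutoff) x| ≤ B := by
    intro x
    have h0 : 0 ≤ |cutoff x| + ∑ j, |pd j cutoff x| + |∑ j, pd j (pd j cutoff) x| := by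
      have : 0 ≤ ∑ j, |pd j cutoff x| := Finset.sum_nonneg fun _ _ => abs_nonneg _
      positivity
    have h1 : (1 : ℝ) ≤ (1 + ‖x‖) ^ 2 := one_le_pow₀ (by linarith [norm_nonneg x])
    have h2 : (Metric.closedBall (0 : Eu n) R').indicator (fun _ => (1 : ℝ)) x ≤ 1 :=
      indicator_le_self' (fun _ _ => zero_le_one) x
    exact (le_mul_of_one_le_left h0 h1).trans ((hB x).trans (mul_le_of_le_one_right hB0 h2))
  refine ⟨B, hB0, fun m x => ?_⟩
  set c : ℝ := ((m : ℝ) + 1)⁻¹ with hc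
  have hc0 : 0 ≤ c := by positivity
  have hc1 : c ≤ 1 := inv_le_one_of_one_le₀ (by linarith [(m.cast_nonneg : (0 : ℝ) ≤ m)])
  have e1 : ∀ j y, pd j (fun y : Eu n => cutoff (c • y)) y = c * pd j cutoff (c • y) := fun j y =>
    pd_comp_smul c j (contDiff_cutoff.differentiable (by simp) _)
  have d1 : ∀ j y, DifferentiableAt ℝ (pd j (cutoff (n := n))) y := fun j y =>
    (ContDiff_pd (k := 1) (contDiff_cutoff.of_le two_le_infty) (by norm_num) j).differentiable
      (by norm_num) y
  have e2 : ∀ j, pd j (pd j (fun y : Eu n => cutoff (c • y))) x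
      = c * (c * pd j (pd j cutoff) (c • x)) := fun j => by
    have d2 : DifferentiableAt ℝ (fun y : Eu n => pd j cutoff (c • y)) x :=
      (d1 j (c • x)).comp x (differentiableAt_id.const_smul c)
    rw [pd_congr j (Eventually.of_forall (e1 j)), pd_const_mul c j d2,
      pd_comp_smul c j (d1 j _)]
  have hj := hjet (c • x)
  have hs0 : 0 ≤ ∑ j, |pd j cutoff (c • x)| := Finset.sum_nonneg fun _ _ => abs_nonneg _
  refine ⟨fun j => ?_, ?_⟩
  · rw [e1, abs_mul, abs_of_nonneg hc0]
    have := Finset.single_le_sum (f := fun j => |pd j cutoff (c • x)|) (fun _ _ => abs_nonneg _)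
      (Finset.mem_univ j)
    refine (mul_le_of_le_one_left (abs_nonneg _) hc1).trans ?_
    linarith [abs_nonneg (cutoff (c • x)), abs_nonneg (∑ j, pd j (pd j cutoff) (c • x))]
  · simp_rw [e2]
    rw [← Finset.mul_sum, ← Finset.mul_sum, ← mul_assoc, abs_mul,
      abs_of_nonneg (mul_nonneg hc0 hc0)]
    refine (mul_le_of_le_one_left (abs_nonneg _) (mul_le_one₀ hc1 hc0 hc1)).trans ?_
    linarith [abs_nonneg (cutoff (c • x))]

theorem cutoff_smul_eventually_eq_one (x : Eu n) :
    ∀ᶠ m : ℕ in atTop, (fun y => cutoff (((m : ℝ) + 1)⁻¹ • y)) =ᶠ[𝓝 x] fun _ => (1 : ℝ) := by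
  filter_upwards [tendsto_natCast_atTop_atTop.eventually_ge_atTop ‖x‖] with m hm
  have hm1 : (0 : ℝ) < (m : ℝ) + 1 := by positivity
  filter_upwards [Metric.isOpen_ball.mem_nhds
    (show x ∈ Metric.ball (0 : Eu n) ((m : ℝ) + 1) by simp; linarith)] with y hy
  rw [mem_ball_zero_iff] at hy
  refine cutoff_eq_one ?_
  rw [norm_smul, norm_inv, Real.norm_of_nonneg hm1.le, inv_mul_le_iff₀ hm1]
  linarith

theorem tendsto_div_natCast_add (t : ℝ) (ht : 0 ≤ t) :
    Tendsto (fun m : ℕ => ((m : ℝ) + 1) / ((m : ℝ) + 1 + t)) atTop (𝓝 1) := by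
  have h1 : Tendsto (fun m : ℕ => 1 - t / ((m : ℝ) + 1 + t)) atTop (𝓝 (1 - 0)) := by
    refine tendsto_const_nhds.sub (tendsto_const_nhds.div_atTop ?_)
    exact tendsto_atTop_add_const_right _ _
      (tendsto_atTop_add_const_right _ _ tendsto_natCast_atTop_atTop)
  rw [sub_zero] at h1
  refine h1.congr fun m => ?_
  have : (m : ℝ) + 1 + t ≠ 0 := by positivity
  field_simp
  ring

/-- For large m the cutoff is 1 near x, so only the terms with the first and second derivatives of
S_{m+1} at t survive; these derivatives tend to 1 and 0. -/
theorem tendsto_truncLap_cutoff (x : Eu n) {t : ℝ} (ht : 0 ≤ t) (p : Fin n → ℝ) (q : ℝ) :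
    Tendsto (fun m : ℕ => truncLap ((m : ℝ) + 1) (fun y => cutoff (((m : ℝ) + 1)⁻¹ • y)) x t p q)
      atTop (𝓝 q) := by
  have h1 := tendsto_div_natCast_add t ht
  have h2 : Tendsto (fun m : ℕ => ((m : ℝ) + 1 + t)⁻¹) atTop (𝓝 0) :=
    (tendsto_atTop_add_const_right _ _
      (tendsto_atTop_add_const_right _ _ tendsto_natCast_atTop_atTop)).inv_tendsto_atTop
  have h3 := ((h1.pow 2).mul_const q).sub
    ((((h1.pow 2).mul h2).const_mul 2).mul_const (∑ j, p j ^ 2))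
  simp only [one_pow, one_mul, mul_zero, zero_mul, sub_zero] at h3
  refine h3.congr' ?_
  filter_upwards [cutoff_smul_eventually_eq_one x] with m hm
  have e1 : ∀ j, pd j (fun y => cutoff (((m : ℝ) + 1)⁻¹ • y)) x = 0 := fun j => by
    rw [pd_congr j hm, pd_const]
  have e2 : ∀ j, pd j (pd j (fun y => cutoff (((m : ℝ) + 1)⁻¹ • y))) x = 0 := fun j => by
    rw [pd_congr j (pd_eventuallyEq hm j),
      pd_congr j (Eventually.of_forall fun y => pd_const j (1 : ℝ) y), pd_const]
  have e3 := hm.self_of_nhds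
  have : (m : ℝ) + 1 + t ≠ 0 := by positivity
  simp only [truncLap, e1, e2, e3, zero_mul, Finset.sum_const_zero, mul_zero, zero_add, one_mul]
  field_simp

theorem tendsto_integral_cutoff_mul_satur {μ : Measure (Eu n)}
    (hμ : Integrable (fun x => ‖u x‖ ^ 2) μ) :
    Tendsto (fun m : ℕ => ∫ x, cutoff (((m : ℝ) + 1)⁻¹ • x) * satur ((m : ℝ) + 1) (‖u x‖ ^ 2) ∂μ)
      atTop (𝓝 (∫ x, ‖u x‖ ^ 2 ∂μ)) := by
  have hs : ∀ (m : ℕ) (x : Eu n), satur ((m : ℝ) + 1) (‖u x‖ ^ 2)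
      = ((m : ℝ) + 1) / ((m : ℝ) + 1 + ‖u x‖ ^ 2) * ‖u x‖ ^ 2 := fun m x => by
    rw [satur]; ring
  refine tendsto_integral_of_dominated_convergence (fun x => ‖u x‖ ^ 2) (fun m => ?_) hμ
    (fun m => Eventually.of_forall fun x => ?_) (Eventually.of_forall fun x => ?_)
  · refine (contDiff_cutoff_smul _).continuous.aestronglyMeasurable.mul ?_
    simp_rw [hs]
    exact ((hμ.1.aemeasurable.const_add _).const_div _).aestronglyMeasurable.mul hμ.1
  · have hp : (0 : ℝ) < (m : ℝ) + 1 := by positivity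
    have h0 := satur_nonneg hp (sq_nonneg ‖u x‖)
    rw [Real.norm_of_nonneg (mul_nonneg (cutoff_nonneg _) h0)]
    exact (mul_le_of_le_one_left h0 (cutoff_le_one _)).trans (satur_le hp (sq_nonneg _))
  · simp_rw [hs]
    have h1 := (tendsto_div_natCast_add (‖u x‖ ^ 2) (sq_nonneg _)).mul_const (‖u x‖ ^ 2)
    have h2 : Tendsto (fun m : ℕ => cutoff (((m : ℝ) + 1)⁻¹ • x)) atTop (𝓝 1) :=
      tendsto_const_nhds.congr' ((cutoff_smul_eventually_eq_one x).mono fun _ hm =>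
        hm.self_of_nhds.symm)
    simpa using h2.mul h1

/-- Take N = m + 1 and the cutoff at scale m + 1 in the truncated identity. The volume side is
dominated by a multiple of (1 + 1/|x|) `jetBound`, uniformly in m. The measure side is dominated by
|u|², which is integrable for both measures. -/
theorem distributional_term_eq (hn : 3 ≤ n) (h : IsSolution A V z f u G)
    (hm : AdmissibleMultipliers φ θ) {T : ℝ}
    (hT : DistributionalBilaplacianTerm (radial φ) (radial θ) u T) :
    T = 1 / 2 * ∫ x, weight φ θ x * lapSq A V z f u G x := by
  obtain ⟨μ₁, μ₂, hf₁, hf₂, hμ, hi₁, hi₂, hL₁, hL₂, rfl⟩ := hT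
  obtain ⟨C, hC0, hC⟩ := hm.exists_abs_weight_le (n := n)
  obtain ⟨K, hK0, hK⟩ := exists_pd_cutoff_smul_le (n := n)
  have hN : ∀ m : ℕ, (0 : ℝ) < (m : ℝ) + 1 := fun m => by positivity
  have htest : ∀ m : ℕ, IsTest (fun y : Eu n => cutoff (((m : ℝ) + 1)⁻¹ • y)) := fun m =>
    ⟨contDiff_cutoff_smul _, hasCompactSupport_cutoff_smul (inv_ne_zero (hN m).ne')⟩
  have hμ' : ∀ ψ : Eu n → ℝ, IsTest ψ →
      ∫ x, weight φ θ x * ∑ j, pd j (pd j ψ) x = 2 * ((∫ x, ψ x ∂μ₁) - ∫ x, ψ x ∂μ₂) :=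
    fun ψ hψ => by rw [hm.integral_weight_mul_lap hn hψ, hμ ψ hψ]
  have heq := fun m : ℕ => h.integral_weight_mul_truncLap hn hm hμ' hL₁ hL₂ (hN m) (htest m)
    (fun x => cutoff_nonneg _) (fun x => cutoff_le_one _)
  have hJ : Integrable (fun x => C * (K + 2 * K * n + 9) *
      (jetBound A V z f u G x + jetBound A V z f u G x * ‖x‖⁻¹)) volume :=
    (h.integrable_jetBound.add (h.integrable_jetBound_mul_inv hn)).const_mul _
  have hlim : Tendsto (fun m : ℕ => ∫ x, weight φ θ x
        * truncLap ((m : ℝ) + 1) (fun y => cutoff (((m : ℝ) + 1)⁻¹ • y)) x (‖u x‖ ^ 2)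
          (fun j => gradSq A u G j x) (lapSq A V z f u G x)) atTop
      (𝓝 (∫ x, weight φ θ x * lapSq A V z f u G x)) := by
    refine tendsto_integral_of_dominated_convergence _ (fun m => ?_) hJ (fun m => ?_)
      (Eventually.of_forall fun x =>
        (tendsto_truncLap_cutoff x (sq_nonneg _) _ _).const_mul _)
    · exact (hm.aestronglyMeasurable_weight hn).mul (aestronglyMeasurable_truncLap _ (htest m)
        h.integrable_sq.1 (fun j => (h.integrable_gradSq j).1) h.integrable_lapSq.1)
    · filter_upwards [ae_ne_zero hn] with x hx
      rw [norm_mul, Real.norm_eq_abs, Real.norm_eq_abs]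
      have h1 := abs_truncLap_le_jetBound (A := A) (V := V) (z := z) (f := f) (u := u) (G := G)
        (η := fun y => cutoff (((m : ℝ) + 1)⁻¹ • y)) (x := x) (hN m) (cutoff_nonneg _)
        (cutoff_le_one _) (hK m x).1 hK0 (hK m x).2
      have h2 : 0 ≤ C * (1 + ‖x‖⁻¹) := by positivity
      have h3 := mul_le_mul (hC x hx) h1 (abs_nonneg _) h2
      refine h3.trans (le_of_eq ?_)
      ring
  simp_rw [heq] at hlim
  have := tendsto_nhds_unique hlim (((tendsto_integral_cutoff_mul_satur hi₁).sub
    (tendsto_integral_cutoff_mul_satur hi₂)).const_mul 2)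
  rw [this]
  ring

end IsSolution

end Limit

/-! ### The classical term as a special case of the distributional one -/

section Classical

theorem ae_isLebesguePoint {w : Eu n → ℝ} (hw : LocallyIntegrable w volume) :
    ∀ᵐ x, IsLebesguePoint w x := by
  -- Dimension zero is treated separately, since the comparison of open and closed balls needs
  -- spheres to be null sets. There the oscillation vanishes identically.
  rcases Nat.eq_zero_or_pos n with rfl | hn
  · refine Eventually.of_forall fun x => ?_
    have : ∀ y : Eu 0, |w y - w x| = 0 := fun y => by simp [Subsingleton.elim y x]
    simp [IsLebesguePoint, this]
  · filter_upwards [IsUnifLocDoublingMeasure.ae_tendsto_average_norm_sub volume hw 1] with x hx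
    have := hx (l := 𝓝[>] (0 : ℝ)) (fun _ => x) (fun ρ => ρ) tendsto_id (by
      filter_upwards [self_mem_nhdsWithin] with ρ hρ
      exact Metric.mem_closedBall_self (by simpa using le_of_lt hρ))
    simp_rw [IsLebesguePoint, average_ball_eq_average_closedBall hn.ne']
    exact this

theorem isFiniteMeasureOnCompacts_withDensity {d : Eu n → ℝ} (hd : Continuous d) :
    IsFiniteMeasureOnCompacts ((volume : Measure (Eu n)).withDensity fun x => ENNReal.ofReal (d x)) := by
  refine ⟨fun K hK => ?_⟩
  rw [withDensity_apply _ hK.measurableSet]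
  exact (hd.continuousOn.integrableOn_compact hK).lintegral_lt_top

theorem integrable_withDensity_ofReal {d g : Eu n → ℝ} (hd : Continuous d)
    (hg : AEStronglyMeasurable g volume) (hdg : Integrable (fun x => d x * g x) volume) :
    Integrable g (volume.withDensity fun x => ENNReal.ofReal (d x)) ∧
    Integrable (fun x => max (d x) 0 * g x) volume ∧
    ∫ x, g x ∂(volume.withDensity fun x => ENNReal.ofReal (d x)) = ∫ x, max (d x) 0 * g x := by
  have hm : Measurable fun x => ENNReal.ofReal (d x) := hd.measurable.ennreal_ofReal
  have hlt : ∀ᵐ x : Eu n, ENNReal.ofReal (d x) < ⊤ :=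
    Eventually.of_forall fun x => ENNReal.ofReal_lt_top
  have hi : Integrable (fun x => max (d x) 0 * g x) volume := by
    refine hdg.mono ((hd.max continuous_const).aestronglyMeasurable.mul hg)
      (Eventually.of_forall fun x => ?_)
    rw [norm_mul, norm_mul, Real.norm_of_nonneg (le_max_right _ _), Real.norm_eq_abs (d x)]
    gcongr
    exact max_le (le_abs_self _) (abs_nonneg _)
  have he : ∀ x, (ENNReal.ofReal (d x)).toReal • g x = max (d x) 0 * g x := fun x => by
    rw [ENNReal.toReal_ofReal', smul_eq_mul]
  refine ⟨?_, hi, ?_⟩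
  · rw [integrable_withDensity_iff_integrable_smul' hm hlt]
    simp_rw [he]
    exact hi
  · rw [integral_withDensity_eq_integral_toReal_smul hm hlt]
    simp_rw [he]

/-- A continuous signed density as a difference of two positive measures. -/
theorem integral_withDensity_sub {d g : Eu n → ℝ} (hd : Continuous d)
    (hg : AEStronglyMeasurable g volume) (hdg : Integrable (fun x => d x * g x) volume) :
    (∫ x, g x ∂(volume.withDensity fun x => ENNReal.ofReal (d x)))
      - ∫ x, g x ∂(volume.withDensity fun x => ENNReal.ofReal (-d x)) = ∫ x, d x * g x := by
  obtain ⟨-, i1, e1⟩ := integrable_withDensity_ofReal hd hg hdg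
  obtain ⟨-, i2, e2⟩ := integrable_withDensity_ofReal (d := fun x => -d x) hd.neg hg
    (hdg.neg.congr (Eventually.of_forall fun x => by simp))
  rw [e1, e2, ← integral_sub i1 i2]
  refine integral_congr_ae (Eventually.of_forall fun x => ?_)
  simp only [← sub_mul]
  congr 1
  rcases le_total 0 (d x) with h | h
  · rw [max_eq_left h, max_eq_right (by linarith), sub_zero]
  · rw [max_eq_right h, max_eq_left (by linarith)]
    ring

theorem integral_mul_sum_pd_pd {g ψ : Eu n → ℝ} (hg : ContDiff ℝ 2 g) (hψ : ContDiff ℝ 2 ψ)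
    (hc : HasCompactSupport ψ) :
    ∫ x, g x * ∑ j, pd j (pd j ψ) x = ∫ x, (∑ j, pd j (pd j g) x) * ψ x := by
  have hg' : ∀ j, ContDiff ℝ 1 (pd j g) := ContDiff_pd hg (by norm_num)
  have hψ' : ∀ j, ContDiff ℝ 1 (pd j ψ) := ContDiff_pd hψ (by norm_num)
  simp_rw [Finset.mul_sum, Finset.sum_mul]
  rw [integral_finsetSum _ fun j _ => ?_, integral_finsetSum _ fun j _ => ?_]
  · refine Finset.sum_congr rfl fun j _ => ?_
    rw [integral_mul_pd (hg.of_le one_le_two) (hψ' j) (HasCompactSupport_pd hc j),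
      integral_mul_pd (hg' j) (hψ.of_le one_le_two) hc, neg_neg]
  · exact ((continuous_pd (hg' j) j).mul hψ.continuous).integrable_of_hasCompactSupport hc.mul_left
  · exact (hg.continuous.mul (continuous_pd (hψ' j) j)).integrable_of_hasCompactSupport
      (HasCompactSupport_pd (HasCompactSupport_pd hc j) j).mul_left

theorem ContDiff.laplacian_eq {g : Eu n → ℝ} (hg : ContDiff ℝ 2 g) :
    Laplacian.laplacian g = fun x => ∑ j, pd j (pd j g) x :=
  funext fun _ => laplacian_eq_sum_pd hg.contDiffAt

theorem contDiff_sum_pd_pd {g : Eu n → ℝ} {k m : WithTop ℕ∞} (hg : ContDiff ℝ m g)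
    (hk : k + 1 + 1 ≤ m) : ContDiff ℝ k (fun x => ∑ j, pd j (pd j g) x) :=
  ContDiff.sum fun j _ => ContDiff_pd (ContDiff_pd hg hk j) le_rfl j

/-- The continuous density ¼Δ²Φ − ½ΔΘ is split into its positive and negative parts. The resulting
measures are absolutely continuous, so almost every point for each of them is a Lebesgue point of
|u|². Ordinary integration by parts identifies the density with the distribution. -/
theorem ClassicalBilaplacianTerm.distributional {Φ Θ : Eu n → ℝ} {u : Eu n → ℂ} {T : ℝ}
    (hu : Integrable (fun x => ‖u x‖ ^ 2) volume) (h : ClassicalBilaplacianTerm Φ Θ u T) :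
    DistributionalBilaplacianTerm Φ Θ u T := by
  obtain ⟨hΦ, hΘ, hi, rfl⟩ := h
  have hΦ2 : ContDiff ℝ 2 Φ := hΦ.of_le (by norm_num)
  have hL : ContDiff ℝ 2 (fun x => ∑ j, pd j (pd j Φ) x) := contDiff_sum_pd_pd hΦ (by norm_num)
  set d : Eu n → ℝ := fun x => (1 / 4) * Laplacian.laplacian (Laplacian.laplacian Φ) x
      - (1 / 2) * Laplacian.laplacian Θ x with hd
  have hLL : Continuous (Laplacian.laplacian (Laplacian.laplacian Φ)) := by
    rw [ContDiff.laplacian_eq hΦ2, ContDiff.laplacian_eq hL]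
    exact (contDiff_sum_pd_pd (k := 0) hL (by norm_num)).continuous
  have hLΘ : Continuous (Laplacian.laplacian Θ) := by
    rw [ContDiff.laplacian_eq hΘ]
    exact (contDiff_sum_pd_pd (k := 0) hΘ (by norm_num)).continuous
  have hdc : Continuous d := (hLL.const_mul _).sub (hLΘ.const_mul _)
  have hleb := ae_isLebesguePoint hu.locallyIntegrable
  refine ⟨volume.withDensity fun x => ENNReal.ofReal (d x),
    volume.withDensity fun x => ENNReal.ofReal (-d x), isFiniteMeasureOnCompacts_withDensity hdc,
    isFiniteMeasureOnCompacts_withDensity hdc.neg, fun ψ hψ => ?_,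
    (integrable_withDensity_ofReal hdc hu.1 hi).1,
    (integrable_withDensity_ofReal (d := fun x => -d x) hdc.neg hu.1
      (hi.neg.congr (Eventually.of_forall fun x => by simp only [hd, Pi.neg_apply]; ring))).1,
    (withDensity_absolutelyContinuous _ _).ae_le hleb,
    (withDensity_absolutelyContinuous _ _).ae_le hleb, (integral_withDensity_sub hdc hu.1 hi).symm⟩
  have hψ2 : ContDiff ℝ 2 ψ := hψ.1.of_le two_le_infty
  have hg := hψ.sum_pd_pd
  have hg2 : ContDiff ℝ 2 (fun x => ∑ j, pd j (pd j ψ) x) := hg.1.of_le two_le_infty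
  have e1 := integral_mul_sum_pd_pd hΦ2 hg2 hg.2
  rw [integral_mul_sum_pd_pd hL hψ2 hψ.2] at e1
  have e2 := integral_mul_sum_pd_pd hΘ hψ2 hψ.2
  have hgg := hg.sum_pd_pd
  have j1 : Integrable (fun x => Φ x * ∑ j, pd j (pd j fun x => ∑ j, pd j (pd j ψ) x) x) volume :=
    (hΦ.continuous.mul hgg.1.continuous).integrable_of_hasCompactSupport hgg.2.mul_left
  have j2 : Integrable (fun x => Θ x * ∑ j, pd j (pd j ψ) x) volume :=
    (hΘ.continuous.mul hg.1.continuous).integrable_of_hasCompactSupport hg.2.mul_left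
  have j3 : Integrable (fun x => Laplacian.laplacian (Laplacian.laplacian Φ) x * ψ x) volume :=
    (hLL.mul hψ.1.continuous).integrable_of_hasCompactSupport hψ.2.mul_left
  have j4 : Integrable (fun x => Laplacian.laplacian Θ x * ψ x) volume :=
    (hLΘ.mul hψ.1.continuous).integrable_of_hasCompactSupport hψ.2.mul_left
  have j5 : Integrable (fun x => d x * ψ x) volume :=
    (hdc.mul hψ.1.continuous).integrable_of_hasCompactSupport hψ.2.mul_left
  rw [integral_withDensity_sub hdc hψ.1.continuous.aestronglyMeasurable j5]
  have e3 : ∫ x, d x * ψ x = 1 / 4 * (∫ x, Laplacian.laplacian (Laplacian.laplacian Φ) x * ψ x)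
      - 1 / 2 * ∫ x, Laplacian.laplacian Θ x * ψ x := by
    rw [← integral_const_mul, ← integral_const_mul,
      ← integral_sub (j3.const_mul _) (j4.const_mul _)]
    refine integral_congr_ae (Eventually.of_forall fun x => ?_)
    simp only [hd]
    ring
  rw [e3, ContDiff.laplacian_eq hΘ, ContDiff.laplacian_eq hΦ2, ContDiff.laplacian_eq hL,
    ContDiff.laplacian_eq hψ2, ContDiff.laplacian_eq hg2, ← e1, ← e2, ← integral_const_mul,
    ← integral_const_mul, ← integral_sub (j1.const_mul _) (j2.const_mul _)]
  refine integral_congr_ae (Eventually.of_forall fun x => ?_)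
  simp only
  ring

end Classical

end MagneticMorawetz

end

/-! ### Conclusion: the Morawetz identity -/

theorem lemma2p1 {n : ℕ} (hn : 3 ≤ n)
    (A : MagneticMorawetz.Eu n → MagneticMorawetz.Eu n) (hA : ContDiff ℝ 1 A)
    (V : MagneticMorawetz.Eu n → ℝ) (hV : ContDiff ℝ 1 V)
    (lam ε s : ℝ) (hlam : 0 ≤ lam) (hε : ε ≠ 0) (hs : s = 1 ∨ s = -1)
    (f : MagneticMorawetz.Eu n → ℂ) (hf : MemLp f 2 volume)
    (u : MagneticMorawetz.Eu n → ℂ) (G : Fin n → MagneticMorawetz.Eu n → ℂ)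
    (hu : MagneticMorawetz.IsFormDomain A V u G)
    (hsol : MagneticMorawetz.IsWeakSolution A V ((lam : ℂ) + (s : ℂ) * (ε : ℂ) * Complex.I) f u G)
    (φ θ : ℝ → ℝ) (hφθ : MagneticMorawetz.AdmissibleMultipliers φ θ)
    (hVint : Integrable
      (fun x => deriv φ ‖x‖ * MagneticMorawetz.radialDeriv V x * ‖u x‖ ^ 2) volume)
    (hBint : Integrable
      (fun x => ((deriv φ ‖x‖ : ℝ) : ℂ) * u x * MagneticMorawetz.tangTerm A u G x) volume)
    (hfint : Integrable
      (fun x => f x * MagneticMorawetz.gradTerm (MagneticMorawetz.radial φ) A u G x) volume)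
    (huint : Integrable
      (fun x => u x * MagneticMorawetz.gradTerm (MagneticMorawetz.radial φ) A u G x) volume) :
    Integrable (MagneticMorawetz.hessTerm (MagneticMorawetz.radial φ) A u G) volume ∧
    Integrable (fun x => θ ‖x‖ * MagneticMorawetz.magGradSq A u G x) volume ∧
    Integrable (fun x => ((1 / 2) * deriv φ ‖x‖ * MagneticMorawetz.radialDeriv V x
      + θ ‖x‖ * V x) * ‖u x‖ ^ 2) volume ∧
    Integrable (fun x => θ ‖x‖ * ‖u x‖ ^ 2) volume ∧
    Integrable (fun x => f x * (MagneticMorawetz.gradTerm (MagneticMorawetz.radial φ) A u G x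
      + (1 / 2) * ((Laplacian.laplacian (MagneticMorawetz.radial φ) x : ℝ) : ℂ) * star (u x))) volume ∧
    Integrable (fun x => f x * ((θ ‖x‖ : ℝ) : ℂ) * star (u x)) volume ∧
    ∀ T : ℝ,
      (MagneticMorawetz.ClassicalBilaplacianTerm
          (MagneticMorawetz.radial φ) (MagneticMorawetz.radial θ) u T ∨
        MagneticMorawetz.DistributionalBilaplacianTerm
          (MagneticMorawetz.radial φ) (MagneticMorawetz.radial θ) u T) →
      (∫ x, MagneticMorawetz.hessTerm (MagneticMorawetz.radial φ) A u G x)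
        - (∫ x, θ ‖x‖ * MagneticMorawetz.magGradSq A u G x)
        - T
        - (∫ x, ((1 / 2) * deriv φ ‖x‖ * MagneticMorawetz.radialDeriv V x
            + θ ‖x‖ * V x) * ‖u x‖ ^ 2)
        + (∫ x, ((deriv φ ‖x‖ : ℝ) : ℂ) * u x * MagneticMorawetz.tangTerm A u G x).im
        + lam * (∫ x, θ ‖x‖ * ‖u x‖ ^ 2)
      = - (∫ x, f x * (MagneticMorawetz.gradTerm (MagneticMorawetz.radial φ) A u G x
            + (1 / 2) * ((Laplacian.laplacian (MagneticMorawetz.radial φ) x : ℝ) : ℂ) * star (u x))).re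
        + (∫ x, f x * ((θ ‖x‖ : ℝ) : ℂ) * star (u x)).re
        - s * ε * (∫ x, u x
            * MagneticMorawetz.gradTerm (MagneticMorawetz.radial φ) A u G x).im := by
  have h : MagneticMorawetz.IsSolution A V ((lam : ℂ) + (s : ℂ) * (ε : ℂ) * Complex.I) f u G :=
    ⟨hA, hV, hf, hu, hsol⟩
  have hre : ((lam : ℂ) + (s : ℂ) * (ε : ℂ) * Complex.I).re = lam := by simp
  have him : ((lam : ℂ) + (s : ℂ) * (ε : ℂ) * Complex.I).im = s * ε := by simp
  obtain ⟨i1, i2, i3, i4, i5, i6, -, e⟩ := h.integral_identity hn hφθ hVint hBint hfint huint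
  rw [hre, him] at e
  refine ⟨i1, i2, i3, i4, i5, i6, fun T hT => ?_⟩
  -- Both meanings of the third integral reduce to the distributional one, which equals ½∫ (½Δφ − θ)
  -- `lapSq`, the term appearing in `integral_identity`.
  have hT' : MagneticMorawetz.DistributionalBilaplacianTerm
      (MagneticMorawetz.radial φ) (MagneticMorawetz.radial θ) u T :=
    hT.elim (MagneticMorawetz.ClassicalBilaplacianTerm.distributional h.integrable_sq) id
  have hT2 := h.distributional_term_eq hn hφθ hT'
  simp only [MagneticMorawetz.weight] at hT2
  rw [hT2]
  exact e
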